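/- **Conventions.** All objects depend on a security parameter $n$. Polynomial-time algorithms are families of polynomial-size circuits: classical circuits with uniform coin bits (PPT), respectively quantum circuits over $\{\mathrm{X},\mathrm{CNOT},\mathrm{Toffoli},\mathrm{H},\mathrm{T}\}$ (QPT), possibly with oracle gates $|\xi\rangle|y\rangle\mapsto|\xi\rangle|y\oplus H(\xi)\rangle$ of unit cost. A function $f:\mathbb N\to\mathbb R$ is negligible if $n^d f(n)\to 0$ for all $d\in\mathbb N$. **Σ-protocols.** Let $\Sigma=(P_1,P_2,V)$ be a Σ-protocol for a relation $R$, with polynomial-length instances, witnesses and messages: $(a,\mathsf{st})\leftarrow P_1(x,w)$, a uniform challenge $c\in\mathcal C_n=\{0,\dots,N(n)-1\}$, $z\leftarrow P_2(\mathsf{st},c)$, and a deterministic verdict $V(x,a,c,z)$, all in polynomial time. It is perfectly complete and specially sound (a PPT extractor always computes a witness from two accepting transcripts with equal $a$ and different challenges). Assume moreover: * *Unique responses:* for all $x,a$, all $c\in\mathcal C_n$ and all $z\ne z'$, $V$ rejects $(a,c,z)$ or $(a,c,z')$. * *Special honest-verifier zero-knowledge:* there is a PPT $\mathsf{Sim}_\Sigma$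 such that every QPT $\mathcal D=(\mathcal D_0,\mathcal D_1)$ has only a negligible difference between the probabilities of the event "$(x,w)\in R$ and $\mathcal D_1(a,c,z,\mathsf{st})=1$", where $(x,w,\mathsf{st})\leftarrow\mathcal D_0$ and $(a,c,z)$ is either an honest transcript for $(x,w)$, or is obtained from a uniform $c\in\mathcal C_n$ and $(a,z)\leftarrow\mathsf{Sim}_\Sigma(x,c)$. * *Commitment entropy $\alpha(n)\ge 0$:* for all $(x,w)\in R$ the commitment $a$ output by $P_1(x,w)$ has min-entropy $H_\infty(a)\ge\alpha(n)$. **Fischlin transform.** Let $k,\ell$ and $N$ be polynomially bounded functions of $n$ and let $t+2\le N$. Let $H$ be a random oracle with values in $\{0,1\}^{\ell}$, defined on (bit strings encoding) tuples $(\mathbf a,i,c,z)$. On input $(x,w)$ the prover of $\mathsf{Fis}[\Sigma]$ computes $(a_i,\mathsf{st}_i)\leftarrow P_1(x,w)$ for $i=1,\dots,k$ and sets $\mathbf a=(a_i)_i$. For every $i$ it then tries $c=0,1,\dots,t+1$ in this order, with a response $z\leftarrow P_2(\mathsf{st}_i,c)$ in each attempt, until $H(\mathbf a,i,c,z)=0^\ell$,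 and puts $c_i=c$, $z_i=z$. If no attempt succeeds for some $i$ it aborts (its output is an abort symbol). Otherwise it outputs $\pi=(\mathbf a,\mathbf c,\mathbf z)$. **Theorem.** If $2^{-k(n)\alpha(n)}$ is negligible, then $\mathsf{Fis}[\Sigma]$ is zero-knowledge in the quantum random oracle model. That is, there is a PPT simulator $\mathsf{Sim}$, which has no access to $H$ and which on input $x$ outputs a proof $\pi$ and instructions for a polynomial-time computable reprogramming of $H$ to an oracle $H'$ (a deterministic polynomial-size circuit decides from the instructions and a point $\xi$ whether $H'(\xi)=H(\xi)$ or $H'(\xi)$ is a new value, which it computes), such that for every QPT distinguisher $\mathcal D=(\mathcal D_0,\mathcal D_1)$ with quantum oracle access $$\Big|\Pr\big[(x,w)\in R\wedge\mathcal D_1^{H}(\pi,\mathsf{st})=1:\ (x,w,\mathsf{st})\leftarrow\mathcal D_0^{H},\ \pi\leftarrow P_{\mathsf{Fis}[\Sigma]}^{H}(x,w)\big]$$ $$-\Pr\big[(x,w)\in R\wedge\mathcal D_1^{H'}(\pi,\mathsf{st})=1:\ (x,w,\mathsf{st})\leftarrow\mathcal D_0^{H},\ (H',\pi)\leftarrow\mathsf{Sim}(x)\big]\Big|$$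 is negligible, where $H$ is a uniformly random function and $\mathsf{st}$ may be a quantum state. -/

import Mathlib

open scoped BigOperators

/-! Asymptotics -/

/-- At most a polynomial in the security parameter. -/
def PolyBounded (f : ℕ → ℕ) : Prop :=
  ∃ p : Polynomial ℕ, ∀ n, f n ≤ p.eval n

/-- Negligible: eventually below every inverse polynomial in absolute value. -/
def Negligible (f : ℕ → ℝ) : Prop :=
  Asymptotics.SuperpolynomialDecay Filter.atTop (fun n : ℕ => (n : ℝ)) f

/-! Bit strings, indexed by a set of positions -/

abbrev Bits (I : Type) : Type := I → Bool

/-- The binary representation (least significant bit first) of `c` with `m` bits. -/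
def natBits (m c : ℕ) : Bits (Fin m) := fun j => c.testBit j

/-! Classical circuits -/

/-- Classical reversible gates on a set `W` of wires; the last wire is the target. A Toffoli gate
with a target that holds 0 computes a conjunction, so with zero-initialised ancilla wires these
gates express every Boolean circuit with linear overhead. -/
inductive CGate (W : Type) : Type
  | not (t : W) : CGate W
  | cnot (c t : W) (h : c ≠ t) : CGate W
  | toffoli (c d t : W) (hc : c ≠ t) (hd : d ≠ t) : CGate W

/-- The action on assignments of the wires. Each gate is an involution. -/
def CGate.apply {W : Type} [DecidableEq W] : CGate W → Bits W → Bits W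
  | .not t, b => Function.update b t (!(b t))
  | .cnot c t _, b => Function.update b t (xor (b t) (b c))
  | .toffoli c d t _ _, b => Function.update b t (xor (b t) (b c && b d))

/-- A deterministic circuit with input positions `I` and output positions `O`: it acts on the input
wires and on `anc` ancilla wires that start as 0, and finally reads each output bit from a wire. -/
structure Circuit (I O : Type) : Type where
  anc : ℕ
  gates : List (CGate (I ⊕ Fin anc))
  out : O → I ⊕ Fin anc

def Circuit.run {I O : Type} [DecidableEq I] (C : Circuit I O) (x : Bits I) : Bits O :=
  fun o => (C.gates.foldl (fun b g => g.apply b) (Sum.elim x fun _ => false)) (C.out o)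

def Circuit.size {I O : Type} (C : Circuit I O) : ℕ := C.gates.length + C.anc

/-- A randomized circuit: a circuit that also receives `coins` many uniform random bits. -/
structure RandCircuit (I O : Type) : Type where
  coins : ℕ
  circ : Circuit (I ⊕ Fin coins) O

abbrev RandCircuit.Coins {I O : Type} (C : RandCircuit I O) : Type := Bits (Fin C.coins)

def RandCircuit.run {I O : Type} [DecidableEq I] (C : RandCircuit I O) (x : Bits I)
    (r : C.Coins) : Bits O :=
  C.circ.run (Sum.elim x r)

def RandCircuit.size {I O : Type} (C : RandCircuit I O) : ℕ := C.circ.size + C.coins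

/-! Quantum circuits with oracle gates. The state of a set `W` of qubits is its vector of
amplitudes, indexed by the computational basis. -/

abbrev QState (W : Type) : Type := Bits W → ℂ

/-- The gates: classical reversible gates, the Hadamard gate, the gate `T = diag(1, e^{iπ/4})`, and
a query to an oracle `{0,1}^I → {0,1}^O` with the input and output registers placed on pairwise
distinct wires. -/
inductive QGate (I O W : Type) : Type
  | classical (g : CGate W) : QGate I O W
  | hadamard (t : W) : QGate I O W
  | phaseT (t : W) : QGate I O W
  | query (e : (I ⊕ O) ↪ W) : QGate I O W

open Classical in
/-- The basis permutation `|ξ⟩|y⟩ ↦ |ξ⟩|y ⊕ H(ξ)⟩` on the registers given by `e`. -/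
noncomputable def queryPerm {I O W : Type} (H : Bits I → Bits O) (e : (I ⊕ O) ↪ W) (b : Bits W) :
    Bits W :=
  fun v => if h : ∃ o : O, e (Sum.inr o) = v then
      xor (b v) (H (fun i => b (e (Sum.inl i))) h.choose)
    else b v

/-- The unitary of a gate. A gate that permutes the basis is an involution, so it acts on
amplitudes by composition. -/
noncomputable def QGate.apply {I O W : Type} [DecidableEq W] (H : Bits I → Bits O) :
    QGate I O W → QState W → QState W
  | .classical g, ψ => fun b => ψ (g.apply b)
  | .hadamard t, ψ => fun b =>
      (ψ (Function.update b t false) + (if b t then -1 else 1) * ψ (Function.update b t true)) /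
        (Real.sqrt 2 : ℂ)
  | .phaseT t, ψ => fun b =>
      (if b t then Complex.exp (Complex.I * (Real.pi / 4 : ℝ)) else 1) * ψ b
  | .query e, ψ => fun b => ψ (queryPerm H e b)

noncomputable def runGates {I O W : Type} [DecidableEq W] (H : Bits I → Bits O)
    (gs : List (QGate I O W)) (ψ : QState W) : QState W :=
  gs.foldl (fun φ g => g.apply H φ) ψ

/-- A two-stage quantum distinguisher `(D₀, D₁)` with access to an oracle `{0,1}^I → {0,1}^O`.
`D₀` starts with all qubits 0 and runs on an instance register `X`, a witness register `W`
and `mem` further qubits. The first two registers are measured, which gives `(x, w)`; the state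
handed over is the content of all three registers afterwards. `D₁` receives it together with a
bit string with positions `Y` and `anc` ancilla qubits, and outputs the measured qubit `out`. -/
structure Distinguisher (I O X W Y : Type) : Type where
  mem : ℕ
  anc : ℕ
  first : List (QGate I O (X ⊕ W ⊕ Fin mem))
  second : List (QGate I O ((X ⊕ W ⊕ Fin mem) ⊕ Y ⊕ Fin anc))
  out : (X ⊕ W ⊕ Fin mem) ⊕ Y ⊕ Fin anc

def Distinguisher.size {I O X W Y : Type} (D : Distinguisher I O X W Y) : ℕ :=
  D.mem + D.anc + D.first.length + D.second.length

/-- The final unnormalised state of `D₀`, with oracle `H`, projected on the outcome `(x, w)`. -/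
noncomputable def Distinguisher.midState {I O X W Y : Type} [Fintype X] [DecidableEq X] [Fintype W]
    [DecidableEq W] (D : Distinguisher I O X W Y) (H : Bits I → Bits O) (x : Bits X) (w : Bits W) :
    QState (X ⊕ W ⊕ Fin D.mem) := fun b =>
  if (fun i => b (Sum.inl i)) = x ∧ (fun i => b (Sum.inr (Sum.inl i))) = w then
    runGates H D.first (Pi.single (fun _ => false) 1) b
  else 0

/-- The final unnormalised state of `D₁`, with oracle `H'` and input `y`, after `D₀`, with oracle
`H`, has output `(x, w)`. -/
noncomputable def Distinguisher.finalState {I O X W Y : Type} [Fintype X] [DecidableEq X]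
    [Fintype W] [DecidableEq W] [Fintype Y] [DecidableEq Y] (D : Distinguisher I O X W Y)
    (H H' : Bits I → Bits O) (x : Bits X) (w : Bits W) (y : Bits Y) :
    QState ((X ⊕ W ⊕ Fin D.mem) ⊕ Y ⊕ Fin D.anc) :=
  runGates H' D.second fun b =>
    if (fun i => b (Sum.inr (Sum.inl i))) = y ∧ (fun i => b (Sum.inr (Sum.inr i))) = fun _ => false
    then D.midState H x w (fun v => b (Sum.inl v))
    else 0

/-- The probability that `D₀`, with oracle `H`, outputs `(x, w)` and that then `D₁`, with oracle
`H'` and input `y`, outputs 1. -/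
noncomputable def Distinguisher.prob {I O X W Y : Type} [Fintype X] [DecidableEq X] [Fintype W]
    [DecidableEq W] [Fintype Y] [DecidableEq Y] (D : Distinguisher I O X W Y)
    (H H' : Bits I → Bits O) (x : Bits X) (w : Bits W) (y : Bits Y) : ℝ :=
  ∑ b, if b D.out then ‖D.finalState H H' x w y b‖ ^ 2 else 0

/-! Three-round public-coin protocols -/

/-- Syntax of a three-round public-coin protocol for a relation. All lengths depend on the security
parameter `n`. The challenge space is `{0, …, numCh n - 1}`, in binary. -/
structure ThreeRound : Type where
  lenX : ℕ → ℕ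
  lenW : ℕ → ℕ
  lenA : ℕ → ℕ
  lenS : ℕ → ℕ
  lenZ : ℕ → ℕ
  numCh : ℕ → ℕ
  rel : ∀ n, Bits (Fin (lenX n)) → Bits (Fin (lenW n)) → Prop
  prover₁ : ∀ n, RandCircuit (Fin (lenX n) ⊕ Fin (lenW n)) (Fin (lenA n) ⊕ Fin (lenS n))
  prover₂ : ∀ n, RandCircuit (Fin (lenS n) ⊕ Fin (numCh n).size) (Fin (lenZ n))
  verifier : ∀ n,
    Circuit (Fin (lenX n) ⊕ Fin (lenA n) ⊕ Fin (numCh n).size ⊕ Fin (lenZ n)) Unit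

namespace ThreeRound

variable (S : ThreeRound) (n : ℕ)

abbrev Inst : Type := Bits (Fin (S.lenX n))
abbrev Wit : Type := Bits (Fin (S.lenW n))
abbrev Com : Type := Bits (Fin (S.lenA n))
abbrev St : Type := Bits (Fin (S.lenS n))
abbrev Chal : Type := Bits (Fin (S.numCh n).size)
abbrev Resp : Type := Bits (Fin (S.lenZ n))

/-- Positions of a transcript `(a, c, z)`. -/
abbrev TrPos : Type := Fin (S.lenA n) ⊕ Fin (S.numCh n).size ⊕ Fin (S.lenZ n)

/-- The bit string that represents a challenge. -/
def chal (c : ℕ) : S.Chal n := natBits (S.numCh n).size c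

/-- The commitment that the prover computes from `(x, w)` and its coins. -/
def commit (x : S.Inst n) (w : S.Wit n) (r : (S.prover₁ n).Coins) : S.Com n :=
  fun i => (S.prover₁ n).run (Sum.elim x w) r (Sum.inl i)

/-- The state that the prover keeps. -/
def state (x : S.Inst n) (w : S.Wit n) (r : (S.prover₁ n).Coins) : S.St n :=
  fun i => (S.prover₁ n).run (Sum.elim x w) r (Sum.inr i)

/-- The response to a challenge. -/
def respond (st : S.St n) (c : ℕ) (r : (S.prover₂ n).Coins) : S.Resp n :=
  (S.prover₂ n).run (Sum.elim st (S.chal n c)) r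

/-- The verdict on the transcript `(a, c, z)`. -/
def accepts (x : S.Inst n) (a : S.Com n) (c : S.Chal n) (z : S.Resp n) : Bool :=
  (S.verifier n).run (Sum.elim x (Sum.elim a (Sum.elim c z))) ()

/-- Prover and verifier run in polynomial time and all strings have polynomial length. -/
def Efficient : Prop :=
  PolyBounded S.lenX ∧ PolyBounded S.lenW ∧ PolyBounded S.lenA ∧ PolyBounded S.lenS ∧
  PolyBounded S.lenZ ∧ PolyBounded (fun n => (S.numCh n).size) ∧
  PolyBounded (fun n => (S.prover₁ n).size) ∧ PolyBounded (fun n => (S.prover₂ n).size) ∧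
  PolyBounded (fun n => (S.verifier n).size)

def Complete : Prop :=
  ∀ n (x : S.Inst n) (w : S.Wit n), S.rel n x w →
    ∀ (r₁ : (S.prover₁ n).Coins) (c : Fin (S.numCh n)) (r₂ : (S.prover₂ n).Coins),
      S.accepts n x (S.commit n x w r₁) (S.chal n c)
        (S.respond n (S.state n x w r₁) c r₂) = true

/-- A polynomial-time extractor computes a witness from any two accepting transcripts with the same
commitment and different challenges. -/
def SpeciallySound : Prop :=
  ∃ E : ∀ n, RandCircuit (Fin (S.lenX n) ⊕ Fin (S.lenA n) ⊕
      (Fin (S.numCh n).size ⊕ Fin (S.lenZ n)) ⊕ (Fin (S.numCh n).size ⊕ Fin (S.lenZ n)))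
      (Fin (S.lenW n)),
    PolyBounded (fun n => (E n).size) ∧
    ∀ n (x : S.Inst n) (a : S.Com n) (c c' : Fin (S.numCh n)) (z z' : S.Resp n), c ≠ c' →
      S.accepts n x a (S.chal n c) z = true → S.accepts n x a (S.chal n c') z' = true →
      ∀ r : (E n).Coins, S.rel n x ((E n).run (Sum.elim x (Sum.elim a
        (Sum.elim (Sum.elim (S.chal n c) z) (Sum.elim (S.chal n c') z')))) r)

/-- The protocol is a Σ-protocol for its relation. -/
structure IsSigmaProtocol : Prop where
  efficient : S.Efficient
  complete : S.Complete
  sound : S.SpeciallySound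

def UniqueResponses : Prop :=
  ∀ n (x : S.Inst n) (a : S.Com n) (c : Fin (S.numCh n)) (z z' : S.Resp n), z ≠ z' →
    S.accepts n x a (S.chal n c) z = false ∨ S.accepts n x a (S.chal n c) z' = false

end ThreeRound

/-- The min-entropy of a finitely supported probability mass function. -/
noncomputable def minEntropy {A : Type} (p : A → ℝ) : ℝ := -Real.logb 2 (⨆ a, p a)

/-- The distribution of the first message of the prover. -/
noncomputable def ThreeRound.commitDist (S : ThreeRound) (n : ℕ) (x : S.Inst n) (w : S.Wit n)
    (a : S.Com n) : ℝ :=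
  𝔼 r : (S.prover₁ n).Coins, if S.commit n x w r = a then 1 else 0

/-- For each security parameter `n` the commitments have min-entropy at least `α n`. -/
def ThreeRound.HasCommitmentEntropy (S : ThreeRound) (α : ℕ → ℝ) : Prop :=
  ∀ n, 0 ≤ α n ∧ ∀ (x : S.Inst n) (w : S.Wit n), S.rel n x w →
    α n ≤ minEntropy (S.commitDist n x w)

namespace ThreeRound

variable (S : ThreeRound) (n : ℕ)

/-- A distinguisher of transcripts. It has no oracle: the oracle without inputs and outputs is
trivial. -/
abbrev TrDistinguisher : Type :=
  Distinguisher Empty Empty (Fin (S.lenX n)) (Fin (S.lenW n)) (S.TrPos n)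

open Classical in
/-- Probability that `D₀` outputs `(x, w)` in the relation and `D₁` accepts an honest transcript. -/
noncomputable def realProb (D : S.TrDistinguisher n) : ℝ :=
  ∑ x : S.Inst n, ∑ w : S.Wit n, if S.rel n x w then
    𝔼 c : Fin (S.numCh n), 𝔼 r₁ : (S.prover₁ n).Coins, 𝔼 r₂ : (S.prover₂ n).Coins,
      D.prob id id x w (Sum.elim (S.commit n x w r₁)
        (Sum.elim (S.chal n c) (S.respond n (S.state n x w r₁) c r₂)))
  else 0

open Classical in
/-- The same probability for the transcript obtained by sampling a uniform challenge `c` and then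
`(a, z)` with the special simulator `sim` on input `(x, c)`. -/
noncomputable def simProb
    (sim : RandCircuit (Fin (S.lenX n) ⊕ Fin (S.numCh n).size) (Fin (S.lenA n) ⊕ Fin (S.lenZ n)))
    (D : S.TrDistinguisher n) : ℝ :=
  ∑ x : S.Inst n, ∑ w : S.Wit n, if S.rel n x w then
    𝔼 c : Fin (S.numCh n), 𝔼 r : sim.Coins,
      D.prob id id x w (Sum.elim (fun i => sim.run (Sum.elim x (S.chal n c)) r (Sum.inl i))
        (Sum.elim (S.chal n c) (fun i => sim.run (Sum.elim x (S.chal n c)) r (Sum.inr i))))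
  else 0

/-- Special honest-verifier zero-knowledge: sampling a uniform challenge and running a
polynomial-time special simulator on it gives an honest-verifier zero-knowledge simulator, against
all quantum polynomial-time distinguishers. -/
def SHVZK : Prop :=
  ∃ sim : ∀ n, RandCircuit (Fin (S.lenX n) ⊕ Fin (S.numCh n).size)
      (Fin (S.lenA n) ⊕ Fin (S.lenZ n)),
    PolyBounded (fun n => (sim n).size) ∧
    ∀ D : ∀ n, S.TrDistinguisher n, PolyBounded (fun n => (D n).size) →
      Negligible fun n => |S.realProb n (D n) - S.simProb n (sim n) (D n)|

end ThreeRound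

/-! Non-interactive proofs in the quantum random oracle model -/

/-- Syntax of a non-interactive proof system for a relation in the random oracle model. The oracle
is a function `{0,1}^In → {0,1}^Out`, proofs are bit strings with positions `Pf`, the prover is
a function of the oracle, its input and uniform coins from `Coins`. -/
structure ROProofSystem : Type 1 where
  lenX : ℕ → ℕ
  lenW : ℕ → ℕ
  rel : ∀ n, Bits (Fin (lenX n)) → Bits (Fin (lenW n)) → Prop
  In : ℕ → Type
  Out : ℕ → Type
  Pf : ℕ → Type
  Coins : ℕ → Type
  [fintypeIn : ∀ n, Fintype (In n)]
  [decIn : ∀ n, DecidableEq (In n)]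
  [fintypeOut : ∀ n, Fintype (Out n)]
  [decOut : ∀ n, DecidableEq (Out n)]
  [fintypePf : ∀ n, Fintype (Pf n)]
  [decPf : ∀ n, DecidableEq (Pf n)]
  [fintypeCoins : ∀ n, Fintype (Coins n)]
  prover : ∀ n, (Bits (In n) → Bits (Out n)) → Bits (Fin (lenX n)) → Bits (Fin (lenW n)) →
    Coins n → Bits (Pf n)
  verifier : ∀ n, (Bits (In n) → Bits (Out n)) → Bits (Fin (lenX n)) → Bits (Pf n) → Bool

attribute [instance] ROProofSystem.fintypeIn ROProofSystem.decIn ROProofSystem.fintypeOut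
  ROProofSystem.decOut ROProofSystem.fintypePf ROProofSystem.decPf ROProofSystem.fintypeCoins

namespace ROProofSystem

variable (Q : ROProofSystem) (n : ℕ)

abbrev Oracle : Type := Bits (Q.In n) → Bits (Q.Out n)

/-- A simulator: `sample` maps an instance to a proof and to reprogramming instructions (a bit
string of length `lenI`). `patch` is the deterministic circuit that interprets the instructions:
on a point `ξ` of the domain it outputs a flag and a value. -/
structure Simulator : Type where
  lenI : ℕ
  sample : RandCircuit (Fin (Q.lenX n)) (Fin lenI ⊕ Q.Pf n)
  patch : Circuit (Fin lenI ⊕ Q.In n) (Unit ⊕ Q.Out n)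

variable {Q n} in
def Simulator.size (sim : Q.Simulator n) : ℕ := sim.lenI + sim.sample.size + sim.patch.size

variable {Q n} in
/-- The oracle `H'` that the instructions `ins` define relative to `H`: where the flag is set, the
value of `H` is replaced. -/
def Simulator.reprogram (sim : Q.Simulator n) (ins : Bits (Fin sim.lenI)) (H : Q.Oracle n) :
    Q.Oracle n := fun ξ =>
  if sim.patch.run (Sum.elim ins ξ) (Sum.inl ()) then
    fun o => sim.patch.run (Sum.elim ins ξ) (Sum.inr o)
  else H ξ

/-- A distinguisher of proofs with quantum access to the oracle. -/
abbrev PfDistinguisher : Type :=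
  Distinguisher (Q.In n) (Q.Out n) (Fin (Q.lenX n)) (Fin (Q.lenW n)) (Q.Pf n)

open Classical in
/-- Probability, for a uniformly random oracle `H`, that `D₀` outputs `(x, w)` in the relation and
`D₁` accepts a proof of the honest prover, both with oracle `H`. -/
noncomputable def realProb (D : Q.PfDistinguisher n) : ℝ :=
  𝔼 H : Q.Oracle n, ∑ x : Bits (Fin (Q.lenX n)), ∑ w : Bits (Fin (Q.lenW n)),
    if Q.rel n x w then 𝔼 r : Q.Coins n, D.prob H H x w (Q.prover n H x w r) else 0

open Classical in
/-- Probability, for a uniformly random oracle `H`, that `D₀` with oracle `H` outputs `(x, w)` in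
the relation and `D₁`, with the oracle `H'` reprogrammed by the simulator, accepts the simulated
proof. -/
noncomputable def simProb (sim : Q.Simulator n) (D : Q.PfDistinguisher n) : ℝ :=
  𝔼 H : Q.Oracle n, ∑ x : Bits (Fin (Q.lenX n)), ∑ w : Bits (Fin (Q.lenW n)),
    if Q.rel n x w then
      𝔼 r : sim.sample.Coins,
        D.prob H (sim.reprogram (fun i => sim.sample.run x r (Sum.inl i)) H) x w
          (fun i => sim.sample.run x r (Sum.inr i))
    else 0

/-- Zero-knowledge in the quantum random oracle model: one polynomial-time simulator works against
all quantum polynomial-time distinguishers. -/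
def IsZeroKnowledge : Prop :=
  ∃ sim : ∀ n, Q.Simulator n, PolyBounded (fun n => (sim n).size) ∧
    ∀ D : ∀ n, Q.PfDistinguisher n, PolyBounded (fun n => (D n).size) →
      Negligible fun n => |Q.realProb n (D n) - Q.simProb n (sim n) (D n)|

end ROProofSystem

/-! The Fischlin transform -/

namespace Fischlin

variable (S : ThreeRound) (k l t : ℕ → ℕ) (n : ℕ)

/-- Positions of an oracle input `(𝐚, i, c, z)`. -/
abbrev In : Type :=
  (Fin (k n) × Fin (S.lenA n)) ⊕ Fin (k n).size ⊕ Fin (S.numCh n).size ⊕ Fin (S.lenZ n)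

/-- Positions of a proof `(𝐚, 𝐜, 𝐳)`; the first bit tells a proof (1) from an abort (0). -/
abbrev Pf : Type :=
  Unit ⊕ (Fin (k n) × Fin (S.lenA n)) ⊕ (Fin (k n) × Fin (S.numCh n).size) ⊕
    (Fin (k n) × Fin (S.lenZ n))

abbrev Oracle : Type := Bits (In S k n) → Bits (Fin (l n))

/-- The oracle input `(𝐚, i, c, z)`. -/
def query (a : Fin (k n) → S.Com n) (i : Fin (k n)) (c : S.Chal n) (z : S.Resp n) :
    Bits (In S k n) :=
  Sum.elim (fun p => a p.1 p.2) (Sum.elim (natBits (k n).size i) (Sum.elim c z))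

/-- The prover's coins: for the `k` commitments, and for the response in each attempt. -/
abbrev Coins : Type :=
  (Fin (k n) → (S.prover₁ n).Coins) × (Fin (k n) → Fin (t n + 2) → (S.prover₂ n).Coins)

variable {S k l t n}

/-- The commitment vector. -/
def comVec (x : S.Inst n) (w : S.Wit n) (r : Coins S k t n) : Fin (k n) → S.Com n :=
  fun i => S.commit n x w (r.1 i)

/-- The response in the attempt of repetition `i` with challenge `c`. -/
def resp (x : S.Inst n) (w : S.Wit n) (r : Coins S k t n) (i : Fin (k n)) (c : Fin (t n + 2)) :
    S.Resp n :=
  S.respond n (S.state n x w (r.1 i)) c (r.2 i c)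

/-- The challenge found in repetition `i`: the first `c` for which the oracle answers `0^l`. The
counter starts at `-1` and the search is aborted once it exceeds `t`, so the attempts are
`c = 0, 1, …, t + 1`. -/
def search (H : Oracle S k l n) (x : S.Inst n) (w : S.Wit n) (r : Coins S k t n) (i : Fin (k n)) :
    Option (Fin (t n + 2)) :=
  (List.finRange (t n + 2)).find? fun c =>
    decide (H (query S k n (comVec x w r) i (S.chal n c) (resp x w r i c)) = fun _ => false)

/-- The prover: abort if the search fails in some repetition, otherwise output `(𝐚, 𝐜, 𝐳)`. -/
def prove (H : Oracle S k l n) (x : S.Inst n) (w : S.Wit n) (r : Coins S k t n) : Bits (Pf S k n) :=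
  if h : ∀ i, (search H x w r i).isSome then
    Sum.elim (fun _ => true) (Sum.elim (fun p => comVec x w r p.1 p.2)
      (Sum.elim (fun p => S.chal n ((search H x w r p.1).get (h p.1)) p.2)
        (fun p => resp x w r p.1 ((search H x w r p.1).get (h p.1)) p.2)))
  else fun _ => false

/-- The verifier. -/
def verify (H : Oracle S k l n) (x : S.Inst n) (π : Bits (Pf S k n)) : Bool :=
  π (Sum.inl ()) && decide (∀ i : Fin (k n),
    let a : Fin (k n) → S.Com n := fun i j => π (Sum.inr (Sum.inl (i, j)))
    let c : S.Chal n := fun j => π (Sum.inr (Sum.inr (Sum.inl (i, j))))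
    let z : S.Resp n := fun j => π (Sum.inr (Sum.inr (Sum.inr (i, j))))
    (∃ d : Fin (S.numCh n), c = S.chal n d) ∧ H (query S k n a i c z) = (fun _ => false) ∧
      S.accepts n x (a i) c z = true)

end Fischlin

/-- The Fischlin transform of a three-round protocol, with `k` repetitions, hash length `l` and
bound `t` on the search. -/
def fischlin (S : ThreeRound) (k l t : ℕ → ℕ) : ROProofSystem where
  lenX := S.lenX
  lenW := S.lenW
  rel := S.rel
  In := Fischlin.In S k
  Out n := Fin (l n)
  Pf := Fischlin.Pf S k
  Coins := Fischlin.Coins S k t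
  prover _ H x w r := Fischlin.prove H x w r
  verifier _ H x π := Fischlin.verify H x π

/-!
# Fischlin's transform is zero-knowledge in the quantum random oracle model

The simulator samples hash values `h (i, c)` for all attempts of all repetitions. They determine
the challenge `c_i = chosen h i` that the search finds in each repetition, so that commitments and
responses `(a_i, z_i)` can be obtained from the special simulator of the Σ-protocol, run on the
challenge `c_i` (on failure of the search the proof is the abort symbol and the oracle stays as it
is). The instructions are `(x, 𝐚, h)`: the oracle gets the value `h (i, c)` at each point
`(𝐚, i, c, z)` whose attempt is made and whose transcript `(a_i, c, z)` is accepted. By unique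
responses this is at most one point for each attempt, and by completeness it is, for honest
commitments, the point that the honest prover queries; so the responses in the failing attempts,
which the simulator does not know, are not needed (`Fischlin.patchOracle_eq_reprogramAt`).

Between the two experiments lies the game `Fischlin.honestGame`, in which the hash values are
sampled and the oracle is reprogrammed, but commitments and responses are honest.

*From the real experiment to the honest game.* Exchanging values of a uniformly random oracle with
independent values leaves it uniform, even at adaptively chosen points
(`expect_reprogramAt`). Thus the real experiment is the honest game, except that already the first
stage `D₀` queries the reprogrammed oracle. All reprogrammed points lie in the block of oracle
inputs that begin with the commitments `𝐚`. Define the influence of a block on a state as the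
expected squared distance by which the state moves when the oracle is resampled in this block. Each
query adds at most 4 to the sum of the influences of all blocks (`influence_apply_le`), and `𝐚` is
a given block with probability at most `2 ^ (-k α)`, so the expected squared distance is
`O(q · 2 ^ (-k α))` for `q` queries. The distinguishing advantage is at most of the order of
`q · √(2 ^ (-k α))` (`Fischlin.abs_realProb_sub_honestGame_le`).

*From the honest to the simulated game.* A hybrid argument replaces the honest transcripts one
repetition at a time (`Fischlin.hybridGame`). The acceptance probability of a distinguisher with `q`
queries is a polynomial of degree at most `2 q` in the values of the oracle
(`Distinguisher.prob_mem_localFun`), hence the random oracle may be replaced by a `2 q`-wise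
independent one: a random polynomial over a field of characteristic 2, which has small circuits
(`exists_wiseIndep`). The randomness other than that of the transcript in question can now be fixed
to the values with the largest advantage, because circuits may have data built in. What remains is a
distinguisher of single transcripts that runs the whole game, including both oracles, without any
oracle (`Distinguisher.exists_simulation`, `Fischlin.exists_stepDistinguisher`). As the challenge of
the transcript is uniform instead of being `c_j`, it outputs 0 unless the two agree, which costs a
factor `N` (`Fischlin.stepAdvantage_eq`); the hybrid argument costs a factor `k`.

Circuits are handled through straight-line programs: `Cost s f` says that `s` instructions compute
`f`, and `PolyTime f` that the functions of the family `f` have circuits of polynomial size. Such a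
program yields a reversible gadget that leaves its scratch wires clean (`Cost.exists_gadget`), with
which an efficiently computable oracle is simulated coherently.
-/

/-! ### Asymptotics -/

namespace PolyBounded

theorem mono {f g : ℕ → ℕ} (hg : PolyBounded g) (h : ∀ n, f n ≤ g n) : PolyBounded f := by
  obtain ⟨p, hp⟩ := hg
  exact ⟨p, fun n => (h n).trans (hp n)⟩

theorem const (c : ℕ) : PolyBounded fun _ => c := ⟨Polynomial.C c, fun n => by simp⟩

theorem add {f g : ℕ → ℕ} (hf : PolyBounded f) (hg : PolyBounded g) :
    PolyBounded fun n => f n + g n := by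
  obtain ⟨p, hp⟩ := hf
  obtain ⟨q, hq⟩ := hg
  exact ⟨p + q, fun n => by simpa using add_le_add (hp n) (hq n)⟩

theorem mul {f g : ℕ → ℕ} (hf : PolyBounded f) (hg : PolyBounded g) :
    PolyBounded fun n => f n * g n := by
  obtain ⟨p, hp⟩ := hf
  obtain ⟨q, hq⟩ := hg
  exact ⟨p * q, fun n => by simpa using Nat.mul_le_mul (hp n) (hq n)⟩

end PolyBounded

namespace Negligible

theorem of_abs_le_polyBounded_mul {f g : ℕ → ℝ} {p : ℕ → ℕ} (hg : Negligible g)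
    (hp : PolyBounded p) (h : ∀ n, |f n| ≤ p n * |g n|) : Negligible f := by
  obtain ⟨P, hP⟩ := hp
  have h1 := hg.polynomial_mul (P.map (Nat.castRingHom ℝ))
  refine h1.trans_abs_le fun n => (h n).trans ?_
  rw [abs_mul]
  refine mul_le_mul_of_nonneg_right (le_trans ?_ (le_abs_self _)) (abs_nonneg _)
  have : Polynomial.eval (n : ℝ) (P.map (Nat.castRingHom ℝ)) = ((P.eval n : ℕ) : ℝ) := by
    simp
  rw [this]
  exact_mod_cast hP n

theorem add {f g : ℕ → ℝ} (hf : Negligible f) (hg : Negligible g) :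
    Negligible fun n => f n + g n :=
  Asymptotics.SuperpolynomialDecay.add hf hg

theorem sqrt {f : ℕ → ℝ} (hf : Negligible f) : Negligible fun n => Real.sqrt (f n) := by
  intro d
  have h := (hf (2 * d)).sqrt
  simp only [Real.sqrt_zero] at h
  refine h.congr fun n => ?_
  rw [pow_mul', Real.sqrt_mul (by positivity), Real.sqrt_sq (by positivity)]

end Negligible

/-! ### Straight-line programs -/

/-- Straight-line programs over the input positions `I`: the list of the Boolean functions that the
instructions compute, the latest one first. An instruction is a constant, an input bit, or the sum
or the product of two earlier results. -/
inductive SLP {I : Type} : List (Bits I → Bool) → Prop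
  | nil : SLP []
  | const (b : Bool) {L : List (Bits I → Bool)} : SLP L → SLP ((fun _ => b) :: L)
  | input (i : I) {L : List (Bits I → Bool)} : SLP L → SLP ((fun x => x i) :: L)
  | xor {f g : Bits I → Bool} {L : List (Bits I → Bool)} :
      f ∈ L → g ∈ L → SLP L → SLP ((fun x => Bool.xor (f x) (g x)) :: L)
  | and {f g : Bits I → Bool} {L : List (Bits I → Bool)} :
      f ∈ L → g ∈ L → SLP L → SLP ((fun x => f x && g x) :: L)

/-- The functions `f o` can be computed jointly by `s` instructions: every straight-line program
has an extension by at most `s` instructions that computes all of them. -/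
def Cost {I O : Type} (s : ℕ) (f : O → Bits I → Bool) : Prop :=
  ∀ L, SLP L → ∃ L', SLP L' ∧ L ⊆ L' ∧ L'.length ≤ L.length + s ∧ ∀ o, f o ∈ L'

namespace Cost

variable {I O M J : Type} {s s' : ℕ}

theorem exists_slp {f : O → Bits I → Bool} (h : Cost s f) :
    ∃ L, SLP L ∧ L.length ≤ s ∧ ∀ o, f o ∈ L := by
  obtain ⟨L, h1, -, h3, h4⟩ := h [] .nil
  exact ⟨L, h1, by simpa using h3, h4⟩

theorem mono {f : O → Bits I → Bool} (h : Cost s f) (hs : s ≤ s') : Cost s' f := fun L hL => by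
  obtain ⟨L', h1, h2, h3, h4⟩ := h L hL
  exact ⟨L', h1, h2, by omega, h4⟩

theorem reindex {f : O → Bits I → Bool} (h : Cost s f) (σ : J → O) : Cost s fun j => f (σ j) :=
  fun L hL => by
    obtain ⟨L', h1, h2, h3, h4⟩ := h L hL
    exact ⟨L', h1, h2, h3, fun j => h4 _⟩

theorem const (b : Bool) : Cost 1 fun (_ : O) (_ : Bits I) => b := fun L hL =>
  ⟨_, hL.const b, by simp, by simp, by simp⟩

theorem input (i : I) : Cost 1 fun (_ : O) (x : Bits I) => x i := fun L hL =>
  ⟨_, hL.input i, by simp, by simp, by simp⟩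

/-- Running one program after another. -/
theorem bind {f : M → Bits I → Bool} {g : O → Bits I → Bool} (hf : Cost s f)
    (hg : ∀ L, SLP L → (∀ m, f m ∈ L) →
      ∃ L', SLP L' ∧ L ⊆ L' ∧ L'.length ≤ L.length + s' ∧ ∀ o, g o ∈ L') :
    Cost (s + s') g := fun L hL => by
  obtain ⟨L1, h1, h2, h3, h4⟩ := hf L hL
  obtain ⟨L2, k1, k2, k3, k4⟩ := hg L1 h1 h4
  exact ⟨L2, k1, List.Subset.trans h2 k2, by omega, k4⟩

theorem sumElim {f : M → Bits I → Bool} {g : O → Bits I → Bool} (hf : Cost s f) (hg : Cost s' g) :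
    Cost (s + s') (Sum.elim f g) := by
  refine hf.bind fun L hL hm => ?_
  obtain ⟨L', h1, h2, h3, h4⟩ := hg L hL
  refine ⟨L', h1, h2, h3, ?_⟩
  rintro (m | o)
  · exact h2 (hm m)
  · exact h4 o

theorem xor {f g : Bits I → Bool} (hf : Cost s fun _ : Unit => f) (hg : Cost s' fun _ : Unit => g) :
    Cost (s + s' + 1) fun (_ : O) x => Bool.xor (f x) (g x) := by
  refine (hf.sumElim hg).bind fun L hL hm => ?_
  exact ⟨_, SLP.xor (hm (Sum.inl ())) (hm (Sum.inr ())) hL, by simp, by simp, by simp⟩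

theorem and {f g : Bits I → Bool} (hf : Cost s fun _ : Unit => f) (hg : Cost s' fun _ : Unit => g) :
    Cost (s + s' + 1) fun (_ : O) x => (f x && g x) := by
  refine (hf.sumElim hg).bind fun L hL hm => ?_
  exact ⟨_, SLP.and (hm (Sum.inl ())) (hm (Sum.inr ())) hL, by simp, by simp, by simp⟩

/-- The tuple of finitely many families. -/
theorem pi [Fintype J] {f : J → O → Bits I → Bool} (hf : ∀ j, Cost s (f j)) :
    Cost (Fintype.card J * s) fun p : J × O => f p.1 p.2 := by
  classical
  have key : ∀ T : Finset J, Cost (T.card * s) fun p : {p : J × O // p.1 ∈ T} =>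
      f p.1.1 p.1.2 := by
    intro T
    induction T using Finset.induction_on with
    | empty => exact fun L hL => ⟨L, hL, by simp, by simp, fun p => absurd p.2 (by simp)⟩
    | insert a T ha ih =>
      rw [Finset.card_insert_of_notMem ha, add_mul, one_mul]
      refine ih.bind fun L hL hm => ?_
      obtain ⟨L', h1, h2, h3, h4⟩ := hf a L hL
      refine ⟨L', h1, h2, h3, ?_⟩
      rintro ⟨⟨j, o⟩, hj⟩
      rcases Finset.mem_insert.1 hj with rfl | hj
      · exact h4 o
      · exact h2 (hm ⟨(j, o), hj⟩)
  exact (key Finset.univ).reindex fun p => ⟨p, Finset.mem_univ _⟩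

theorem pi' [Fintype J] {f : J → Bits I → Bool} (hf : ∀ j, Cost s fun _ : Unit => f j) :
    Cost (Fintype.card J * s) f :=
  (pi (f := fun j (_ : Unit) => f j) hf).reindex fun j => (j, ())

end Cost

/-- Substitution: the program `G` is run on the results `f` of an earlier program. -/
theorem SLP.exists_comp {I M : Type} {G : List (Bits M → Bool)} (hG : SLP G) (f : M → Bits I → Bool)
    {L : List (Bits I → Bool)} (hL : SLP L) (hf : ∀ m, f m ∈ L) :
    ∃ L', SLP L' ∧ L ⊆ L' ∧ L'.length ≤ L.length + G.length ∧
      ∀ g ∈ G, (fun x => g fun m => f m x) ∈ L' := by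
  induction hG with
  | nil => exact ⟨L, hL, by simp, by simp, by simp⟩
  | const b _ ih =>
    obtain ⟨L', h1, h2, h3, h4⟩ := ih
    refine ⟨_, h1.const b, List.Subset.trans h2 (by simp), by simp; omega, ?_⟩
    intro g hg
    rcases List.mem_cons.1 hg with rfl | hg
    · simp
    · exact List.mem_cons_of_mem _ (h4 g hg)
  | input i _ ih =>
    obtain ⟨L', h1, h2, h3, h4⟩ := ih
    refine ⟨L', h1, h2, by simp; omega, ?_⟩
    intro g hg
    rcases List.mem_cons.1 hg with rfl | hg
    · exact h2 (hf i)
    · exact h4 g hg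
  | xor hf hg _ ih =>
    obtain ⟨L', h1, h2, h3, h4⟩ := ih
    refine ⟨_, SLP.xor (h4 _ hf) (h4 _ hg) h1, List.Subset.trans h2 (by simp), by simp; omega, ?_⟩
    intro g hg
    rcases List.mem_cons.1 hg with rfl | hg
    · simp
    · exact List.mem_cons_of_mem _ (h4 g hg)
  | and hf hg _ ih =>
    obtain ⟨L', h1, h2, h3, h4⟩ := ih
    refine ⟨_, SLP.and (h4 _ hf) (h4 _ hg) h1, List.Subset.trans h2 (by simp), by simp; omega, ?_⟩
    intro g hg
    rcases List.mem_cons.1 hg with rfl | hg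
    · simp
    · exact List.mem_cons_of_mem _ (h4 g hg)

theorem Cost.comp {I M O : Type} {s s' : ℕ} {g : O → Bits M → Bool} {f : M → Bits I → Bool}
    (hf : Cost s f) (hg : Cost s' g) : Cost (s + s') fun o x => g o fun m => f m x := by
  obtain ⟨G, hG, hlen, hmem⟩ := hg.exists_slp
  refine hf.bind fun L hL hm => ?_
  obtain ⟨L', h1, h2, h3, h4⟩ := hG.exists_comp f hL hm
  exact ⟨L', h1, h2, by omega, fun o => h4 _ (hmem o)⟩

/-! ### Circuits and straight-line programs -/

/-- The action of a list of classical gates on the assignments of the wires. -/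
def runC {W : Type} [DecidableEq W] (gs : List (CGate W)) (b : Bits W) : Bits W :=
  gs.foldl (fun b g => g.apply b) b

section runC
variable {W : Type} [DecidableEq W]

@[simp] theorem runC_nil (b : Bits W) : runC [] b = b := rfl
@[simp] theorem runC_cons (g : CGate W) (gs : List (CGate W)) (b : Bits W) :
    runC (g :: gs) b = runC gs (g.apply b) := rfl
@[simp] theorem runC_append (gs gs' : List (CGate W)) (b : Bits W) :
    runC (gs ++ gs') b = runC gs' (runC gs b) := List.foldl_append

theorem CGate.apply_apply (g : CGate W) (b : Bits W) : g.apply (g.apply b) = b := by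
  cases g with
  | not t => simp [CGate.apply]
  | cnot c t h => simp [CGate.apply, Function.update_of_ne h]
  | toffoli c d t hc hd => simp [CGate.apply, Function.update_of_ne hc, Function.update_of_ne hd]

theorem runC_reverse_runC (gs : List (CGate W)) (b : Bits W) : runC gs.reverse (runC gs b) = b := by
  induction gs generalizing b with
  | nil => rfl
  | cons g gs ih => simp [ih, CGate.apply_apply]

theorem runC_runC_reverse (gs : List (CGate W)) (b : Bits W) : runC gs (runC gs.reverse b) = b := by
  simpa using runC_reverse_runC gs.reverse b

end runC

/-- A gate changes one wire, whose new content takes at most two instructions. -/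
theorem CGate.cost_apply {I W : Type} [DecidableEq W] (g : CGate W) {L : List (Bits I → Bool)}
    (hL : SLP L) (ht : (fun _ => true) ∈ L) (σ : Bits I → Bits W)
    (hσ : ∀ w, (fun x => σ x w) ∈ L) :
    ∃ L', SLP L' ∧ L ⊆ L' ∧ L'.length ≤ L.length + 2 ∧ ∀ w, (fun x => g.apply (σ x) w) ∈ L' := by
  cases g with
  | not t =>
    refine ⟨_, SLP.xor (hσ t) ht hL, by simp, by simp, fun w => ?_⟩
    by_cases h : w = t
    · subst h; simp [CGate.apply]
    · simp [CGate.apply, Function.update_of_ne h, hσ]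
  | cnot c t _ =>
    refine ⟨_, SLP.xor (hσ t) (hσ c) hL, by simp, by simp, fun w => ?_⟩
    by_cases h : w = t
    · subst h; simp [CGate.apply]
    · simp [CGate.apply, Function.update_of_ne h, hσ]
  | toffoli c d t _ _ =>
    refine ⟨_, SLP.xor (List.mem_cons_of_mem _ (hσ t)) List.mem_cons_self
      (SLP.and (hσ c) (hσ d) hL), by simp, by simp, fun w => ?_⟩
    by_cases h : w = t
    · subst h; simp [CGate.apply]
    · simp [CGate.apply, Function.update_of_ne h, hσ]

theorem exists_slp_runC {I W : Type} [DecidableEq W] (gs : List (CGate W))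
    {L : List (Bits I → Bool)} (hL : SLP L) (ht : (fun _ => true) ∈ L) (σ : Bits I → Bits W)
    (hσ : ∀ w, (fun x => σ x w) ∈ L) :
    ∃ L', SLP L' ∧ L ⊆ L' ∧ L'.length ≤ L.length + 2 * gs.length ∧
      ∀ w, (fun x => runC gs (σ x) w) ∈ L' := by
  induction gs generalizing L σ with
  | nil => exact ⟨L, hL, by simp, by simp, hσ⟩
  | cons g gs ih =>
    obtain ⟨L1, h1, h2, h3, h4⟩ := g.cost_apply hL ht σ hσ
    obtain ⟨L2, k1, k2, k3, k4⟩ := ih h1 (h2 ht) (fun x => g.apply (σ x)) h4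
    exact ⟨L2, k1, List.Subset.trans h2 k2, by simp; omega, k4⟩

/-- A circuit as a straight-line program: two constants, the input bits, and at most two
instructions for each gate. -/
theorem Circuit.cost_run {I O : Type} [DecidableEq I] [Fintype I] (C : Circuit I O) :
    Cost (Fintype.card I + 2 + 2 * C.size) fun o x => C.run x o := by
  have h0 : Cost (Fintype.card I * 1 + (1 + 1)) _ :=
    (Cost.pi' fun i : I => Cost.input (O := Unit) i).sumElim
      ((Cost.const (I := I) (O := Unit) false).sumElim (Cost.const (O := Unit) true))
  refine (h0.bind (s' := 2 * C.size) fun L hL hm => ?_).mono (by omega)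
  obtain ⟨L', h1, h2, h3, h4⟩ := exists_slp_runC C.gates hL (hm (Sum.inr (Sum.inr ())))
    (fun x => Sum.elim x fun _ => false) (by
      rintro (i | j)
      · exact hm (Sum.inl i)
      · exact hm (Sum.inr (Sum.inl ())))
  refine ⟨L', h1, h2, ?_, fun o => h4 _⟩
  have : C.gates.length ≤ C.size := Nat.le_add_right _ _
  omega

/-- Compilation of a straight-line program: each instruction writes its result on a fresh wire that
starts as 0. The wire `u` ends up with the value `val u` of the input. -/
theorem SLP.exists_gates {I U : Type} [DecidableEq U] {L : List (Bits I → Bool)} (hL : SLP L)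
    (inp : I → U) (ws : List U) (hlen : ws.length = L.length) (hnd : ws.Nodup)
    (hdisj : ∀ i, inp i ∉ ws) :
    ∃ (gs : List (CGate U)) (val : U → Bits I → Bool), gs.length ≤ 2 * L.length ∧
      (∀ b : Bits U, (∀ u ∈ ws, b u = false) → ∀ u,
        runC gs b u = if u ∈ ws then val u fun i => b (inp i) else b u) ∧
      ∀ f ∈ L, ∃ u ∈ ws, val u = f := by
  have step : ∀ (F : Bits I → Bool) (L : List (Bits I → Bool)) (w : U) (ws : List U)
      (gs new : List (CGate U)) (val : U → Bits I → Bool), w ∉ ws → (∀ i, inp i ∉ w :: ws) →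
      gs.length ≤ 2 * L.length → new.length ≤ 2 →
      (∀ b : Bits U, (∀ u ∈ ws, b u = false) → ∀ u,
        runC gs b u = if u ∈ ws then val u fun i => b (inp i) else b u) →
      (∀ f ∈ L, ∃ u ∈ ws, val u = f) →
      (∀ b u, u ≠ w → runC new b u = b u) →
      (∀ b : Bits U, (∀ u ∈ w :: ws, b u = false) →
        runC new (runC gs b) w = F fun i => b (inp i)) →
      ∃ (gs : List (CGate U)) (val : U → Bits I → Bool), gs.length ≤ 2 * (F :: L).length ∧
        (∀ b : Bits U, (∀ u ∈ w :: ws, b u = false) → ∀ u,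
          runC gs b u = if u ∈ w :: ws then val u fun i => b (inp i) else b u) ∧
        ∀ f ∈ F :: L, ∃ u ∈ w :: ws, val u = f := by
    intro F L w ws gs new val hw hdisj h1 h2 h3 h4 h5 h6
    refine ⟨gs ++ new, Function.update val w F, by simp; omega, ?_, ?_⟩
    · intro b hb u
      rw [runC_append]
      by_cases hu : u = w
      · subst hu
        simp [h6 b hb]
      · rw [h5 _ _ hu, h3 b fun v hv => hb v (by simp [hv])]
        simp [hu]
    · intro f hf
      rcases List.mem_cons.1 hf with rfl | hf
      · exact ⟨w, by simp, by simp⟩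
      · obtain ⟨u, hu, hu'⟩ := h4 f hf
        refine ⟨u, by simp [hu], ?_⟩
        rw [Function.update_of_ne (by rintro rfl; exact hw hu), hu']
  induction hL generalizing ws with
  | nil => exact ⟨[], fun _ _ => false, by simp, by simp [List.length_eq_zero_iff.1 hlen], by simp⟩
  | @const c L _ ih =>
    obtain ⟨w, ws, rfl⟩ : ∃ w ws', ws = w :: ws' := List.exists_cons_of_length_eq_add_one hlen
    obtain ⟨hw, hnd⟩ := List.nodup_cons.1 hnd
    obtain ⟨gs, val, h1, h2, h3⟩ := ih ws (by simpa using hlen) hnd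
      (fun i hi => hdisj i (List.mem_cons_of_mem _ hi))
    refine step _ L w ws gs (if c then [.not w] else []) val hw hdisj h1
      (by split_ifs <;> simp) h2 h3
      (fun b u hu => by split_ifs <;> simp [CGate.apply, hu]) fun b hb => ?_
    have hb' := h2 b fun v hv => hb v (by simp [hv])
    cases c <;> simp [CGate.apply, hb', hw, hb w]
  | @input i L _ ih =>
    obtain ⟨w, ws, rfl⟩ : ∃ w ws', ws = w :: ws' := List.exists_cons_of_length_eq_add_one hlen
    obtain ⟨hw, hnd⟩ := List.nodup_cons.1 hnd
    obtain ⟨gs, val, h1, h2, h3⟩ := ih ws (by simpa using hlen) hnd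
      (fun i hi => hdisj i (List.mem_cons_of_mem _ hi))
    have hi : inp i ≠ w := fun h => hdisj i (by simp [h])
    have hi' : inp i ∉ ws := fun h => hdisj i (by simp [h])
    refine step _ L w ws gs [.cnot (inp i) w hi] val hw hdisj h1 (by simp) h2 h3
      (fun b u hu => by simp [CGate.apply, hu]) fun b hb => ?_
    have hb' := h2 b fun v hv => hb v (by simp [hv])
    simp [CGate.apply, hb', hw, hi', hb w]
  | @xor f g L hf hg _ ih =>
    obtain ⟨w, ws, rfl⟩ : ∃ w ws', ws = w :: ws' := List.exists_cons_of_length_eq_add_one hlen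
    obtain ⟨hw, hnd⟩ := List.nodup_cons.1 hnd
    obtain ⟨gs, val, h1, h2, h3⟩ := ih ws (by simpa using hlen) hnd
      (fun i hi => hdisj i (List.mem_cons_of_mem _ hi))
    obtain ⟨u, hu, hu'⟩ := h3 f hf
    obtain ⟨v, hv, hv'⟩ := h3 g hg
    have huw : u ≠ w := fun h => hw (h ▸ hu)
    have hvw : v ≠ w := fun h => hw (h ▸ hv)
    refine step _ L w ws gs [.cnot u w huw, .cnot v w hvw] val hw hdisj h1 (by simp) h2 h3
      (fun b u hu => by simp [CGate.apply, hu]) fun b hb => ?_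
    have hb' := h2 b fun v hv => hb v (by simp [hv])
    simp [CGate.apply, hb', hw, hb w, Function.update_of_ne hvw, hu, hv, hu', hv']
  | @and f g L hf hg _ ih =>
    obtain ⟨w, ws, rfl⟩ : ∃ w ws', ws = w :: ws' := List.exists_cons_of_length_eq_add_one hlen
    obtain ⟨hw, hnd⟩ := List.nodup_cons.1 hnd
    obtain ⟨gs, val, h1, h2, h3⟩ := ih ws (by simpa using hlen) hnd
      (fun i hi => hdisj i (List.mem_cons_of_mem _ hi))
    obtain ⟨u, hu, hu'⟩ := h3 f hf
    obtain ⟨v, hv, hv'⟩ := h3 g hg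
    have huw : u ≠ w := fun h => hw (h ▸ hu)
    have hvw : v ≠ w := fun h => hw (h ▸ hv)
    refine step _ L w ws gs [.toffoli u v w huw hvw] val hw hdisj h1 (by simp) h2 h3
      (fun b u hu => by simp [CGate.apply, hu]) fun b hb => ?_
    have hb' := h2 b fun v hv => hb v (by simp [hv])
    simp [CGate.apply, hb', hw, hb w, hu, hv, hu', hv']

/-- The converse of `Circuit.cost_run`, up to a constant factor. -/
theorem Cost.exists_circuit {I O : Type} [DecidableEq I] {s : ℕ} {f : O → Bits I → Bool}
    (hf : Cost s f) : ∃ C : Circuit I O, C.size ≤ 3 * s ∧ ∀ x o, C.run x o = f o x := by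
  obtain ⟨L, hL, hlen, hmem⟩ := hf.exists_slp
  obtain ⟨gs, val, h1, h2, h3⟩ := hL.exists_gates (U := I ⊕ Fin L.length) Sum.inl
    ((List.finRange L.length).map Sum.inr) (by simp)
    ((List.nodup_finRange _).map Sum.inr_injective) (by simp)
  choose out ho hout using fun o => h3 (f o) (hmem o)
  refine ⟨⟨L.length, gs, out⟩, by simp [Circuit.size]; omega, fun x o => ?_⟩
  exact (h2 (Sum.elim x fun _ => false) (by simp) (out o)).trans (by rw [if_pos (ho o), hout]; rfl)

/-! ### Polynomial time -/

/-- The Boolean functions `f n j`, for all indices `j`, have circuits of size polynomial in `n`.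
The index holds both the position of an output bit and data that a circuit has hard-wired. -/
def PolyTime {J I : ℕ → Type} (f : ∀ n, J n → Bits (I n) → Bool) : Prop :=
  ∃ s, PolyBounded s ∧ ∀ n j, Cost (s n) fun _ : Unit => f n j

/-- A conjunction of `Fintype.card K` conditions. -/
theorem Cost.all {I K : Type} [Fintype K] {s : ℕ} {f : K → Bits I → Bool} {F : Bits I → Bool}
    (hf : ∀ κ, Cost s fun _ : Unit => f κ) (hF : ∀ x, F x = true ↔ ∀ κ, f κ x = true) :
    Cost (Fintype.card K * (s + 1) + 1) fun _ : Unit => F := by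
  classical
  have key : ∀ T : Finset K, Cost (T.card * (s + 1) + 1) fun (_ : Unit) x =>
      decide (∀ κ ∈ T, f κ x = true) := by
    intro T
    induction T using Finset.induction_on with
    | empty => simpa using Cost.const (I := I) (O := Unit) true
    | insert a T ha ih =>
      have h := (hf a).and (O := Unit) ih
      rw [Finset.card_insert_of_notMem ha]
      refine Cost.mono (s := s + (T.card * (s + 1) + 1) + 1) ?_ (by ring_nf; omega)
      convert h using 3 with _ x
      rw [Bool.eq_iff_iff]
      simp
  have h := key Finset.univ
  have hF' : F = fun x => decide (∀ κ ∈ Finset.univ, f κ x = true) := by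
    funext x
    rw [Bool.eq_iff_iff]
    simp [hF]
  rw [hF', ← Finset.card_univ]
  exact h

namespace PolyTime

variable {J J' K I M O : ℕ → Type}

theorem congr {f g : ∀ n, J n → Bits (I n) → Bool} (hf : PolyTime f)
    (h : ∀ n j x, g n j x = f n j x) : PolyTime g := by
  have : g = f := by funext n j x; exact h n j x
  exact this ▸ hf

/-- Joint computation of polynomially many bits. -/
theorem exists_cost [∀ n, Fintype (O n)] (hO : PolyBounded fun n => Fintype.card (O n))
    {f : ∀ n, J n → O n → Bits (I n) → Bool}
    (hf : PolyTime (J := fun n => J n × O n) fun n p => f n p.1 p.2) :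
    ∃ s, PolyBounded s ∧ ∀ n j, Cost (s n) (f n j) := by
  obtain ⟨s, hs, h⟩ := hf
  exact ⟨_, hO.mul hs, fun n j => Cost.pi' fun o => h n (j, o)⟩

theorem reindex {f : ∀ n, J n → Bits (I n) → Bool} (hf : PolyTime f) (σ : ∀ n, J' n → J n) :
    PolyTime fun n j => f n (σ n j) := by
  obtain ⟨s, hs, h⟩ := hf
  exact ⟨s, hs, fun n j => h n _⟩

theorem const (c : ∀ n, J n → Bool) : PolyTime (I := I) fun n j _ => c n j :=
  ⟨_, .const 1, fun _ _ => Cost.const _⟩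

theorem input (σ : ∀ n, J n → I n) : PolyTime fun n j x => x (σ n j) :=
  ⟨_, .const 1, fun _ _ => Cost.input _⟩

theorem xor {f g : ∀ n, J n → Bits (I n) → Bool} (hf : PolyTime f) (hg : PolyTime g) :
    PolyTime fun n j x => Bool.xor (f n j x) (g n j x) := by
  obtain ⟨s, hs, h⟩ := hf
  obtain ⟨s', hs', h'⟩ := hg
  exact ⟨_, (hs.add hs').add (.const 1), fun n j => (h n j).xor (h' n j)⟩

theorem and {f g : ∀ n, J n → Bits (I n) → Bool} (hf : PolyTime f) (hg : PolyTime g) :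
    PolyTime fun n j x => f n j x && g n j x := by
  obtain ⟨s, hs, h⟩ := hf
  obtain ⟨s', hs', h'⟩ := hg
  exact ⟨_, (hs.add hs').add (.const 1), fun n j => (h n j).and (h' n j)⟩

theorem not {f : ∀ n, J n → Bits (I n) → Bool} (hf : PolyTime f) :
    PolyTime fun n j x => !f n j x :=
  (hf.xor (const fun _ _ => true)).congr fun n j x => by simp

theorem or {f g : ∀ n, J n → Bits (I n) → Bool} (hf : PolyTime f) (hg : PolyTime g) :
    PolyTime fun n j x => f n j x || g n j x :=
  (hf.not.and hg.not).not.congr fun n j x => by simp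

theorem beq {f g : ∀ n, J n → Bits (I n) → Bool} (hf : PolyTime f) (hg : PolyTime g) :
    PolyTime fun n j x => f n j x == g n j x :=
  (hf.xor hg).not.congr fun n j x => by cases f n j x <;> cases g n j x <;> rfl

theorem cond {f g h : ∀ n, J n → Bits (I n) → Bool} (hf : PolyTime f) (hg : PolyTime g)
    (hh : PolyTime h) : PolyTime fun n j x => if f n j x then g n j x else h n j x :=
  ((hf.and hg).or (hf.not.and hh)).congr fun n j x => by cases f n j x <;> simp

/-- A conjunction of polynomially many conditions. -/
theorem all [∀ n, Fintype (K n)] (hK : PolyBounded fun n => Fintype.card (K n))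
    {f : ∀ n, J n → K n → Bits (I n) → Bool} {F : ∀ n, J n → Bits (I n) → Bool}
    (hf : PolyTime (J := fun n => J n × K n) fun n p => f n p.1 p.2)
    (hF : ∀ n j x, F n j x = true ↔ ∀ κ, f n j κ x = true) : PolyTime F := by
  obtain ⟨s, hs, h⟩ := hf
  exact ⟨_, (hK.mul (hs.add (.const 1))).add (.const 1), fun n j =>
    Cost.all (fun κ => h n (j, κ)) (hF n j)⟩

/-- A disjunction of polynomially many conditions. -/
theorem any [∀ n, Fintype (K n)] (hK : PolyBounded fun n => Fintype.card (K n))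
    {f : ∀ n, J n → K n → Bits (I n) → Bool} {F : ∀ n, J n → Bits (I n) → Bool}
    (hf : PolyTime (J := fun n => J n × K n) fun n p => f n p.1 p.2)
    (hF : ∀ n j x, F n j x = true ↔ ∃ κ, f n j κ x = true) : PolyTime F := by
  have h := PolyTime.all hK (F := fun n j x => !F n j x) (f := fun n j κ x => !f n j κ x) hf.not
    (fun n j x => by
      rw [Bool.not_eq_true', ← Bool.not_eq_true, hF]
      push Not
      simp)
  exact h.not.congr fun n j x => by simp

/-- Composition with a function that computes polynomially many bits, both with the same hard-wired
data. -/
theorem comp [∀ n, Fintype (M n)] (hM : PolyBounded fun n => Fintype.card (M n))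
    {g : ∀ n, J n → Bits (M n) → Bool} {f : ∀ n, J n → M n → Bits (I n) → Bool}
    (hg : PolyTime g) (hf : PolyTime (J := fun n => J n × M n) fun n p => f n p.1 p.2) :
    PolyTime fun n j x => g n j fun m => f n j m x := by
  obtain ⟨s, hs, h⟩ := hg
  obtain ⟨s', hs', h'⟩ := exists_cost hM hf
  exact ⟨_, hs'.add hs, fun n j => (h' n j).comp (h n j)⟩

theorem circuit [∀ n, Fintype (I n)] [∀ n, DecidableEq (I n)]
    (hI : PolyBounded fun n => Fintype.card (I n)) (C : ∀ n, Circuit (I n) (O n))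
    (hC : PolyBounded fun n => (C n).size) : PolyTime fun n o x => (C n).run x o :=
  ⟨_, (hI.add (.const 2)).add ((PolyBounded.const 2).mul hC), fun n o =>
    (C n).cost_run.reindex fun _ => o⟩

end PolyTime

/-! ### Reversible evaluation of straight-line programs -/

open Classical in
/-- Adding `f`, evaluated on the wires `inp`, to the wires `out`. -/
noncomputable def xorOut {I O U : Type} (inp : I → U) (out : O → U) (f : Bits I → Bits O)
    (b : Bits U) : Bits U :=
  fun v => if h : ∃ o : O, out o = v then xor (b v) (f (fun i => b (inp i)) h.choose) else b v

section xorOut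

variable {I O U : Type} {inp : I → U} {out : O → U}

theorem queryPerm_eq_xorOut (H : Bits I → Bits O) (e : (I ⊕ O) ↪ U) :
    queryPerm H e = xorOut (fun i => e (Sum.inl i)) (fun o => e (Sum.inr o)) H := rfl

theorem xorOut_out (hout : Function.Injective out) (f : Bits I → Bits O) (b : Bits U) (o : O) :
    xorOut inp out f b (out o) = xor (b (out o)) (f (fun i => b (inp i)) o) := by
  have h : ∃ o' : O, out o' = out o := ⟨o, rfl⟩
  rw [xorOut, dif_pos h, hout h.choose_spec]

theorem xorOut_of_forall_ne (f : Bits I → Bits O) (b : Bits U) {v : U} (hv : ∀ o, out o ≠ v) :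
    xorOut inp out f b v = b v := by
  rw [xorOut, dif_neg (by simpa using hv)]

theorem xorOut_inp (hio : ∀ i o, inp i ≠ out o) (f : Bits I → Bits O) (b : Bits U) (i : I) :
    xorOut inp out f b (inp i) = b (inp i) :=
  xorOut_of_forall_ne _ _ fun o h => hio i o h.symm

theorem xorOut_xorOut (hout : Function.Injective out) (hio : ∀ i o, inp i ≠ out o)
    (f : Bits I → Bits O) (b : Bits U) : xorOut inp out f (xorOut inp out f b) = b := by
  funext v
  by_cases h : ∃ o, out o = v
  · obtain ⟨o, rfl⟩ := h
    simp [xorOut_out hout, xorOut_inp hio]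
  · push Not at h
    simp [xorOut_of_forall_ne _ _ h]

end xorOut

theorem queryPerm_queryPerm {I O U : Type} (H : Bits I → Bits O) (e : (I ⊕ O) ↪ U) (b : Bits U) :
    queryPerm H e (queryPerm H e b) = b := by
  rw [queryPerm_eq_xorOut]
  exact xorOut_xorOut (e.injective.comp Sum.inr_injective) (by simp) H b

theorem queryPerm_inl {I O U : Type} (H : Bits I → Bits O) (e : (I ⊕ O) ↪ U) (b : Bits U) (i : I) :
    queryPerm H e b (e (Sum.inl i)) = b (e (Sum.inl i)) := by
  rw [queryPerm_eq_xorOut]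
  exact xorOut_inp (by simp) H b i

/-- Copying the wires `w` to the wires `out`, by addition. -/
theorem runC_cnots {O U : Type} [DecidableEq U] (out w : O → U) (hout : Function.Injective out)
    (hw : ∀ o o', w o ≠ out o') (os : List O) (hos : os.Nodup) (b : Bits U) :
    (∀ o ∈ os, runC (os.map fun o => CGate.cnot (w o) (out o) (hw o o)) b (out o) =
      xor (b (out o)) (b (w o))) ∧
    ∀ u, (∀ o ∈ os, out o ≠ u) →
      runC (os.map fun o => CGate.cnot (w o) (out o) (hw o o)) b u = b u := by
  induction os generalizing b with
  | nil => simp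
  | cons a os ih =>
    obtain ⟨ha, hos⟩ := List.nodup_cons.1 hos
    obtain ⟨h1, h2⟩ := ih hos ((CGate.cnot (w a) (out a) (hw a a)).apply b)
    simp only [List.map_cons, runC_cons]
    constructor
    · intro o ho
      rcases List.mem_cons.1 ho with rfl | ho
      · rw [h2 _ fun o' ho' h => ha (by rwa [← hout h])]
        simp [CGate.apply]
      · have hne : out o ≠ out a := fun h => ha (by rwa [← hout h])
        rw [h1 o ho]
        simp [CGate.apply, hne, hw o a]
    · intro u hu
      rw [h2 u fun o ho => hu o (by simp [ho])]
      simp [CGate.apply, Function.update_of_ne (hu a (by simp)).symm]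

/-- A function with a straight-line program is added to the wires `out` by computing it on scratch
wires, copying the result and undoing the computation. -/
theorem Cost.exists_gadget {I O U : Type} [DecidableEq U] [Fintype O] {s : ℕ}
    {f : O → Bits I → Bool} (hf : Cost s f) (inp : I → U) (out : O → U) (scr : Fin s → U)
    (hout : Function.Injective out) (hscr : Function.Injective scr)
    (hio : ∀ i o, inp i ≠ out o) (his : ∀ i k, inp i ≠ scr k) (hos : ∀ o k, out o ≠ scr k) :
    ∃ gs : List (CGate U), gs.length ≤ 4 * s + Fintype.card O ∧
      ∀ b : Bits U, (∀ k, b (scr k) = false) →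
        runC gs b = xorOut inp out (fun x o => f o x) b := by
  obtain ⟨L, hL, hlen, hmem⟩ := hf.exists_slp
  set ws : List U := (List.finRange L.length).map fun k => scr (Fin.castLE hlen k) with hws
  have hws' : ∀ u ∈ ws, ∃ k, u = scr k := by
    intro u hu
    obtain ⟨k, -, rfl⟩ := List.mem_map.1 hu
    exact ⟨_, rfl⟩
  obtain ⟨gs, val, h1, h2, h3⟩ := hL.exists_gates inp ws (by simp [hws])
    ((List.nodup_finRange _).map (hscr.comp (Fin.castLE_injective _)))
    (fun i hi => by obtain ⟨k, hk⟩ := hws' _ hi; exact his i k hk)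
  choose w hw hval using fun o => h3 (f o) (hmem o)
  have hwo : ∀ o o', w o ≠ out o' := fun o o' h => by
    obtain ⟨k, hk⟩ := hws' _ (hw o)
    exact hos o' k (h ▸ hk)
  have hows : ∀ o, out o ∉ ws := fun o h => by
    obtain ⟨k, hk⟩ := hws' _ h
    exact hos o k hk
  refine ⟨gs ++ (Finset.univ.toList.map fun o => .cnot (w o) (out o) (hwo o o)) ++ gs.reverse,
    by simp; omega, fun b hb => ?_⟩
  have hclean : ∀ u ∈ ws, b u = false := fun u hu => by
    obtain ⟨k, rfl⟩ := hws' _ hu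
    exact hb k
  obtain ⟨c1, c2⟩ := runC_cnots out w hout hwo Finset.univ.toList (Finset.nodup_toList _)
    (runC gs b)
  have hclean' : ∀ u ∈ ws, xorOut inp out (fun x o => f o x) b u = false := fun u hu => by
    rw [xorOut_of_forall_ne _ _ (by rintro o rfl; exact hows o hu), hclean u hu]
  rw [runC_append, runC_append, ← runC_reverse_runC gs (xorOut inp out (fun x o => f o x) b)]
  congr 1
  funext u
  rw [h2 _ hclean' u]
  by_cases hu : ∃ o, out o = u
  · obtain ⟨o, rfl⟩ := hu
    rw [c1 o (by simp), h2 b hclean, h2 b hclean, if_neg (hows o), if_neg (hows o), if_pos (hw o),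
      hval, xorOut_out hout]
  · push Not at hu
    rw [c2 u fun o _ => hu o, h2 b hclean, xorOut_of_forall_ne _ _ hu]
    simp only [xorOut_inp hio]

/-- As a reversible computation, a gadget as in `Cost.exists_gadget` maps wire assignments with
dirty scratch wires to such assignments. -/
theorem clean_of_clean_runC {I O U : Type} [DecidableEq U] {s : ℕ} {f : Bits I → Bits O}
    {inp : I → U} {out : O → U} {scr : Fin s → U}
    (hout : Function.Injective out) (hio : ∀ i o, inp i ≠ out o) (hos : ∀ o k, out o ≠ scr k)
    {gs : List (CGate U)}
    (hgs : ∀ b : Bits U, (∀ k, b (scr k) = false) → runC gs b = xorOut inp out f b)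
    {b : Bits U} (hb : ∀ k, runC gs b (scr k) = false) :
    (∀ k, b (scr k) = false) := by
  have h1 : ∀ k, xorOut inp out f (runC gs b) (scr k) = false := fun k => by
    rw [xorOut_of_forall_ne _ _ fun o => hos o k, hb k]
  have h2 := hgs _ h1
  rw [xorOut_xorOut hout hio] at h2
  have h3 := congrArg (runC gs.reverse) h2
  rw [runC_reverse_runC, runC_reverse_runC] at h3
  rw [← h3]
  exact h1

/-! ### Quantum circuits on a subset of the wires -/

section lift

variable {I O V U : Type} [DecidableEq V] [DecidableEq U]

theorem runGates_nil {W : Type} [DecidableEq W] (H : Bits I → Bits O) (ψ : QState W) :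
    runGates H [] ψ = ψ := rfl

theorem runGates_cons {W : Type} [DecidableEq W] (H : Bits I → Bits O) (g : QGate I O W)
    (gs : List (QGate I O W)) (ψ : QState W) :
    runGates H (g :: gs) ψ = runGates H gs (g.apply H ψ) := rfl

theorem runGates_append {W : Type} [DecidableEq W] (H : Bits I → Bits O)
    (gs gs' : List (QGate I O W)) (ψ : QState W) :
    runGates H (gs ++ gs') ψ = runGates H gs' (runGates H gs ψ) := List.foldl_append

/-- The quantum circuit that acts on amplitudes by composition with `runC gs`. -/
def invQ (gs : List (CGate U)) : List (QGate I O U) := gs.reverse.map .classical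

theorem runGates_invQ (H : Bits I → Bits O) (gs : List (CGate U)) (ψ : QState U) :
    runGates H (invQ gs) ψ = fun b => ψ (runC gs b) := by
  induction gs with
  | nil => rfl
  | cons g gs ih =>
    have : (invQ (g :: gs) : List (QGate I O U)) = invQ gs ++ [.classical g] := by simp [invQ]
    rw [this, runGates_append, ih]
    rfl

/-- A wire assignment agrees with `s` outside of the wires `core`. -/
def RestEq (core : V ↪ U) (s b : Bits U) : Prop := ∀ u, (∀ v, core v ≠ u) → b u = s u

open Classical in
/-- The state on the wires `U` which is `ψ` on the wires `core` and the basis state `s` on the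
others. -/
noncomputable def liftState (core : V ↪ U) (s : Bits U) (ψ : QState V) : QState U := fun b =>
  if RestEq core s b then ψ fun v => b (core v) else 0

/-- The gate on the wires `core` that corresponds to a gate on the wires `V`. -/
def CGate.map (core : V ↪ U) : CGate V → CGate U
  | .not t => .not (core t)
  | .cnot c t h => .cnot (core c) (core t) (core.injective.ne h)
  | .toffoli c d t hc hd => .toffoli (core c) (core d) (core t) (core.injective.ne hc)
      (core.injective.ne hd)

theorem update_core (core : V ↪ U) (b : Bits U) (t : V) (y : Bool) :
    (fun v => Function.update b (core t) y (core v)) =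
      Function.update (fun v => b (core v)) t y := by
  funext v
  by_cases h : v = t
  · subst h; simp
  · simp [h, core.injective.eq_iff]

omit [DecidableEq V] in
theorem restEq_update (core : V ↪ U) (s b : Bits U) (t : V) (y : Bool) :
    RestEq core s (Function.update b (core t) y) ↔ RestEq core s b := by
  refine forall_congr' fun u => forall_congr' fun hu => ?_
  rw [Function.update_of_ne (hu t).symm]

theorem CGate.map_apply_core (core : V ↪ U) (g : CGate V) (b : Bits U) :
    (fun v => (g.map core).apply b (core v)) = g.apply fun v => b (core v) := by
  cases g <;> exact update_core _ _ _ _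

omit [DecidableEq V] in
theorem CGate.restEq_map_apply (core : V ↪ U) (g : CGate V) (s b : Bits U) :
    RestEq core s ((g.map core).apply b) ↔ RestEq core s b := by
  cases g <;> exact restEq_update _ _ _ _ _

/-- A gate on the wires `V`, performed on the wires `core` without an oracle: a query is replaced by
classical gates. -/
def QGate.simulate (core : V ↪ U) (qry : ((I ⊕ O) ↪ V) → List (CGate U)) :
    QGate I O V → List (QGate Empty Empty U)
  | .classical g => [.classical (g.map core)]
  | .hadamard t => [.hadamard (core t)]
  | .phaseT t => [.phaseT (core t)]
  | .query e => invQ (qry e)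

/-- The simulated gate preserves the form of a lifted state. The hypothesis `hq` only concerns wire
assignments `b` in the support of such states; that a query maps no others into the support follows
from reversibility. -/
theorem runGates_simulate (core : V ↪ U) (qry : ((I ⊕ O) ↪ V) → List (CGate U))
    (H : Bits I → Bits O) (s : Bits U)
    (hq : ∀ e b, RestEq core s b → RestEq core s (runC (qry e) b) ∧
      (fun v => runC (qry e) b (core v)) = queryPerm H e fun v => b (core v))
    (g : QGate I O V) (ψ : QState V) :
    runGates id (g.simulate core qry) (liftState core s ψ) = liftState core s (g.apply H ψ) := by
  cases g with
  | classical g =>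
    funext b
    have h := g.restEq_map_apply core s b
    by_cases hb : RestEq core s b <;>
      simp [QGate.simulate, runGates_cons, runGates_nil, QGate.apply, liftState,
        CGate.map_apply_core, h, hb]
  | hadamard t =>
    funext b
    have h := restEq_update core s b t
    by_cases hb : RestEq core s b <;>
      simp [QGate.simulate, runGates_cons, runGates_nil, QGate.apply, liftState, update_core, h, hb]
  | phaseT t =>
    funext b
    by_cases hb : RestEq core s b <;>
      simp [QGate.simulate, runGates_cons, runGates_nil, QGate.apply, liftState, hb]
  | query e =>
    funext b
    simp only [QGate.simulate, runGates_invQ, QGate.apply, liftState]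
    by_cases hb : RestEq core s b
    · rw [if_pos hb, if_pos (hq e b hb).1, (hq e b hb).2]
    · rw [if_neg hb, if_neg]
      intro hc
      -- The assignment `d` below has rest `s` and the same image as `b`, hence is equal to `b`.
      classical
      set c := runC (qry e) b with hcdef
      have key : ∃ d, RestEq core s d ∧ runC (qry e) d = c := by
        let d : Bits U := fun u => if h : ∃ v, core v = u then
          queryPerm H e (fun v => c (core v)) h.choose else s u
        have hd1 : RestEq core s d := fun u hu => dif_neg (by simpa using hu)
        have hd2 : (fun v => d (core v)) = queryPerm H e fun v => c (core v) := by
          funext v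
          have h : ∃ v', core v' = core v := ⟨v, rfl⟩
          have : d (core v) = queryPerm H e (fun v => c (core v)) h.choose := dif_pos h
          rw [this, core.injective h.choose_spec]
        refine ⟨d, hd1, ?_⟩
        obtain ⟨k1, k2⟩ := hq e d hd1
        rw [hd2, queryPerm_queryPerm] at k2
        funext u
        by_cases h : ∃ v, core v = u
        · obtain ⟨v, rfl⟩ := h
          exact congrFun k2 v
        · push Not at h
          rw [k1 u h, hc u h]
      obtain ⟨d, hd, hdc⟩ := key
      have := congrArg (runC (qry e).reverse) hdc
      rw [hcdef, runC_reverse_runC, runC_reverse_runC] at this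
      exact hb (this ▸ hd)

theorem runGates_flatMap_simulate (core : V ↪ U) (qry : ((I ⊕ O) ↪ V) → List (CGate U))
    (H : Bits I → Bits O) (s : Bits U)
    (hq : ∀ e b, RestEq core s b → RestEq core s (runC (qry e) b) ∧
      (fun v => runC (qry e) b (core v)) = queryPerm H e fun v => b (core v))
    (gs : List (QGate I O V)) (ψ : QState V) :
    runGates id (gs.flatMap (QGate.simulate core qry)) (liftState core s ψ) =
      liftState core s (runGates H gs ψ) := by
  induction gs generalizing ψ with
  | nil => rfl
  | cons g gs ih =>
    rw [List.flatMap_cons, runGates_append, runGates_simulate core qry H s hq, ih, runGates_cons]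

omit [DecidableEq V] [DecidableEq U] in
theorem length_flatMap_simulate_le (core : V ↪ U) (qry : ((I ⊕ O) ↪ V) → List (CGate U)) {m : ℕ}
    (hm : ∀ e, (qry e).length ≤ m) (gs : List (QGate I O V)) :
    (gs.flatMap (QGate.simulate core qry)).length ≤ gs.length * (m + 1) := by
  induction gs with
  | nil => simp
  | cons g gs ih =>
    have : (g.simulate core qry).length ≤ m + 1 := by
      cases g with
      | query e => simpa [QGate.simulate, invQ] using (hm e).trans (Nat.le_succ m)
      | _ => simp [QGate.simulate]
    rw [List.flatMap_cons, List.length_append, List.length_cons, add_mul, one_mul]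
    omega

omit [DecidableEq V] in
theorem liftState_single [Fintype V] [Fintype U] (core : V ↪ U) :
    liftState core (fun _ => false) (Pi.single (fun _ => false) 1 : QState V) =
      (Pi.single (fun _ => false) 1 : QState U) := by
  funext b
  rw [liftState]
  by_cases hb : b = fun _ => false
  · subst hb
    rw [if_pos (show RestEq core _ _ from fun _ _ => rfl), Pi.single_eq_same, Pi.single_eq_same]
  · rw [Pi.single_eq_of_ne hb]
    split_ifs with h
    · rw [Pi.single_eq_of_ne]
      intro h'
      refine hb (funext fun u => ?_)
      by_cases hu : ∃ v, core v = u
      · obtain ⟨v, rfl⟩ := hu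
        exact congrFun h' v
      · push Not at hu
        exact h u hu
    · rfl

/-- A sum over the wire assignments in the support of a lifted state. -/
theorem sum_eq_sum_core [Fintype V] [Fintype U] (core : V ↪ U) (s : Bits U) (F : Bits U → ℝ)
    (G : Bits V → ℝ) (h0 : ∀ b, ¬ RestEq core s b → F b = 0)
    (h1 : ∀ b, RestEq core s b → F b = G fun v => b (core v)) : ∑ b, F b = ∑ v, G v := by
  classical
  rw [← Finset.sum_filter_add_sum_filter_not Finset.univ (RestEq core s) F,
    Finset.sum_eq_zero (s := Finset.univ.filter fun b => ¬ RestEq core s b)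
      (fun b hb => h0 b (Finset.mem_filter.1 hb).2), add_zero]
  have hg : ∀ c : Bits V, ∃ b : Bits U, RestEq core s b ∧ (fun v => b (core v)) = c := by
    intro c
    refine ⟨fun u => if h : ∃ v, core v = u then c h.choose else s u,
      fun u hu => dif_neg (by simpa using hu), funext fun v => ?_⟩
    have h : ∃ v', core v' = core v := ⟨v, rfl⟩
    exact (dif_pos h).trans (by rw [core.injective h.choose_spec])
  refine Finset.sum_bij (fun b _ => fun v => b (core v)) (fun _ _ => Finset.mem_univ _) ?_ ?_ ?_
  · intro b hb b' hb' h
    have k := (Finset.mem_filter.1 hb).2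
    have k' := (Finset.mem_filter.1 hb').2
    funext u
    by_cases hu : ∃ v, core v = u
    · obtain ⟨v, rfl⟩ := hu
      exact congrFun h v
    · push Not at hu
      rw [k u hu, k' u hu]
  · intro c _
    obtain ⟨b, hb, hbc⟩ := hg c
    exact ⟨b, Finset.mem_filter.2 ⟨Finset.mem_univ _, hb⟩, hbc⟩
  · intro b hb
    exact h1 b (Finset.mem_filter.1 hb).2

end lift

/-! ### Simulation of a distinguisher with an efficiently computable oracle -/

/-- The wires `V` as a part of the wires `U`. -/
def coreOf {V R U : Type} (φ : V ⊕ R ≃ U) : V ↪ U :=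
  ⟨fun v => φ (Sum.inl v), φ.injective.comp Sum.inl_injective⟩

theorem coreOf_apply {V R U : Type} (φ : V ⊕ R ≃ U) (v : V) : coreOf φ v = φ (Sum.inl v) := rfl

theorem restEq_coreOf {V R U : Type} (φ : V ⊕ R ≃ U) (s b : Bits U) :
    RestEq (coreOf φ) s b ↔ ∀ r, b (φ (Sum.inr r)) = s (φ (Sum.inr r)) := by
  constructor
  · exact fun h r => h _ fun v => by simp [coreOf_apply]
  · intro h u hu
    obtain ⟨v | r, rfl⟩ := φ.surjective u
    · exact absurd rfl (hu v)
    · exact h r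

theorem xorOut_core {I I' O V U : Type} (core : V ↪ U) (inp : I → V) (inp' : I' → U) (out : O → V)
    (hout : Function.Injective out) (f : Bits I → Bits O) (f' : Bits I' → Bits O) (b : Bits U)
    (hf : f' (fun i => b (inp' i)) = f fun i => b (core (inp i))) :
    (fun v => xorOut inp' (fun o => core (out o)) f' b (core v)) =
      xorOut inp out f fun v => b (core v) := by
  funext v
  by_cases h : ∃ o, out o = v
  · obtain ⟨o, rfl⟩ := h
    rw [xorOut_out (out := fun o => core (out o)) (core.injective.comp hout), xorOut_out hout, hf]
  · push Not at h
    rw [xorOut_of_forall_ne _ _ h, xorOut_of_forall_ne _ _ fun o ho => h o (core.injective ho)]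

theorem restEq_xorOut {I O V U : Type} (core : V ↪ U) (inp : I → U) (out : O → V)
    (f : Bits I → Bits O) (s b : Bits U) (h : RestEq core s b) :
    RestEq core s (xorOut inp (fun o => core (out o)) f b) := fun u hu => by
  rw [xorOut_of_forall_ne _ _ fun o => hu _, h u hu]

/-- The wires of the simulating second stage. On the left are the registers, the input and the
ancillas of the simulated stage, followed by scratch wires, the input `y`, copies of `x` and `w`,
and a wire for the verdict. On the right they are sorted into what comes from the first stage, the
input, and the remaining wires, which are ancillas. -/
def wireShuffle (V S P N Y X W : Type) :
    (V ⊕ P ⊕ N) ⊕ (S ⊕ Y ⊕ X ⊕ W ⊕ Unit) ≃ (V ⊕ S) ⊕ Y ⊕ (P ⊕ N ⊕ X ⊕ W ⊕ Unit) where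
  toFun
    | .inl (.inl v) => .inl (.inl v)
    | .inl (.inr (.inl p)) => .inr (.inr (.inl p))
    | .inl (.inr (.inr n)) => .inr (.inr (.inr (.inl n)))
    | .inr (.inl s) => .inl (.inr s)
    | .inr (.inr (.inl y)) => .inr (.inl y)
    | .inr (.inr (.inr r)) => .inr (.inr (.inr (.inr r)))
  invFun
    | .inl (.inl v) => .inl (.inl v)
    | .inr (.inr (.inl p)) => .inl (.inr (.inl p))
    | .inr (.inr (.inr (.inl n))) => .inl (.inr (.inr n))
    | .inl (.inr s) => .inr (.inl s)
    | .inr (.inl y) => .inr (.inr (.inl y))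
    | .inr (.inr (.inr (.inr r))) => .inr (.inr (.inr r))
  left_inv := by rintro ((v | p | n) | (s | y | r)) <;> rfl
  right_inv := by rintro ((v | s) | (y | p | n | r)) <;> rfl

/-- Scratch wires are counted among the memory wires. -/
def memShuffle (X W : Type) (m s : ℕ) : (X ⊕ W ⊕ Fin m) ⊕ Fin s ≃ X ⊕ W ⊕ Fin (m + s) :=
  ((Equiv.sumAssoc X (W ⊕ Fin m) (Fin s)).trans
    (Equiv.sumCongr (Equiv.refl X) (Equiv.sumAssoc W (Fin m) (Fin s)))).trans
    (Equiv.sumCongr (Equiv.refl X) (Equiv.sumCongr (Equiv.refl W) finSumFinEquiv))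

/-- The first stage runs with the oracle `G`, the second with an oracle `G' (x, w, y)` that depends
on its input. Since both have straight-line programs, a distinguisher without oracle can run `D`,
compute the input of the second stage from `(x, w, y)` and replace its verdict by 0 for some of the
strings `y`. -/
theorem Distinguisher.exists_simulation {I O X W P Y : Type} [Fintype O]
    [Fintype X] [DecidableEq X] [Fintype W] [DecidableEq W] [Fintype P] [DecidableEq P]
    [Fintype Y] [DecidableEq Y] (D : Distinguisher I O X W P) {s : ℕ}
    (G : Bits I → Bits O) (hG : Cost s fun o x => G x o)
    (π : Bits (X ⊕ W ⊕ Y) → Bits P)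
    (hπ : Cost s fun (o : X ⊕ W ⊕ P) (u : Bits (X ⊕ W ⊕ Y)) =>
      Sum.elim (fun i => u (Sum.inl i)) (Sum.elim (fun i => u (Sum.inr (Sum.inl i))) (π u)) o)
    (G' : Bits (X ⊕ W ⊕ Y) → Bits I → Bits O)
    (hG' : Cost s fun o (u : Bits ((X ⊕ W ⊕ Y) ⊕ I)) =>
      G' (fun i => u (Sum.inl i)) (fun i => u (Sum.inr i)) o)
    (acc : Bits Y → Bool)
    (hacc : Cost s fun (_ : Unit) (u : Bits (Y ⊕ Unit)) =>
      acc (fun i => u (Sum.inl i)) && u (Sum.inr ())) :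
    ∃ D' : Distinguisher Empty Empty X W Y,
      D'.size ≤ (D.size + Fintype.card P + Fintype.card X + Fintype.card W + 1) *
        (4 * s + Fintype.card O + 1) * 5 ∧
      ∀ x w y, D'.prob id id x w y = if acc y then
        D.prob G (G' (Sum.elim x (Sum.elim w y))) x w (π (Sum.elim x (Sum.elim w y))) else 0 := by
  classical
  obtain ⟨φ₁, hφX, hφW⟩ : ∃ φ₁ : (X ⊕ W ⊕ Fin D.mem) ⊕ Fin s ≃ X ⊕ W ⊕ Fin (D.mem + s),
      (∀ i, φ₁ (Sum.inl (Sum.inl i)) = Sum.inl i) ∧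
      ∀ i, φ₁ (Sum.inl (Sum.inr (Sum.inl i))) = Sum.inr (Sum.inl i) :=
    ⟨memShuffle X W D.mem s, fun _ => rfl, fun _ => rfl⟩
  obtain ⟨N, φ₂, hN, hφV, hφS, hφY, hφA⟩ : ∃ (N : ℕ) (φ₂ : ((X ⊕ W ⊕ Fin D.mem) ⊕ P ⊕ Fin D.anc) ⊕
        (Fin s ⊕ Y ⊕ X ⊕ W ⊕ Unit) ≃ (X ⊕ W ⊕ Fin (D.mem + s)) ⊕ Y ⊕ Fin N),
      N = Fintype.card (P ⊕ Fin D.anc ⊕ X ⊕ W ⊕ Unit) ∧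
      (∀ v, φ₂ (Sum.inl (Sum.inl v)) = Sum.inl (φ₁ (Sum.inl v))) ∧
      (∀ k, φ₂ (Sum.inr (Sum.inl k)) = Sum.inl (φ₁ (Sum.inr k))) ∧
      (∀ i, φ₂ (Sum.inr (Sum.inr (Sum.inl i))) = Sum.inr (Sum.inl i)) ∧
      (∀ b : Bits ((X ⊕ W ⊕ Fin (D.mem + s)) ⊕ Y ⊕ Fin N),
        ((fun i => b (Sum.inr (Sum.inr i))) = fun _ => false) ↔
          (∀ i, b (φ₂ (Sum.inl (Sum.inr i))) = false) ∧
          ∀ i, b (φ₂ (Sum.inr (Sum.inr (Sum.inr i)))) = false) := by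
    refine ⟨_, (wireShuffle (X ⊕ W ⊕ Fin D.mem) (Fin s) P (Fin D.anc) Y X W).trans
      (Equiv.sumCongr φ₁ (Equiv.sumCongr (Equiv.refl Y) (Fintype.equivFin _))), rfl, fun _ => rfl,
      fun _ => rfl, fun _ => rfl, fun b => ⟨fun h => ⟨?_, fun i => congrFun h _⟩, fun h => ?_⟩⟩
    · rintro (i | i)
      · exact congrFun h _
      · exact congrFun h _
    · funext i
      obtain ⟨j, rfl⟩ := (Fintype.equivFin (P ⊕ Fin D.anc ⊕ X ⊕ W ⊕ Unit)).surjective i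
      rcases j with p | n | r
      · exact h.1 (Sum.inl p)
      · exact h.1 (Sum.inr n)
      · exact h.2 r
  -- A query is replaced by a gadget for the oracle. In the second stage the oracle is computed
  -- from copies of `x` and `w`, since the registers themselves may have been changed by then.
  choose q₁ hq₁l hq₁ using fun E : (I ⊕ O) ↪ X ⊕ W ⊕ Fin D.mem =>
    hG.exists_gadget (fun i => coreOf φ₁ (E (Sum.inl i))) (fun o => coreOf φ₁ (E (Sum.inr o)))
      (fun k => φ₁ (Sum.inr k)) (fun o o' h => by simpa using h) (fun o o' h => by simpa using h)
      (fun i o h => by simp at h) (fun i k => by simp [coreOf_apply])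
      (fun o k => by simp [coreOf_apply])
  choose q₂ hq₂l hq₂ using fun E : (I ⊕ O) ↪ (X ⊕ W ⊕ Fin D.mem) ⊕ P ⊕ Fin D.anc =>
    hG'.exists_gadget
      (Sum.elim (Sum.elim (fun i => φ₂ (Sum.inr (Sum.inr (Sum.inr (Sum.inl i)))))
        (Sum.elim (fun i => φ₂ (Sum.inr (Sum.inr (Sum.inr (Sum.inr (Sum.inl i))))))
          fun i => φ₂ (Sum.inr (Sum.inr (Sum.inl i))))) fun i => coreOf φ₂ (E (Sum.inl i)))
      (fun o => coreOf φ₂ (E (Sum.inr o))) (fun k => φ₂ (Sum.inr (Sum.inl k)))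
      (fun o o' h => by simpa using h) (fun o o' h => by simpa using h)
      (by rintro ((i | i | i) | i) o <;> simp [coreOf_apply])
      (by rintro ((i | i | i) | i) k <;> simp [coreOf_apply]) (fun o k => by simp [coreOf_apply])
  -- Before the second stage, its input `π (x, w, y)` is computed, and `x` and `w` are copied.
  let pinp : X ⊕ W ⊕ Y → (X ⊕ W ⊕ Fin (D.mem + s)) ⊕ Y ⊕ Fin N :=
    Sum.elim (fun i => φ₂ (Sum.inl (Sum.inl (Sum.inl i)))) (Sum.elim
      (fun i => φ₂ (Sum.inl (Sum.inl (Sum.inr (Sum.inl i)))))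
      (fun i => φ₂ (Sum.inr (Sum.inr (Sum.inl i)))))
  let pout : X ⊕ W ⊕ P → (X ⊕ W ⊕ Fin (D.mem + s)) ⊕ Y ⊕ Fin N :=
    Sum.elim (fun i => φ₂ (Sum.inr (Sum.inr (Sum.inr (Sum.inl i))))) (Sum.elim
      (fun i => φ₂ (Sum.inr (Sum.inr (Sum.inr (Sum.inr (Sum.inl i))))))
      (fun i => φ₂ (Sum.inl (Sum.inr (Sum.inl i)))))
  have hpout : Function.Injective pout := by
    rintro (i | i | i) (j | j | j) h <;> simp [pout] at h <;> rw [h]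
  have hpio : ∀ i o, pinp i ≠ pout o := by
    rintro (i | i | i) (j | j | j) <;> simp [pinp, pout]
  have hpos : ∀ o k, pout o ≠ φ₂ (Sum.inr (Sum.inl k)) := by
    rintro (i | i | i) k <;> simp [pout]
  obtain ⟨gp, hgpl, hgp⟩ := hπ.exists_gadget pinp pout (fun k => φ₂ (Sum.inr (Sum.inl k)))
    hpout (fun o o' h => by simpa using h) hpio (by rintro (i | i | i) k <;> simp [pinp]) hpos
  -- At the end, the conjunction of `acc y` and the verdict of `D` is computed on a fresh wire.
  let finp : Y ⊕ Unit → (X ⊕ W ⊕ Fin (D.mem + s)) ⊕ Y ⊕ Fin N :=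
    Sum.elim (fun i => φ₂ (Sum.inr (Sum.inr (Sum.inl i)))) (fun _ => φ₂ (Sum.inl D.out))
  let fout : Unit → (X ⊕ W ⊕ Fin (D.mem + s)) ⊕ Y ⊕ Fin N := fun _ =>
    φ₂ (Sum.inr (Sum.inr (Sum.inr (Sum.inr (Sum.inr ())))))
  have hfout : Function.Injective fout := fun _ _ _ => rfl
  have hfio : ∀ i o, finp i ≠ fout o := by
    rintro (i | i) o <;> simp [finp, fout]
  have hfos : ∀ o k, fout o ≠ φ₂ (Sum.inr (Sum.inl k)) := by
    intro o k; simp [fout]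
  obtain ⟨gf, hgfl, hgf⟩ := hacc.exists_gadget finp fout (fun k => φ₂ (Sum.inr (Sum.inl k)))
    hfout (fun o o' h => by simpa using h) hfio (by rintro (i | i) k <;> simp [finp]) hfos
  let D' : Distinguisher Empty Empty X W Y := ⟨D.mem + s, N,
    D.first.flatMap (QGate.simulate (coreOf φ₁) q₁),
    invQ gp ++ (D.second.flatMap (QGate.simulate (coreOf φ₂) q₂) ++ invQ gf), fout ()⟩
  refine ⟨D', ?_, fun x w y => ?_⟩
  · have l1 : D'.first.length ≤ D.first.length * (4 * s + Fintype.card O + 1) :=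
      length_flatMap_simulate_le _ _ hq₁l _
    have l2 := length_flatMap_simulate_le (coreOf φ₂) _ hq₂l D.second
    have l3 : D'.second.length ≤ (4 * s + Fintype.card (X ⊕ W ⊕ P)) +
        (D.second.length * (4 * s + Fintype.card O + 1) + (4 * s + 1)) := by
      simp only [D', invQ, List.length_append, List.length_map, List.length_reverse]
      simp only [Fintype.card_unit] at hgfl
      omega
    simp only [Fintype.card_sum, Fintype.card_fin, Fintype.card_unit] at hN l3
    simp only [Distinguisher.size] at *
    have hmem : D'.mem = D.mem + s := rfl
    have hanc : D'.anc = N := rfl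
    generalize Fintype.card P = cP at *
    generalize Fintype.card X = cX at *
    generalize Fintype.card W = cW at *
    generalize hK : 4 * s + Fintype.card O + 1 = K at *
    have e1 : (D.mem + D.anc + D.first.length + D.second.length + cP + cX + cW + 1) * K * 5 =
      (D.first.length * K + D.second.length * K) +
      (D.mem + D.anc + cP + cX + cW) * K + (D.mem + D.anc + D.first.length + D.second.length +
        cP + cX + cW) * K * 4 + 5 * K := by ring
    have e2 : D.mem + D.anc + cP + cX + cW ≤ (D.mem + D.anc + cP + cX + cW) * K :=
      Nat.le_mul_of_pos_right _ (by omega)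
    have e3 : D.mem + D.anc + D.first.length + D.second.length + cP + cX + cW ≤
      (D.mem + D.anc + D.first.length + D.second.length + cP + cX + cW) * K :=
      Nat.le_mul_of_pos_right _ (by omega)
    omega
  · have hmid0 : ∀ c, D.midState G x w c ≠ 0 →
        (∀ i, c (Sum.inl i) = x i) ∧ ∀ i, c (Sum.inr (Sum.inl i)) = w i := by
      intro c hc
      unfold Distinguisher.midState at hc
      split_ifs at hc with h
      · exact ⟨fun i => congrFun h.1 i, fun i => congrFun h.2 i⟩
      · exact absurd rfl hc
    -- After the first stage the scratch wires are clean again, and `D` has not been disturbed.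
    have h1 : ∀ b : Bits (X ⊕ W ⊕ Fin (D.mem + s)), D'.midState id x w b =
        liftState (coreOf φ₁) (fun _ => false) (D.midState G x w) b := by
      intro b
      have h := runGates_flatMap_simulate (coreOf φ₁) q₁ G (fun _ => false) (by
        intro E b hb
        rw [hq₁ E b fun k => (restEq_coreOf φ₁ _ b).1 hb k]
        refine ⟨restEq_xorOut _ _ (fun o => E (Sum.inr o)) _ _ _ hb, ?_⟩
        exact xorOut_core _ _ _ _ (E.injective.comp Sum.inr_injective) _ _ _ rfl)
        D.first (Pi.single (fun _ => false) 1)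
      rw [liftState_single] at h
      have hX : (fun i => b (Sum.inl i)) = fun i => b (coreOf φ₁ (Sum.inl i)) := by
        funext i; rw [coreOf_apply, hφX]
      have hW : (fun i => b (Sum.inr (Sum.inl i))) =
          fun i => b (coreOf φ₁ (Sum.inr (Sum.inl i))) := by
        funext i; rw [coreOf_apply, hφW]
      rw [Distinguisher.midState, hX, hW, show D'.first = _ from rfl, h, liftState, liftState,
        Distinguisher.midState]
      by_cases hr : RestEq (coreOf φ₁) (fun _ => false) b
      · rw [if_pos hr, if_pos hr]
      · rw [if_neg hr, if_neg hr, ite_self]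
    -- The wires that the simulated second stage does not use: scratch wires, `y`, copies of `x`
    -- and `w`, and the wire for the verdict.
    let σ : Bits ((X ⊕ W ⊕ Fin (D.mem + s)) ⊕ Y ⊕ Fin N) := fun u =>
      Sum.elim (fun _ => false) (Sum.elim (fun _ => false) (Sum.elim y (Sum.elim x
        (Sum.elim w fun _ => false)))) (φ₂.symm u)
    have hσ : ∀ b, RestEq (coreOf φ₂) σ b ↔
        (∀ k, b (φ₂ (Sum.inr (Sum.inl k))) = false) ∧
        (∀ i, b (φ₂ (Sum.inr (Sum.inr (Sum.inl i)))) = y i) ∧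
        (∀ i, b (φ₂ (Sum.inr (Sum.inr (Sum.inr (Sum.inl i))))) = x i) ∧
        (∀ i, b (φ₂ (Sum.inr (Sum.inr (Sum.inr (Sum.inr (Sum.inl i)))))) = w i) ∧
        b (φ₂ (Sum.inr (Sum.inr (Sum.inr (Sum.inr (Sum.inr ())))))) = false := by
      intro b
      rw [restEq_coreOf]
      constructor
      · intro h
        exact ⟨fun k => by simpa [σ] using h (Sum.inl k),
          fun i => by simpa [σ] using h (Sum.inr (Sum.inl i)),
          fun i => by simpa [σ] using h (Sum.inr (Sum.inr (Sum.inl i))),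
          fun i => by simpa [σ] using h (Sum.inr (Sum.inr (Sum.inr (Sum.inl i)))),
          by simpa [σ] using h (Sum.inr (Sum.inr (Sum.inr (Sum.inr ()))))⟩
      · rintro ⟨k1, k2, k3, k4, k5⟩ (i | i | i | i | i)
        · simpa [σ] using k1 i
        · simpa [σ] using k2 i
        · simpa [σ] using k3 i
        · simpa [σ] using k4 i
        · simpa [σ] using k5
    let init : QState ((X ⊕ W ⊕ Fin D.mem) ⊕ P ⊕ Fin D.anc) := fun b =>
      if (fun i => b (Sum.inr (Sum.inl i))) = π (Sum.elim x (Sum.elim w y)) ∧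
        (fun i => b (Sum.inr (Sum.inr i))) = fun _ => false
      then D.midState G x w (fun v => b (Sum.inl v)) else 0
    have h2 : runGates (I := Empty) (O := Empty) id (invQ gp)
        (fun b : Bits ((X ⊕ W ⊕ Fin (D.mem + s)) ⊕ Y ⊕ Fin N) =>
          if (fun i => b (Sum.inr (Sum.inl i))) = y ∧
            (fun i => b (Sum.inr (Sum.inr i))) = fun _ => false
          then D'.midState id x w (fun v => b (Sum.inl v)) else 0) =
        liftState (coreOf φ₂) σ init := by
      rw [runGates_invQ]
      funext b
      by_cases hb : ∀ k, b (φ₂ (Sum.inr (Sum.inl k))) = false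
      · rw [hgp b hb]
        set c := xorOut pinp pout (fun u o => Sum.elim (fun i => u (Sum.inl i))
          (Sum.elim (fun i => u (Sum.inr (Sum.inl i))) (π u)) o) b with hc
        have hcS : ∀ k, c (φ₂ (Sum.inr (Sum.inl k))) = false := fun k => by
          rw [hc, xorOut_of_forall_ne _ _ fun o => hpos o k, hb]
        have hcV : ∀ v, c (φ₂ (Sum.inl (Sum.inl v))) = b (φ₂ (Sum.inl (Sum.inl v))) := fun v =>
          xorOut_of_forall_ne _ _ (by rintro (i | i | i) <;> simp [pout])
        have hcY : ∀ i, c (φ₂ (Sum.inr (Sum.inr (Sum.inl i)))) =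
            b (φ₂ (Sum.inr (Sum.inr (Sum.inl i)))) := fun v =>
          xorOut_of_forall_ne _ _ (by rintro (i | i | i) <;> simp [pout])
        have hcN : ∀ i, c (φ₂ (Sum.inl (Sum.inr (Sum.inr i)))) =
            b (φ₂ (Sum.inl (Sum.inr (Sum.inr i)))) := fun v =>
          xorOut_of_forall_ne _ _ (by rintro (i | i | i) <;> simp [pout])
        have hcO : c (φ₂ (Sum.inr (Sum.inr (Sum.inr (Sum.inr (Sum.inr ())))))) =
            b (φ₂ (Sum.inr (Sum.inr (Sum.inr (Sum.inr (Sum.inr ())))))) :=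
          xorOut_of_forall_ne _ _ (by rintro (i | i | i) <;> simp [pout])
        have hcX : ∀ i, c (φ₂ (Sum.inr (Sum.inr (Sum.inr (Sum.inl i))))) =
            xor (b (φ₂ (Sum.inr (Sum.inr (Sum.inr (Sum.inl i))))))
              (b (φ₂ (Sum.inl (Sum.inl (Sum.inl i))))) := fun i =>
          xorOut_out hpout _ b (Sum.inl i)
        have hcW : ∀ i, c (φ₂ (Sum.inr (Sum.inr (Sum.inr (Sum.inr (Sum.inl i)))))) =
            xor (b (φ₂ (Sum.inr (Sum.inr (Sum.inr (Sum.inr (Sum.inl i)))))))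
              (b (φ₂ (Sum.inl (Sum.inl (Sum.inr (Sum.inl i)))))) := fun i =>
          xorOut_out hpout _ b (Sum.inr (Sum.inl i))
        have hcP : ∀ i, c (φ₂ (Sum.inl (Sum.inr (Sum.inl i)))) =
            xor (b (φ₂ (Sum.inl (Sum.inr (Sum.inl i))))) (π (fun i => b (pinp i)) i) := fun i =>
          xorOut_out hpout _ b (Sum.inr (Sum.inr i))
        have hm : D'.midState id x w (fun v => c (Sum.inl v)) =
            D.midState G x w fun v => b (φ₂ (Sum.inl (Sum.inl v))) := by
          rw [h1, liftState, if_pos ((restEq_coreOf _ _ _).2 fun k => by rw [← hφS, hcS])]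
          congr 1
          funext v
          rw [coreOf_apply, ← hφV, hcV]
        simp only [hm]
        by_cases hz : D.midState G x w (fun v => b (φ₂ (Sum.inl (Sum.inl v)))) = 0
        · have : init (fun v => b (coreOf φ₂ v)) = 0 := by
            simp only [init, coreOf_apply, hz, ite_self]
          rw [hz, ite_self, liftState, this, ite_self]
        · obtain ⟨hx, hw⟩ := hmid0 _ hz
          have hcond : ((fun i => c (Sum.inr (Sum.inl i))) = y ∧
              (fun i => c (Sum.inr (Sum.inr i))) = fun _ => false) ↔
              RestEq (coreOf φ₂) σ b ∧
              ((fun i => b (φ₂ (Sum.inl (Sum.inr (Sum.inl i))))) = π (Sum.elim x (Sum.elim w y)) ∧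
              (fun i => b (φ₂ (Sum.inl (Sum.inr (Sum.inr i))))) = fun _ => false) := by
            have hpi : (∀ i, b (φ₂ (Sum.inr (Sum.inr (Sum.inl i)))) = y i) →
                (fun i => b (pinp i)) = Sum.elim x (Sum.elim w y) := by
              intro hy
              funext i
              rcases i with i | i | i
              · exact hx i
              · exact hw i
              · exact hy i
            rw [hφA, hσ]
            simp only [funext_iff, Sum.forall, ← hφY, hcY, hcN, hcX, hcW, hcP, hcO, hx, hw]
            constructor
            · rintro ⟨k1, ⟨k2, k3⟩, k4, k5, k6⟩
              refine ⟨⟨hb, k1, fun i => by simpa using k4 i, fun i => by simpa using k5 i, k6 ()⟩,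
                fun i => ?_, k3⟩
              have := k2 i
              rw [hpi k1] at this
              simpa using this
            · rintro ⟨⟨_, k1, k4, k5, k6⟩, k2, k3⟩
              refine ⟨k1, ⟨fun i => ?_, k3⟩, fun i => by simpa using k4 i,
                fun i => by simpa using k5 i, fun _ => k6⟩
              rw [hpi k1, k2, Bool.xor_self]
          rw [liftState]
          by_cases hr : RestEq (coreOf φ₂) σ b
          · rw [if_pos hr]
            simp only [hr, true_and] at hcond
            simp only [hcond, init, coreOf_apply]
          · rw [if_neg hr, if_neg fun h => hr (hcond.1 h).1]
      · have hb' : ¬ ∀ k, runC gp b (φ₂ (Sum.inr (Sum.inl k))) = false := fun h =>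
          hb (clean_of_clean_runC (scr := fun k => φ₂ (Sum.inr (Sum.inl k))) hpout hpio hpos hgp h)
        rw [liftState, if_neg fun h => hb ((hσ b).1 h).1]
        refine ite_eq_right_iff.2 fun _ => ?_
        rw [h1, liftState, if_neg]
        intro h
        refine hb' fun k => ?_
        rw [hφS]
        exact (restEq_coreOf _ _ _).1 h k
    -- The wires in `σ` do not change during the second stage, so every query is answered with
    -- the oracle for the same `(x, w, y)`.
    have h3 : D'.finalState id id x w y = fun b => liftState (coreOf φ₂) σ
        (D.finalState G (G' (Sum.elim x (Sum.elim w y))) x w (π (Sum.elim x (Sum.elim w y))))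
        (runC gf b) := by
      rw [Distinguisher.finalState, show D'.second = _ from rfl, runGates_append, runGates_append,
        runGates_invQ _ gf, h2, runGates_flatMap_simulate (coreOf φ₂) q₂
          (G' (Sum.elim x (Sum.elim w y))) σ]
      · rfl
      · intro E b hb
        obtain ⟨k1, k2, k3, k4, -⟩ := (hσ b).1 hb
        rw [hq₂ E b k1]
        refine ⟨restEq_xorOut _ _ (fun o => E (Sum.inr o)) _ _ _ hb, ?_⟩
        refine xorOut_core _ (fun i => E (Sum.inl i)) _ _ (E.injective.comp Sum.inr_injective)
          _ _ _ ?_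
        refine congrArg (fun u => G' u fun i => b (coreOf φ₂ (E (Sum.inl i)))) ?_
        funext i
        rcases i with i | i | i
        · exact k3 i
        · exact k4 i
        · exact k2 i
    -- The last gadget permutes the wire assignments, which is undone in the sum over all of them.
    let eqv : Bits ((X ⊕ W ⊕ Fin (D.mem + s)) ⊕ Y ⊕ Fin N) ≃
        Bits ((X ⊕ W ⊕ Fin (D.mem + s)) ⊕ Y ⊕ Fin N) :=
      ⟨runC gf, runC gf.reverse, runC_reverse_runC gf, runC_runC_reverse gf⟩
    have h4 : D'.prob id id x w y = ∑ c, if runC gf.reverse c (fout ()) then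
        ‖liftState (coreOf φ₂) σ (D.finalState G (G' (Sum.elim x (Sum.elim w y))) x w
          (π (Sum.elim x (Sum.elim w y)))) c‖ ^ 2 else 0 := by
      rw [Distinguisher.prob, h3]
      refine Fintype.sum_equiv eqv _ _ fun b => ?_
      have : runC gf.reverse (eqv b) = b := runC_reverse_runC gf b
      rw [this]
      rfl
    rw [h4, sum_eq_sum_core (coreOf φ₂) σ _ (fun v => if acc y && v D.out then
      ‖D.finalState G (G' (Sum.elim x (Sum.elim w y))) x w (π (Sum.elim x (Sum.elim w y))) v‖ ^ 2
      else 0)]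
    · rw [Distinguisher.prob]
      cases acc y <;> simp
    · intro c hc
      rw [liftState, if_neg hc]
      simp
    · intro c hc
      obtain ⟨k1, k2, -, -, k5⟩ := (hσ c).1 hc
      have hd := hgf
        (xorOut finp fout (fun u _ => acc (fun i => u (Sum.inl i)) && u (Sum.inr ())) c)
        fun k => by rw [xorOut_of_forall_ne _ _ fun o => hfos o k, k1]
      rw [xorOut_xorOut hfout hfio] at hd
      have hd' := congrArg (runC gf.reverse) hd
      rw [runC_reverse_runC] at hd'
      have hv : runC gf.reverse c (fout ()) = (acc y && c (coreOf φ₂ D.out)) := by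
        rw [← hd', xorOut_out hfout _ _ (), show c (fout ()) = false from k5, Bool.false_xor]
        congr 1
        congr 1
        funext i
        exact k2 i
      rw [hv, liftState, if_pos hc]

/-! ### Norms of quantum states -/

/-- The squared norm of a state. -/
noncomputable def mass {W : Type} [Fintype W] [DecidableEq W] (ψ : QState W) : ℝ :=
  ∑ b, ‖ψ b‖ ^ 2

section mass

variable {I O W : Type} [Fintype W] [DecidableEq W]

theorem mass_nonneg (ψ : QState W) : 0 ≤ mass ψ := Finset.sum_nonneg fun _ _ => by positivity

theorem mass_comp_involutive (ψ : QState W) (f : Bits W → Bits W) (hf : Function.Involutive f) :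
    mass (fun b => ψ (f b)) = mass ψ :=
  Fintype.sum_equiv hf.toPerm _ _ fun _ => rfl

theorem mass_single : mass (Pi.single (fun _ => false) 1 : QState W) = 1 := by
  rw [mass, Finset.sum_eq_single (fun _ => false)]
  · simp
  · intro b _ hb
    simp [Pi.single_eq_of_ne hb]
  · simp

theorem mass_sub_le (ψ φ : QState W) : mass (ψ - φ) ≤ 2 * mass ψ + 2 * mass φ := by
  rw [mass, mass, mass, Finset.mul_sum, Finset.mul_sum, ← Finset.sum_add_distrib]
  refine Finset.sum_le_sum fun b _ => ?_
  have := norm_sub_le (ψ b) (φ b)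
  rw [Pi.sub_apply]
  nlinarith [norm_nonneg (ψ b - φ b), sq_nonneg (‖ψ b‖ - ‖φ b‖)]

omit [Fintype W] in
theorem QGate.apply_sub (H : Bits I → Bits O) (g : QGate I O W) (ψ φ : QState W) :
    g.apply H (ψ - φ) = g.apply H ψ - g.apply H φ := by
  cases g with
  | hadamard t => funext b; simp only [QGate.apply, Pi.sub_apply]; ring
  | phaseT t => funext b; simp only [QGate.apply, Pi.sub_apply]; ring
  | _ => rfl

/-- Gates are unitary. -/
theorem mass_apply (H : Bits I → Bits O) (g : QGate I O W) (ψ : QState W) :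
    mass (g.apply H ψ) = mass ψ := by
  cases g with
  | classical g => exact mass_comp_involutive ψ _ g.apply_apply
  | query e => exact mass_comp_involutive ψ _ (queryPerm_queryPerm H e)
  | phaseT t =>
    refine Finset.sum_congr rfl fun b _ => ?_
    have : Complex.I * ((Real.pi / 4 : ℝ) : ℂ) = ((Real.pi / 4 : ℝ) : ℂ) * Complex.I := mul_comm _ _
    simp only [QGate.apply]
    split_ifs
    · rw [norm_mul, this, Complex.norm_exp_ofReal_mul_I, one_mul]
    · rw [one_mul]
  | hadamard t =>
    -- the sum over all `b` is paired with the sum over all `b` with the bit `t` flipped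
    have hflip : Function.Involutive fun b : Bits W => Function.update b t (!(b t)) := by
      intro b; simp
    have h1 := mass_comp_involutive ψ _ hflip
    have h2 := mass_comp_involutive ((QGate.hadamard t : QGate I O W).apply H ψ) _ hflip
    have h3 : mass ((QGate.hadamard t : QGate I O W).apply H ψ) +
        mass (fun b => (QGate.hadamard t : QGate I O W).apply H ψ (Function.update b t (!(b t)))) =
        mass ψ + mass fun b => ψ (Function.update b t (!(b t))) := by
      simp only [mass, ← Finset.sum_add_distrib]
      refine Finset.sum_congr rfl fun b _ => ?_
      have hp := parallelogram_law_with_norm ℝ (ψ (Function.update b t false))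
        (ψ (Function.update b t true))
      have hs : ‖((Real.sqrt 2 : ℝ) : ℂ)‖ ^ 2 = 2 := by
        rw [Complex.norm_real, Real.norm_eq_abs, sq_abs, Real.sq_sqrt (by norm_num)]
      have hb : Function.update b t (b t) = b := Function.update_eq_self t b
      cases hbt : b t <;> rw [hbt] at hb <;>
        simp only [QGate.apply, hbt, Function.update_idem, Function.update_self, norm_div, div_pow,
          hs, Bool.not_false, Bool.not_true, if_true, one_mul, neg_mul, ← sub_eq_add_neg,
          Bool.false_eq_true, if_false] <;>
        rw [hb] at hp ⊢ <;> linarith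
    linarith

omit [Fintype W] in
theorem runGates_sub (H : Bits I → Bits O) (gs : List (QGate I O W)) (ψ φ : QState W) :
    runGates H gs (ψ - φ) = runGates H gs ψ - runGates H gs φ := by
  induction gs generalizing ψ φ with
  | nil => rfl
  | cons g gs ih => simp only [runGates_cons, QGate.apply_sub, ih]

theorem mass_runGates (H : Bits I → Bits O) (gs : List (QGate I O W)) (ψ : QState W) :
    mass (runGates H gs ψ) = mass ψ := by
  induction gs generalizing ψ with
  | nil => rfl
  | cons g gs ih => rw [runGates_cons, ih, mass_apply]

end mass

/-! ### The influence of blocks of oracle values -/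

/-- The oracle `H` with the values in the block `a` taken from `H'`. -/
def mergeBlock {I O B : Type} [DecidableEq B] (β : Bits I → B) (a : B) (H' H : Bits I → Bits O) :
    Bits I → Bits O := fun ξ => if β ξ = a then H' ξ else H ξ

section influence

variable {I O W B : Type} [Fintype I] [DecidableEq I] [Fintype O] [DecidableEq O]
  [Fintype W] [DecidableEq W] [Fintype B] [DecidableEq B] (β : Bits I → B)

omit [Fintype B] in
theorem expect_mergeBlock (a : B) (F : (Bits I → Bits O) → ℝ) :
    𝔼 H : Bits I → Bits O, 𝔼 H' : Bits I → Bits O, F (mergeBlock β a H' H) =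
      𝔼 H : Bits I → Bits O, F H := by
  classical
  have hinv : Function.Involutive fun p : (Bits I → Bits O) × (Bits I → Bits O) =>
      (mergeBlock β a p.2 p.1, mergeBlock β a p.1 p.2) := by
    rintro ⟨H, H'⟩
    ext1 <;> funext ξ <;> simp only [mergeBlock] <;> split_ifs <;> rfl
  have h1 := Fintype.expect_equiv hinv.toPerm
    (fun p : (Bits I → Bits O) × (Bits I → Bits O) => F (mergeBlock β a p.2 p.1))
    (fun p => F p.1) fun _ => rfl
  rw [← Finset.univ_product_univ, Finset.expect_product, Finset.expect_product] at h1
  simpa using h1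

/-- The total influence of the blocks of `β` on a family of states that depends on the oracle: the
expected change of the state when the oracle values in one block are resampled, summed over all
blocks. -/
noncomputable def influence (φ : (Bits I → Bits O) → QState W) : ℝ :=
  ∑ a : B, 𝔼 H : Bits I → Bits O, 𝔼 H' : Bits I → Bits O, mass (φ H - φ (mergeBlock β a H' H))

theorem influence_const (ψ : QState W) : influence (O := O) β (fun _ => ψ) = 0 := by
  simp [influence, mass]

theorem influence_mono {W' : Type} [Fintype W'] [DecidableEq W']
    {φ : (Bits I → Bits O) → QState W} {φ' : (Bits I → Bits O) → QState W'}
    (h : ∀ H K, mass (φ H - φ K) ≤ mass (φ' H - φ' K)) : influence β φ ≤ influence β φ' :=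
  Finset.sum_le_sum fun _ _ => Finset.expect_le_expect fun _ _ =>
    Finset.expect_le_expect fun _ _ => h _ _

omit [Fintype I] [DecidableEq I] [Fintype O] [DecidableEq O] [Fintype W] [DecidableEq W] in
theorem queryPerm_congr {H K : Bits I → Bits O} (e : (I ⊕ O) ↪ W) {b : Bits W}
    (h : H (fun i => b (e (Sum.inl i))) = K fun i => b (e (Sum.inl i))) :
    queryPerm H e b = queryPerm K e b := by
  funext v
  simp only [queryPerm, h]

/-- A query increases the total influence by at most 4: resampling the block `a` only affects the
part of the superposition whose query lies in this block, and these parts are orthogonal. -/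
theorem influence_apply_le (φ : (Bits I → Bits O) → QState W) (g : QGate I O W) :
    influence β (fun H => g.apply H (φ H)) ≤
      influence β φ + 4 * 𝔼 H : Bits I → Bits O, mass (φ H) := by
  have hm : 0 ≤ 𝔼 H : Bits I → Bits O, mass (φ H) :=
    Finset.expect_nonneg fun _ _ => mass_nonneg _
  have other : (∀ H K : Bits I → Bits O, (g.apply H : QState W → QState W) = g.apply K) →
      influence β (fun H => g.apply H (φ H)) ≤
      influence β φ + 4 * 𝔼 H : Bits I → Bits O, mass (φ H) := by
    intro hg
    have : influence β (fun H => g.apply H (φ H)) ≤ influence β φ := influence_mono β fun H K => by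
      rw [hg K H, ← QGate.apply_sub, mass_apply]
    linarith
  cases g with
  | classical g => exact other fun _ _ => rfl
  | hadamard t => exact other fun _ _ => rfl
  | phaseT t => exact other fun _ _ => rfl
  | query e =>
    let P : B → QState W → ℝ := fun a ψ =>
      ∑ b : Bits W, if β (fun i => b (e (Sum.inl i))) = a then ‖ψ b‖ ^ 2 else 0
    have hP : ∀ ψ, ∑ a, P a ψ = mass ψ := by
      intro ψ
      simp only [P]
      rw [Finset.sum_comm]
      exact Finset.sum_congr rfl fun b _ => by simp
    have hPq : ∀ a (H : Bits I → Bits O) ψ, P a (fun b => ψ (queryPerm H e b)) = P a ψ := by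
      intro a H ψ
      refine Fintype.sum_equiv (Function.Involutive.toPerm _ (queryPerm_queryPerm H e)) _ _
        fun b => ?_
      have : (fun i => queryPerm H e b (e (Sum.inl i))) = fun i => b (e (Sum.inl i)) :=
        funext fun i => queryPerm_inl H e b i
      exact if_congr (by rw [← this]; rfl) rfl rfl
    have key : ∀ a (H H' : Bits I → Bits O),
        mass ((QGate.query e).apply H (φ H) -
          (QGate.query e).apply (mergeBlock β a H' H) (φ (mergeBlock β a H' H))) ≤
        mass (φ H - φ (mergeBlock β a H' H)) + 2 * P a (φ H) +
          2 * P a (φ (mergeBlock β a H' H)) := by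
      intro a H H'
      set K := mergeBlock β a H' H with hK
      rw [← mass_comp_involutive (φ H - φ K) _ (queryPerm_queryPerm H e), ← hPq a H (φ H),
        ← hPq a K (φ K)]
      simp only [mass, P]
      rw [Finset.mul_sum, Finset.mul_sum, ← Finset.sum_add_distrib, ← Finset.sum_add_distrib]
      refine Finset.sum_le_sum fun b _ => ?_
      simp only [QGate.apply, Pi.sub_apply]
      split_ifs with h
      · have := norm_sub_le (φ H (queryPerm H e b)) (φ K (queryPerm K e b))
        nlinarith [norm_nonneg (φ H (queryPerm H e b) - φ K (queryPerm K e b)),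
          sq_nonneg (‖φ H (queryPerm H e b)‖ - ‖φ K (queryPerm K e b)‖),
          sq_nonneg ‖φ H (queryPerm H e b) - φ K (queryPerm H e b)‖]
      · have : queryPerm K e b = queryPerm H e b :=
          queryPerm_congr e (by rw [hK, mergeBlock, if_neg h])
        rw [this]
        simp
    calc influence β (fun H => (QGate.query e).apply H (φ H))
        ≤ ∑ a : B, 𝔼 H : Bits I → Bits O, 𝔼 H' : Bits I → Bits O,
          (mass (φ H - φ (mergeBlock β a H' H)) + 2 * P a (φ H) +
          2 * P a (φ (mergeBlock β a H' H))) :=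
          Finset.sum_le_sum fun a _ => Finset.expect_le_expect fun H _ =>
            Finset.expect_le_expect fun H' _ => key a H H'
      _ = influence β φ + 4 * 𝔼 H : Bits I → Bits O, mass (φ H) := by
          have h : ∀ a : B, 𝔼 H : Bits I → Bits O, 𝔼 H' : Bits I → Bits O,
              (mass (φ H - φ (mergeBlock β a H' H)) + 2 * P a (φ H) +
                2 * P a (φ (mergeBlock β a H' H))) =
              𝔼 H : Bits I → Bits O, 𝔼 H' : Bits I → Bits O,
                mass (φ H - φ (mergeBlock β a H' H)) + 4 * 𝔼 H : Bits I → Bits O, P a (φ H) := by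
            intro a
            simp only [Finset.expect_add_distrib, ← Finset.mul_expect, Fintype.expect_const]
            rw [expect_mergeBlock β a fun H => P a (φ H)]
            ring
          simp only [h, Finset.sum_add_distrib, ← Finset.mul_sum]
          rw [← Finset.expect_sum_comm _ _ fun H a => P a (φ H)]
          simp only [hP]
          rfl

theorem influence_runGates_le (φ : (Bits I → Bits O) → QState W) (gs : List (QGate I O W)) :
    influence β (fun H => runGates H gs (φ H)) ≤
      influence β φ + gs.length * (4 * 𝔼 H : Bits I → Bits O, mass (φ H)) := by
  induction gs generalizing φ with
  | nil => simp [runGates_nil]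
  | cons g gs ih =>
    have h1 := ih fun H => g.apply H (φ H)
    have h2 := influence_apply_le β φ g
    simp only [mass_apply] at h1
    simp only [runGates_cons, List.length_cons]
    push_cast
    linarith

end influence

/-! ### Distinguishers with a resampled oracle -/

namespace Distinguisher

variable {I O X W Y : Type} [Fintype X] [DecidableEq X] [Fintype W] [DecidableEq W] [Fintype Y]
  [DecidableEq Y] (D : Distinguisher I O X W Y)

/-- The projection onto the outcome `(x, w)` of the measurement of the first two registers. -/
noncomputable def measured (x : Bits X) (w : Bits W) (ψ : QState (X ⊕ W ⊕ Fin D.mem)) :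
    QState (X ⊕ W ⊕ Fin D.mem) := fun b =>
  if (fun i => b (Sum.inl i)) = x ∧ (fun i => b (Sum.inr (Sum.inl i))) = w then ψ b else 0

omit [Fintype Y] [DecidableEq Y] in
theorem sum_mass_measured (ψ : QState (X ⊕ W ⊕ Fin D.mem)) :
    ∑ x, ∑ w, mass (D.measured x w ψ) = mass ψ := by
  simp only [mass, measured]
  rw [← Fintype.sum_prod_type', Finset.sum_comm]
  refine Finset.sum_congr rfl fun b _ => ?_
  rw [Finset.sum_eq_single
    ((fun i => b (Sum.inl i)), (fun i => b (Sum.inr (Sum.inl i))))]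
  · simp
  · rintro ⟨x, w⟩ _ hne
    rw [if_neg, norm_zero]
    · norm_num
    · rintro ⟨rfl, rfl⟩
      exact hne rfl
  · simp

/-- The state of the registers of the second stage when it starts. -/
noncomputable def extended (y : Bits Y) (ψ : QState (X ⊕ W ⊕ Fin D.mem)) :
    QState ((X ⊕ W ⊕ Fin D.mem) ⊕ Y ⊕ Fin D.anc) := fun b =>
  if (fun i => b (Sum.inr (Sum.inl i))) = y ∧ (fun i => b (Sum.inr (Sum.inr i))) = fun _ => false
  then ψ (fun v => b (Sum.inl v)) else 0

theorem mass_extended (y : Bits Y) (ψ : QState (X ⊕ W ⊕ Fin D.mem)) :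
    mass (D.extended y ψ) = mass ψ := by
  have hr : ∀ b : Bits ((X ⊕ W ⊕ Fin D.mem) ⊕ Y ⊕ Fin D.anc),
      RestEq (coreOf (Equiv.refl _)) (Sum.elim (fun _ => false) (Sum.elim y fun _ => false)) b ↔
      ((fun i => b (Sum.inr (Sum.inl i))) = y ∧ (fun i => b (Sum.inr (Sum.inr i))) = fun _ => false)
      := by
    intro b
    rw [restEq_coreOf]
    simp [Sum.forall, funext_iff]
  refine sum_eq_sum_core (coreOf (Equiv.refl _))
    (Sum.elim (fun _ => false) (Sum.elim y fun _ => false)) _ _ (fun b hb => ?_) fun b hb => ?_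
  · rw [hr] at hb
    rw [extended, if_neg hb]
    simp
  · rw [hr] at hb
    rw [extended, if_pos hb]
    rfl

omit [Fintype Y] [DecidableEq Y] in
theorem midState_eq (H : Bits I → Bits O) (x : Bits X) (w : Bits W) : D.midState H x w =
    D.measured x w (runGates H D.first (Pi.single (fun _ => false) 1)) := rfl

theorem finalState_eq (H H' : Bits I → Bits O) (x : Bits X) (w : Bits W) (y : Bits Y) :
    D.finalState H H' x w y = runGates H' D.second (D.extended y (D.midState H x w)) := rfl

omit [DecidableEq X] [DecidableEq W] [Fintype Y] [DecidableEq Y] in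
theorem measured_sub (x : Bits X) (w : Bits W) (ψ φ : QState (X ⊕ W ⊕ Fin D.mem)) :
    D.measured x w (ψ - φ) = D.measured x w ψ - D.measured x w φ := by
  funext b
  simp only [measured, Pi.sub_apply]
  split_ifs <;> simp

omit [Fintype X] [DecidableEq X] [Fintype W] [DecidableEq W] [DecidableEq Y] in
theorem extended_sub (y : Bits Y) (ψ φ : QState (X ⊕ W ⊕ Fin D.mem)) :
    D.extended y (ψ - φ) = D.extended y ψ - D.extended y φ := by
  funext b
  simp only [extended, Pi.sub_apply]
  split_ifs <;> simp

omit [Fintype Y] [DecidableEq Y] in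
theorem sum_mass_midState (H : Bits I → Bits O) : ∑ x, ∑ w, mass (D.midState H x w) = 1 := by
  simp only [midState_eq]
  rw [sum_mass_measured, mass_runGates, mass_single]

theorem mass_finalState (H H' : Bits I → Bits O) (x : Bits X) (w : Bits W) (y : Bits Y) :
    mass (D.finalState H H' x w y) = mass (D.midState H x w) := by
  rw [finalState_eq, mass_runGates, mass_extended]

theorem mass_finalState_sub (H K H' : Bits I → Bits O) (x : Bits X) (w : Bits W) (y : Bits Y) :
    mass (D.finalState H H' x w y - D.finalState K H' x w y) =
      mass (D.midState H x w - D.midState K x w) := by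
  rw [finalState_eq, finalState_eq, ← runGates_sub, mass_runGates, ← extended_sub, mass_extended]

/-- On each amplitude, `|‖u‖² - ‖v‖²| ≤ ‖u - v‖ (‖u‖ + ‖v‖)` is split by the inequality of
arithmetic and geometric means with weight `r`. In contrast to the bound by the Cauchy–Schwarz
inequality, the result can be summed over the outcomes `(x, w)` without further loss. -/
theorem abs_prob_sub_prob_le (H H' K K' : Bits I → Bits O) (x : Bits X) (w : Bits W) (y : Bits Y)
    {r : ℝ} (hr : 0 < r) :
    |D.prob H H' x w y - D.prob K K' x w y| ≤
      mass (D.finalState H H' x w y - D.finalState K K' x w y) / (2 * r) +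
        r * (mass (D.midState H x w) + mass (D.midState K x w)) := by
  rw [← D.mass_finalState H H' x w y, ← D.mass_finalState K K' x w y, prob, prob,
    ← Finset.sum_sub_distrib]
  refine (Finset.abs_sum_le_sum_abs _ _).trans ?_
  simp only [mass]
  rw [Finset.sum_div, ← Finset.sum_add_distrib, Finset.mul_sum, ← Finset.sum_add_distrib]
  refine Finset.sum_le_sum fun b _ => ?_
  set u := D.finalState H H' x w y b
  set v := D.finalState K K' x w y b
  rw [Pi.sub_apply]
  have h0 : 0 ≤ ‖u - v‖ ^ 2 / (2 * r) + r * (‖u‖ ^ 2 + ‖v‖ ^ 2) := by positivity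
  split_ifs
  · have h1 : |‖u‖ ^ 2 - ‖v‖ ^ 2| ≤ ‖u - v‖ * (‖u‖ + ‖v‖) := by
      rw [sq_sub_sq, abs_mul, abs_of_nonneg (by positivity : 0 ≤ ‖u‖ + ‖v‖), mul_comm]
      exact mul_le_mul_of_nonneg_right (abs_norm_sub_norm_le u v) (by positivity)
    refine h1.trans ?_
    have h2 : ‖u - v‖ * (‖u‖ + ‖v‖) = (2 * (‖u - v‖ * (r * (‖u‖ + ‖v‖)))) / (2 * r) := by
      field_simp
    have h3 : ‖u - v‖ ^ 2 / (2 * r) + r * (‖u‖ ^ 2 + ‖v‖ ^ 2) =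
        (‖u - v‖ ^ 2 + 2 * r ^ 2 * (‖u‖ ^ 2 + ‖v‖ ^ 2)) / (2 * r) := by
      field_simp
    rw [h2, h3]
    refine div_le_div_of_nonneg_right ?_ (by positivity)
    nlinarith [sq_nonneg (‖u - v‖ - r * (‖u‖ + ‖v‖)), sq_nonneg (r * (‖u‖ - ‖v‖))]
  · simpa using h0

variable [Fintype I] [DecidableEq I] [Fintype O] [DecidableEq O] {B : Type} [Fintype B]
  [DecidableEq B] (β : Bits I → B)

omit [Fintype Y] [DecidableEq Y] in
/-- The influence is summed over all outcomes of the measurement, which is orthogonal, so that only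
the queries of the first stage count. -/
theorem sum_influence_midState_le :
    ∑ x, ∑ w, influence β (fun H => D.midState H x w) ≤ 4 * D.first.length := by
  have h1 : ∑ x, ∑ w, influence β (fun H => D.midState H x w) =
      influence β fun H => runGates H D.first (Pi.single (fun _ => false) 1) := by
    simp only [influence, midState_eq, ← measured_sub]
    have hsum : ∀ F : Bits X → Bits W → B → ℝ,
        ∑ x, ∑ w, ∑ a, F x w a = ∑ a, ∑ x, ∑ w, F x w a := fun F =>
      (Finset.sum_congr rfl fun x _ => Finset.sum_comm).trans Finset.sum_comm
    rw [hsum]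
    refine Finset.sum_congr rfl fun a _ => ?_
    simp only [← Finset.expect_sum_comm _ _ (fun (_ : Bits I → Bits O) _ => _), sum_mass_measured]
  rw [h1]
  refine (influence_runGates_le β _ _).trans ?_
  rw [influence_const]
  simp [mass_single, mul_comm]

theorem sum_influence_finalState_le (y : Bits Y) :
    ∑ x, ∑ w, influence β (fun H => D.finalState H H x w y) ≤
      4 * (D.first.length + D.second.length) := by
  have h1 : ∀ x w, influence β (fun H => D.finalState H H x w y) ≤
      influence β (fun H => D.midState H x w) +
        D.second.length * (4 * 𝔼 H : Bits I → Bits O, mass (D.midState H x w)) := by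
    intro x w
    refine (influence_runGates_le β (fun H => D.extended y (D.midState H x w)) D.second).trans ?_
    simp only [mass_extended]
    refine add_le_add_left (influence_mono β fun H K => ?_) _
    rw [← extended_sub, mass_extended]
  refine (Finset.sum_le_sum fun x _ => Finset.sum_le_sum fun w _ => h1 x w).trans ?_
  simp only [Finset.sum_add_distrib, ← Finset.mul_sum, ← Finset.expect_sum_comm, sum_mass_midState,
    Fintype.expect_const]
  have := D.sum_influence_midState_le β
  linarith

end Distinguisher

/-! ### Oracles with limited independence -/

/-- The span of the functions that depend on at most `q` values of the oracle. -/
def localFun (I O : Type) (q : ℕ) : Submodule ℂ ((Bits I → Bits O) → ℂ) :=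
  Submodule.span ℂ {f | ∃ s : Finset (Bits I), s.card ≤ q ∧ DependsOn f (s : Set (Bits I))}

section localFun

variable {I O : Type} {q q' : ℕ}

theorem localFun_of_dependsOn {f : (Bits I → Bits O) → ℂ} (s : Finset (Bits I)) (hs : s.card ≤ q)
    (hf : DependsOn f (s : Set (Bits I))) : f ∈ localFun I O q :=
  Submodule.subset_span ⟨s, hs, hf⟩

theorem localFun_mono (h : q ≤ q') : localFun I O q ≤ localFun I O q' :=
  Submodule.span_mono fun _ ⟨s, hs, hf⟩ => ⟨s, hs.trans h, hf⟩

theorem const_mem_localFun (c : ℂ) : (fun _ => c) ∈ localFun I O q :=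
  localFun_of_dependsOn ∅ (by simp) fun _ _ _ => rfl

theorem mul_mem_localFun {f g : (Bits I → Bits O) → ℂ} (hf : f ∈ localFun I O q)
    (hg : g ∈ localFun I O q') : (fun H => f H * g H) ∈ localFun I O (q + q') := by
  classical
  induction hf using Submodule.span_induction with
  | mem f hf =>
    obtain ⟨s, hs, hf⟩ := hf
    induction hg using Submodule.span_induction with
    | mem g hg =>
      obtain ⟨s', hs', hg⟩ := hg
      refine localFun_of_dependsOn (s ∪ s')
        ((Finset.card_union_le _ _).trans (add_le_add hs hs')) fun H K h => ?_
      rw [hf fun ξ hξ => h ξ (by simp_all), hg fun ξ hξ => h ξ (by simp_all)]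
    | zero => simpa using const_mem_localFun 0
    | add g g' _ _ h h' =>
      simp only [Pi.add_apply, mul_add]
      exact add_mem h h'
    | smul c g _ h =>
      have : (fun H => f H * (c • g) H) = c • fun H => f H * g H := by
        funext H; simp [mul_left_comm]
      exact this ▸ Submodule.smul_mem _ c h
  | zero => simpa using const_mem_localFun 0
  | add f f' _ _ h h' =>
    simp only [Pi.add_apply, add_mul]
    exact add_mem h h'
  | smul c f _ h =>
    have : (fun H => (c • f) H * g H) = c • fun H => f H * g H := by
      funext H; simp [mul_assoc]
    exact this ▸ Submodule.smul_mem _ c h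

theorem conj_mem_localFun {f : (Bits I → Bits O) → ℂ} (hf : f ∈ localFun I O q) :
    (fun H => (starRingEnd ℂ) (f H)) ∈ localFun I O q := by
  induction hf using Submodule.span_induction with
  | mem f hf =>
    obtain ⟨s, hs, hf⟩ := hf
    exact localFun_of_dependsOn s hs fun H K h => congrArg _ (hf h)
  | zero => simpa using const_mem_localFun 0
  | add f f' _ _ h h' =>
    simp only [Pi.add_apply, map_add]
    exact add_mem h h'
  | smul c f _ h =>
    have : (fun H => (starRingEnd ℂ) ((c • f) H)) =
        (starRingEnd ℂ) c • fun H => (starRingEnd ℂ) (f H) := by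
      funext H; simp
    exact this ▸ Submodule.smul_mem _ _ h

theorem sum_mem_localFun {J : Type} (s : Finset J) {f : J → (Bits I → Bits O) → ℂ}
    (hf : ∀ j ∈ s, f j ∈ localFun I O q) : (fun H => ∑ j ∈ s, f j H) ∈ localFun I O q := by
  have : (fun H => ∑ j ∈ s, f j H) = ∑ j ∈ s, f j := by funext H; simp
  exact this ▸ sum_mem hf

end localFun

/-- The polynomial method: if each value of `R H` depends only on the value of `H` at the same
point, then the amplitudes of a circuit with oracle `R H` have a degree that grows by 1 with each
query. -/
theorem runGates_mem_localFun {I O W : Type} [Fintype O] [DecidableEq O] [DecidableEq W]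
    (R : (Bits I → Bits O) → Bits I → Bits O)
    (hR : ∀ H K ξ, H ξ = K ξ → R H ξ = R K ξ) (gs : List (QGate I O W)) {q : ℕ}
    (φ : (Bits I → Bits O) → QState W) (hφ : ∀ b, (fun H => φ H b) ∈ localFun I O q) (b : Bits W) :
    (fun H => runGates (R H) gs (φ H) b) ∈ localFun I O (q + gs.length) := by
  classical
  induction gs generalizing q φ b with
  | nil => exact hφ b
  | cons g gs ih =>
    have h1 : ∀ b, (fun H => g.apply (R H) (φ H) b) ∈ localFun I O (q + 1) := by
      intro b
      cases g with
      | classical g => exact localFun_mono (Nat.le_succ q) (hφ _)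
      | hadamard t =>
        refine localFun_mono (Nat.le_succ q) ?_
        have : (fun H => (QGate.hadamard t : QGate I O W).apply (R H) (φ H) b) =
            ((Real.sqrt 2 : ℂ))⁻¹ • ((fun H => φ H (Function.update b t false)) +
              (if b t then -1 else 1 : ℂ) • fun H => φ H (Function.update b t true)) := by
          funext H
          by_cases hb : b t <;> simp [QGate.apply, div_eq_inv_mul, hb]
        rw [this]
        exact Submodule.smul_mem _ _ (add_mem (hφ _) (Submodule.smul_mem _ _ (hφ _)))
      | phaseT t => exact localFun_mono (Nat.le_succ q) (Submodule.smul_mem _ _ (hφ _))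
      | query e =>
        have : (fun H => (QGate.query e).apply (R H) (φ H) b) = fun H => ∑ y : Bits O,
            (if R H (fun i => b (e (Sum.inl i))) = y then 1 else 0) *
              φ H (queryPerm (fun _ => y) e b) := by
          funext H
          simp only [ite_mul, one_mul, zero_mul, Finset.sum_ite_eq, Finset.mem_univ, if_true]
          exact congrArg (φ H) (queryPerm_congr e rfl)
        rw [this, add_comm]
        refine sum_mem_localFun _ fun y _ => mul_mem_localFun ?_ (hφ _)
        refine localFun_of_dependsOn {fun i => b (e (Sum.inl i))} (by simp) fun H K h => ?_
        rw [hR H K _ (h _ (by simp))]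
    have h2 := ih (fun H => g.apply (R H) (φ H)) h1 b
    rw [List.length_cons, ← add_assoc, add_right_comm]
    exact h2

/-- A probability is a product of amplitudes and their conjugates, hence the factor 2. -/
theorem Distinguisher.prob_mem_localFun {I O X W Y : Type} [Fintype O] [DecidableEq O] [Fintype X]
    [DecidableEq X] [Fintype W] [DecidableEq W] [Fintype Y] [DecidableEq Y]
    (D : Distinguisher I O X W Y) (R : (Bits I → Bits O) → Bits I → Bits O)
    (hR : ∀ H K ξ, H ξ = K ξ → R H ξ = R K ξ) (x : Bits X) (w : Bits W) (y : Bits Y) :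
    (fun H => (D.prob H (R H) x w y : ℂ)) ∈
      localFun I O (2 * (D.first.length + D.second.length)) := by
  have h1 : ∀ b, (fun H => D.midState H x w b) ∈ localFun I O D.first.length := by
    intro b
    have := runGates_mem_localFun (W := X ⊕ W ⊕ Fin D.mem) (fun H : Bits I → Bits O => H)
      (fun _ _ _ h => h) D.first (q := 0) (fun _ => Pi.single (fun _ => false) 1)
      (fun _ => const_mem_localFun _) b
    rw [zero_add] at this
    simp only [Distinguisher.midState]
    split_ifs
    · exact this
    · exact const_mem_localFun 0
  have h2 : ∀ b, (fun H => D.finalState H (R H) x w y b) ∈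
      localFun I O (D.first.length + D.second.length) := by
    intro b
    refine runGates_mem_localFun R hR D.second _ (fun b => ?_) b
    split_ifs
    · exact h1 _
    · exact const_mem_localFun 0
  have h3 : (fun H => (D.prob H (R H) x w y : ℂ)) = fun H => ∑ b, if b D.out then
      D.finalState H (R H) x w y b * (starRingEnd ℂ) (D.finalState H (R H) x w y b) else 0 := by
    funext H
    rw [Distinguisher.prob, Complex.ofReal_sum]
    refine Finset.sum_congr rfl fun b _ => ?_
    split_ifs
    · rw [Complex.mul_conj']; simp
    · simp
  rw [h3, two_mul]
  refine sum_mem_localFun _ fun b _ => ?_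
  split_ifs
  · exact mul_mem_localFun (h2 b) (conj_mem_localFun (h2 b))
  · exact const_mem_localFun 0

/-- A family of oracles is `q`-wise independent: the values of a random member at any `q` points are
distributed as for a uniformly random oracle. -/
def WiseIndep {I O K : Type} [Fintype I] [DecidableEq I] [Fintype O] [DecidableEq O] [Fintype K]
    (q : ℕ) (E : K → Bits I → Bits O) : Prop :=
  ∀ (s : Finset (Bits I)), s.card ≤ q → ∀ F : (Bits I → Bits O) → ℂ,
    DependsOn F (s : Set (Bits I)) → 𝔼 κ, F (E κ) = 𝔼 H : Bits I → Bits O, F H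

/-- By linearity, `q`-wise independence extends to the span of the functions of `q` values. -/
theorem WiseIndep.expect_eq {I O K : Type} [Fintype I] [DecidableEq I] [Fintype O] [DecidableEq O]
    [Fintype K] {q : ℕ} {E : K → Bits I → Bits O} (hE : WiseIndep q E)
    {f : (Bits I → Bits O) → ℂ} (hf : f ∈ localFun I O q) :
    𝔼 κ, f (E κ) = 𝔼 H : Bits I → Bits O, f H := by
  induction hf using Submodule.span_induction with
  | mem f hf =>
    obtain ⟨s, hs, hf⟩ := hf
    exact hE s hs f hf
  | zero => simp
  | add f g _ _ h h' => simp only [Pi.add_apply, Finset.expect_add_distrib, h, h']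
  | smul c f _ h => simp only [Pi.smul_apply, smul_eq_mul, ← Finset.mul_expect, h]

/-! ### Polynomials over a binary field -/

/-- A surjective homomorphism maps the uniform distribution to the uniform distribution. -/
theorem expect_comp_of_surjective {A B : Type} [AddGroup A] [Fintype A] [AddGroup B] [Fintype B]
    (ρ : A →+ B) (hρ : Function.Surjective ρ) (F : B → ℂ) : 𝔼 a, F (ρ a) = 𝔼 b, F b := by
  have h1 : ∀ b, 𝔼 a, F (ρ a + b) = 𝔼 a, F (ρ a) := by
    intro b
    obtain ⟨c, rfl⟩ := hρ b
    exact Fintype.expect_equiv (Equiv.addRight c) _ _ fun a => by simp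
  have h2 : ∀ a, 𝔼 b, F (ρ a + b) = 𝔼 b, F b := fun a =>
    Fintype.expect_equiv (Equiv.addLeft (ρ a)) _ _ fun b => by simp
  have h3 : 𝔼 b : B, 𝔼 a : A, F (ρ a + b) = 𝔼 a, F (ρ a) := by
    simp only [h1, Fintype.expect_const]
  rw [← h3, Finset.expect_comm]
  simp only [h2, Fintype.expect_const]

/-- A bit as an element of the field with two elements. -/
def toBit (b : Bool) : ZMod 2 := if b then 1 else 0

/-- The inverse of `toBit`. -/
def ofBit (z : ZMod 2) : Bool := decide (z = 1)

@[simp] theorem ofBit_toBit (b : Bool) : ofBit (toBit b) = b := by cases b <;> rfl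

@[simp] theorem toBit_ofBit (z : ZMod 2) : toBit (ofBit z) = z := by revert z; decide

theorem ofBit_add (y z : ZMod 2) : ofBit (y + z) = xor (ofBit y) (ofBit z) := by
  revert y z; decide

theorem ofBit_mul (y z : ZMod 2) : ofBit (y * z) = (ofBit y && ofBit z) := by
  revert y z; decide

theorem Cost.sum {I K : Type} [Fintype K] {s : ℕ} {f : K → Bits I → ZMod 2}
    (hf : ∀ κ, Cost s fun (_ : Unit) x => ofBit (f κ x)) :
    Cost (Fintype.card K * (s + 1) + 1) fun (_ : Unit) x => ofBit (∑ κ, f κ x) := by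
  classical
  have key : ∀ T : Finset K, Cost (T.card * (s + 1) + 1) fun (_ : Unit) x =>
      ofBit (∑ κ ∈ T, f κ x) := by
    intro T
    induction T using Finset.induction_on with
    | empty => simpa using Cost.const (I := I) (O := Unit) (ofBit 0)
    | insert a T ha ih =>
      simp only [Finset.sum_insert ha, ofBit_add, Finset.card_insert_of_notMem ha]
      exact ((hf a).xor ih).mono (by ring_nf; omega)
  exact key Finset.univ

/-- The polynomial with coefficients `κ`. -/
def polyEval {K : Type} [CommRing K] : {d : ℕ} → (Fin d → K) → K → K
  | 0, _, _ => 0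
  | _ + 1, κ, x => polyEval (fun j => κ j.succ) x * x + κ 0

theorem polyEval_eq_sum {K : Type} [CommRing K] {d : ℕ} (κ : Fin d → K) (x : K) :
    polyEval κ x = ∑ j, κ j * x ^ (j : ℕ) := by
  induction d with
  | zero => simp [polyEval]
  | succ d ih =>
    rw [polyEval, ih, Fin.sum_univ_succ, Finset.sum_mul, add_comm]
    simp [pow_succ, mul_assoc]

/-- Lagrange interpolation with at most `d` nodes. -/
theorem exists_polyEval_eq {K : Type} [Field K] [DecidableEq K] {d : ℕ} (s : Finset K)
    (hs : s.card ≤ d) (r : K → K) : ∃ κ : Fin d → K, ∀ x ∈ s, polyEval κ x = r x := by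
  have hinj : Set.InjOn (id : K → K) s := Function.injective_id.injOn
  refine ⟨fun j => (Lagrange.interpolate s id r).coeff j, fun x hx => ?_⟩
  have h1 : (Lagrange.interpolate s id r).eval x = r x :=
    Lagrange.eval_interpolate_at_node (v := id) r hinj hx
  have h2 : (Lagrange.interpolate s id r).natDegree < d := by
    have hd : 0 < d := (Finset.card_pos.2 ⟨x, hx⟩).trans_le hs
    rcases eq_or_ne (Lagrange.interpolate s id r) 0 with h0 | h0
    · rw [h0]; simpa using hd
    · rw [Polynomial.natDegree_lt_iff_degree_lt h0]
      exact (Lagrange.degree_interpolate_lt r hinj).trans_le (by exact_mod_cast hs)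
  rw [polyEval_eq_sum, ← h1, Polynomial.eval_eq_sum_range' h2, Finset.sum_range]

section family

variable {I O K : Type} [Fintype I] [DecidableEq I] [Fintype O] [DecidableEq O] [Field K]
  [Algebra (ZMod 2) K] (B : Module.Basis (I ⊕ O ⊕ Unit) (ZMod 2) K)

/-- A bit string as a field element. The basis has vectors for the input bits, for the output bits
of the oracle, and one more so that it is not empty. -/
noncomputable def fieldOfBits (ξ : Bits I) : K := ∑ i, toBit (ξ i) • B (Sum.inl i)

omit [DecidableEq I] [Fintype O] [DecidableEq O] in
theorem repr_fieldOfBits (ξ : Bits I) (i : I) :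
    B.repr (fieldOfBits B ξ) (Sum.inl i) = toBit (ξ i) := by
  classical
  simp [fieldOfBits, Finsupp.single_apply]

omit [DecidableEq I] [Fintype O] [DecidableEq O] in
theorem fieldOfBits_injective : Function.Injective (fieldOfBits B : Bits I → K) := by
  intro ξ ξ' h
  funext i
  have := congrArg (fun y => ofBit (B.repr y (Sum.inl i))) h
  simpa only [repr_fieldOfBits, ofBit_toBit] using this

/-- The oracle given by a polynomial: the coordinates of its value that belong to output bits. -/
noncomputable def polyOracle {d : ℕ} (κ : Fin d → K) (ξ : Bits I) : Bits O := fun o =>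
  ofBit (B.repr (polyEval κ (fieldOfBits B ξ)) (Sum.inr (Sum.inl o)))

/-- By interpolation, the values of a random polynomial of degree less than `d` at `d` points are
independent and uniform. -/
theorem wiseIndep_polyOracle [Fintype K] (d : ℕ) :
    WiseIndep d (polyOracle B : (Fin d → K) → Bits I → Bits O) := by
  classical
  intro s hs F hF
  let ρ₁ : (Fin d → K) →+ (s → O → ZMod 2) :=
    { toFun := fun κ ξ o => B.repr (polyEval κ (fieldOfBits B ξ.1)) (Sum.inr (Sum.inl o))
      map_zero' := by
        funext ξ o
        simp [polyEval_eq_sum]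
      map_add' := fun κ κ' => by
        funext ξ o
        simp [polyEval_eq_sum, add_mul, Finset.sum_add_distrib] }
  let ρ₂ : (Bits I → O → ZMod 2) →+ (s → O → ZMod 2) :=
    { toFun := fun G ξ => G ξ.1, map_zero' := rfl, map_add' := fun _ _ => rfl }
  let F' : (s → O → ZMod 2) → ℂ := fun v =>
    F fun ξ o => if h : ξ ∈ s then ofBit (v ⟨ξ, h⟩ o) else false
  have hρ₁ : Function.Surjective ρ₁ := by
    intro v
    obtain ⟨κ, hκ⟩ := exists_polyEval_eq (s.image (fieldOfBits B))
      (Finset.card_image_le.trans hs) (fun y => if h : ∃ ξ : s, fieldOfBits B ξ.1 = y then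
        ∑ o, v h.choose o • B (Sum.inr (Sum.inl o)) else 0)
    refine ⟨κ, ?_⟩
    funext ξ o
    have h : ∃ ξ' : s, fieldOfBits B ξ'.1 = fieldOfBits B ξ.1 := ⟨ξ, rfl⟩
    have hξ : h.choose = ξ := Subtype.ext (fieldOfBits_injective B h.choose_spec)
    have := hκ (fieldOfBits B ξ.1) (Finset.mem_image_of_mem _ ξ.2)
    rw [dif_pos h, hξ] at this
    change B.repr (polyEval κ (fieldOfBits B ξ.1)) (Sum.inr (Sum.inl o)) = v ξ o
    rw [this]
    simp [Finsupp.single_apply]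
  have hρ₂ : Function.Surjective ρ₂ := fun v =>
    ⟨fun ξ => if h : ξ ∈ s then v ⟨ξ, h⟩ else 0, by funext ξ; simp [ρ₂]⟩
  have h1 : ∀ κ : Fin d → K, F (polyOracle B κ) = F' (ρ₁ κ) := fun κ => hF fun ξ hξ => by
    funext o
    rw [dif_pos (Finset.mem_coe.1 hξ)]
    rfl
  let toB : (Bits I → Bits O) ≃ (Bits I → O → ZMod 2) :=
    { toFun := fun H ξ o => toBit (H ξ o)
      invFun := fun G ξ o => ofBit (G ξ o)
      left_inv := fun H => by simp
      right_inv := fun G => by simp }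
  simp only [h1]
  rw [expect_comp_of_surjective ρ₁ hρ₁, ← expect_comp_of_surjective ρ₂ hρ₂]
  refine (Fintype.expect_equiv toB _ _ fun H => hF fun ξ hξ => ?_).symm
  funext o
  rw [dif_pos (Finset.mem_coe.1 hξ)]
  exact (ofBit_toBit _).symm

omit [DecidableEq I] [DecidableEq O] in
/-- Evaluation by Horner's scheme. The coefficients and the multiplication table of the field are
built into the circuit. -/
theorem cost_polyEval {d : ℕ} (κ : Fin d → K) :
    Cost (1 + d * (Fintype.card I + Fintype.card (I ⊕ O ⊕ Unit) *
      (Fintype.card (I ⊕ O ⊕ Unit) * Fintype.card I * 6 + 3)))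
      fun c ξ => ofBit (B.repr (polyEval κ (fieldOfBits B ξ)) c) := by
  induction d with
  | zero => simpa [polyEval] using Cost.const (I := I) (ofBit 0)
  | succ d ih =>
    -- one step of Horner's scheme, on the coordinates of the accumulator and the input bits
    have step : ∀ c : I ⊕ O ⊕ Unit, Cost
        (Fintype.card ((I ⊕ O ⊕ Unit) × I) * (5 + 1) + 1 + 1 + 1)
        fun (_ : Unit) (u : Bits ((I ⊕ O ⊕ Unit) ⊕ I)) =>
          Bool.xor (ofBit (∑ p : (I ⊕ O ⊕ Unit) × I, toBit (u (Sum.inl p.1)) *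
            toBit (u (Sum.inr p.2)) * B.repr (B p.1 * B (Sum.inl p.2)) c))
            (ofBit (B.repr (κ 0) c)) := by
      intro c
      refine (Cost.sum fun p => ?_).xor (Cost.const _)
      simp only [ofBit_mul, ofBit_toBit]
      exact ((Cost.input _).and (Cost.input _)).and (Cost.const _)
    have hin : Cost (Fintype.card I) fun (i : I) (ξ : Bits I) => ξ i := by
      simpa using Cost.pi' fun i : I => Cost.input (O := Unit) i
    have h := Cost.comp ((ih fun j => κ j.succ).sumElim hin) (Cost.pi' step)
    have heq : (fun c (ξ : Bits I) => ofBit (B.repr (polyEval κ (fieldOfBits B ξ)) c)) =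
        fun c ξ => Bool.xor (ofBit (∑ p : (I ⊕ O ⊕ Unit) × I,
          toBit (ofBit (B.repr (polyEval (fun j => κ j.succ) (fieldOfBits B ξ)) p.1)) *
            toBit (ξ p.2) * B.repr (B p.1 * B (Sum.inl p.2)) c)) (ofBit (B.repr (κ 0) c)) := by
      funext c ξ
      rw [polyEval, map_add, Finsupp.add_apply, ofBit_add]
      congr 2
      generalize polyEval (fun j => κ j.succ) (fieldOfBits B ξ) = y
      have hy : y * fieldOfBits B ξ = ∑ p : (I ⊕ O ⊕ Unit) × I,
          (B.repr y p.1 * toBit (ξ p.2)) • (B p.1 * B (Sum.inl p.2)) := by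
        conv_lhs => rw [← B.sum_repr y, fieldOfBits, Finset.sum_mul_sum]
        rw [Fintype.sum_prod_type]
        exact Finset.sum_congr rfl fun i _ => Finset.sum_congr rfl fun j _ => by
          rw [smul_mul_smul_comm]
      rw [hy]
      simp
    rw [heq]
    refine h.mono ?_
    rw [Fintype.card_prod]
    generalize Fintype.card (I ⊕ O ⊕ Unit) = m
    ring_nf
    omega

end family

/-- There are `d`-wise independent oracles with circuits of polynomial size. -/
theorem exists_wiseIndep (I O : Type) [Fintype I] [DecidableEq I] [Fintype O] [DecidableEq O]
    (d : ℕ) : ∃ (K : Type) (_ : Fintype K) (_ : Nonempty K) (E : K → Bits I → Bits O),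
      WiseIndep d E ∧ ∀ κ, Cost (1 + d * (Fintype.card I + (Fintype.card I + (Fintype.card O + 1)) *
        ((Fintype.card I + (Fintype.card O + 1)) * Fintype.card I * 6 + 3)))
        fun o ξ => E κ ξ o := by
  classical
  have hm : Fintype.card (I ⊕ O ⊕ Unit) ≠ 0 := Fintype.card_ne_zero
  let F := GaloisField 2 (Fintype.card (I ⊕ O ⊕ Unit))
  let _ : Fintype F := Fintype.ofFinite F
  let B : Module.Basis (I ⊕ O ⊕ Unit) (ZMod 2) F :=
    (Module.finBasisOfFinrankEq (ZMod 2) F (GaloisField.finrank 2 hm)).reindex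
      (Fintype.equivFin _).symm
  refine ⟨Fin d → F, inferInstance, inferInstance, polyOracle B, wiseIndep_polyOracle B d,
    fun κ => ?_⟩
  have h := (cost_polyEval B κ).reindex fun o : O => Sum.inr (Sum.inl o)
  simp only [Fintype.card_sum, Fintype.card_unit] at h
  exact h

/-! ### Adaptive reprogramming -/

section reprogram

open Classical in
/-- The values of `H` at the points `p j` with `j` in `M h` are replaced by `h j`. This is meant for
injective `p`; otherwise one of the values is chosen. -/
noncomputable def reprogramAt {J X Y : Type} (p : J → X) (M : (J → Y) → Set J) (h : J → Y)
    (H : X → Y) : X → Y := fun ξ =>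
  if hx : ∃ j, j ∈ M h ∧ p j = ξ then h hx.choose else H ξ

variable {J X Y : Type} {p : J → X} (hp : Function.Injective p) (M : (J → Y) → Set J)

include hp in
theorem reprogramAt_of_mem {h : J → Y} {j : J} (hj : j ∈ M h) (H : X → Y) :
    reprogramAt p M h H (p j) = h j := by
  have hx : ∃ j', j' ∈ M h ∧ p j' = p j := ⟨j, hj, rfl⟩
  rw [reprogramAt, dif_pos hx, hp hx.choose_spec.2]

theorem reprogramAt_of_forall {h : J → Y} {ξ : X} (hξ : ∀ j ∈ M h, p j ≠ ξ) (H : X → Y) :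
    reprogramAt p M h H ξ = H ξ := by
  rw [reprogramAt, dif_neg]
  rintro ⟨j, hj, rfl⟩
  exact hξ j hj rfl

include hp in
/-- Reprogramming a random oracle with random values gives a random oracle, even if the set of
reprogrammed points is chosen adaptively: whether `j` belongs to `M h` may only be determined by the
values of `h` on `M h`. Old and new values can then be exchanged, which is a bijection. -/
theorem expect_reprogramAt [Fintype J] [DecidableEq J] [Fintype X] [DecidableEq X] [Fintype Y]
    (hM : ∀ h h' : J → Y, (∀ j ∈ M h, h j = h' j) → M h = M h') (F : (X → Y) → ℝ) :
    𝔼 H : X → Y, 𝔼 h : J → Y, F (reprogramAt p M h H) = 𝔼 H : X → Y, F H := by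
  classical
  rcases isEmpty_or_nonempty (J → Y) with hJ | hJ
  · obtain ⟨j⟩ : Nonempty J := by
      by_contra hne
      rw [not_nonempty_iff] at hne
      exact hJ.false fun j => hne.elim j
    have hY : IsEmpty Y := by
      by_contra hne
      rw [not_isEmpty_iff] at hne
      obtain ⟨y⟩ := hne
      exact hJ.false fun _ => y
    have : IsEmpty (X → Y) := ⟨fun H => hY.elim (H (p j))⟩
    simp
  let T : (X → Y) × (J → Y) → (X → Y) × (J → Y) := fun q =>
    (reprogramAt p M q.2 q.1, fun j => if j ∈ M q.2 then q.1 (p j) else q.2 j)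
  have hmask : ∀ (H : X → Y) (h : J → Y), M (fun j => reprogramAt p M h H (p j)) = M h :=
    fun H h => (hM _ _ fun j hj => (reprogramAt_of_mem hp M hj H).symm).symm
  have hT : Function.Injective T := by
    rintro ⟨H₁, h₁⟩ ⟨H₂, h₂⟩ h
    obtain ⟨e1, e2⟩ := Prod.ext_iff.1 h
    dsimp only [T] at e1 e2
    have hMM : M h₁ = M h₂ := by rw [← hmask H₁ h₁, ← hmask H₂ h₂, e1]
    have hh : h₁ = h₂ := by
      funext j
      by_cases hj : j ∈ M h₁
      · rw [← reprogramAt_of_mem hp M hj H₁, e1, reprogramAt_of_mem hp M (hMM ▸ hj)]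
      · have := congrFun e2 j
        rwa [if_neg hj, if_neg (hMM ▸ hj)] at this
    subst hh
    refine Prod.ext (funext fun ξ => ?_) rfl
    by_cases hξ : ∃ j ∈ M h₁, p j = ξ
    · obtain ⟨j, hj, rfl⟩ := hξ
      have := congrFun e2 j
      rwa [if_pos hj, if_pos hj] at this
    · push Not at hξ
      have := congrFun e1 ξ
      rwa [reprogramAt_of_forall M hξ, reprogramAt_of_forall M hξ] at this
  have h1 := Fintype.expect_bijective T (Finite.injective_iff_bijective.1 hT)
    (fun q => F (reprogramAt p M q.2 q.1)) (fun q => F q.1) fun _ => rfl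
  rw [← Finset.univ_product_univ, Finset.expect_product, Finset.expect_product] at h1
  simpa using h1

end reprogram

section block

variable {I O W B : Type} [Fintype I] [DecidableEq I] [Fintype O] [DecidableEq O] [Fintype W]
  [DecidableEq W] [Fintype B] [DecidableEq B] (β : Bits I → B)

/-- The influence of one block. -/
noncomputable def blockInfluence (φ : (Bits I → Bits O) → QState W) (a : B) : ℝ :=
  𝔼 H : Bits I → Bits O, 𝔼 H' : Bits I → Bits O, mass (φ H - φ (mergeBlock β a H' H))

omit [Fintype B] in
theorem blockInfluence_nonneg (φ : (Bits I → Bits O) → QState W) (a : B) :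
    0 ≤ blockInfluence β φ a :=
  Finset.expect_nonneg fun _ _ => Finset.expect_nonneg fun _ _ => mass_nonneg _

omit [Fintype B] in
/-- Reprogramming within one block changes the state by at most four times the influence of the
block, because both oracles become the same when the block is resampled. -/
theorem expect_mass_reprogramAt_le {J : Type} [Fintype J] [DecidableEq J] {p : J → Bits I}
    (hp : Function.Injective p) (M : (J → Bits O) → Set J)
    (hM : ∀ h h' : J → Bits O, (∀ j ∈ M h, h j = h' j) → M h = M h')
    (φ : (Bits I → Bits O) → QState W) {a : B} (ha : ∀ j, β (p j) = a) :
    𝔼 H : Bits I → Bits O, 𝔼 h : J → Bits O, mass (φ (reprogramAt p M h H) - φ H) ≤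
      4 * blockInfluence β φ a := by
  have hmerge : ∀ (H K : Bits I → Bits O) h,
      mergeBlock β a K (reprogramAt p M h H) = mergeBlock β a K H := by
    intro H K h
    funext ξ
    simp only [mergeBlock]
    split_ifs with hξ
    · rfl
    · exact reprogramAt_of_forall M (fun j _ hj => hξ (by rw [← hj]; exact ha j)) H
  have key : ∀ (H K : Bits I → Bits O) h, mass (φ (reprogramAt p M h H) - φ H) ≤
      2 * mass (φ (reprogramAt p M h H) - φ (mergeBlock β a K (reprogramAt p M h H))) +
        2 * mass (φ H - φ (mergeBlock β a K H)) := by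
    intro H K h
    rw [hmerge]
    have := mass_sub_le (φ (reprogramAt p M h H) - φ (mergeBlock β a K H))
      (φ H - φ (mergeBlock β a K H))
    rwa [sub_sub_sub_cancel_right] at this
  let G : (Bits I → Bits O) → ℝ := fun H =>
    𝔼 K : Bits I → Bits O, mass (φ H - φ (mergeBlock β a K H))
  have key' : ∀ (H : Bits I → Bits O) h, mass (φ (reprogramAt p M h H) - φ H) ≤
      2 * G (reprogramAt p M h H) + 2 * G H := by
    intro H h
    have h1 : mass (φ (reprogramAt p M h H) - φ H) = 𝔼 _K : Bits I → Bits O,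
      mass (φ (reprogramAt p M h H) - φ H) := (Fintype.expect_const _).symm
    rw [h1]
    simp only [G, Finset.mul_expect, ← Finset.expect_add_distrib]
    exact Finset.expect_le_expect fun K _ => key H K h
  refine (Finset.expect_le_expect fun H _ => Finset.expect_le_expect fun h _ => key' H h).trans ?_
  simp only [Finset.expect_add_distrib, ← Finset.mul_expect, Fintype.expect_const]
  rw [expect_reprogramAt hp M hM G]
  simp only [G, blockInfluence]
  linarith

/-- For a random block that is hard to guess, the expected influence is a small part of the total
influence. -/
theorem expect_blockInfluence_le {Ω : Type} [Fintype Ω] (φ : (Bits I → Bits O) → QState W)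
    (a : Ω → B) {q : ℝ} (hq : ∀ b, (𝔼 ω, if a ω = b then (1 : ℝ) else 0) ≤ q) :
    𝔼 ω, blockInfluence β φ (a ω) ≤ q * influence β φ := by
  have h1 : ∀ ω, blockInfluence β φ (a ω) =
      ∑ b, (if a ω = b then (1 : ℝ) else 0) * blockInfluence β φ b := fun ω => by simp
  simp only [h1]
  rw [Finset.expect_sum_comm, influence, Finset.mul_sum]
  refine Finset.sum_le_sum fun b _ => ?_
  rw [← Finset.expect_mul]
  exact mul_le_mul_of_nonneg_right (hq b) (blockInfluence_nonneg β φ b)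

end block

/-! ### The search for challenges -/

/-- The first index at which `h` takes the value `0^l`. -/
def firstZero {m l : ℕ} (h : Fin m → Bits (Fin l)) : Option (Fin m) :=
  (List.finRange m).find? fun c => decide (h c = fun _ => false)

theorem firstZero_eq_some_iff {m l : ℕ} {h : Fin m → Bits (Fin l)} {c : Fin m} :
    firstZero h = some c ↔ (h c = fun _ => false) ∧ ∀ c' < c, h c' ≠ fun _ => false := by
  rw [firstZero, List.find?_eq_some_iff_getElem]
  constructor
  · rintro ⟨h1, i, hi, h2, h3⟩
    refine ⟨by simpa using h1, fun c' hc' => ?_⟩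
    have hc : i = (c : ℕ) := by simpa [Fin.ext_iff] using h2
    have := h3 c' (by rw [hc]; exact hc')
    simpa using this
  · rintro ⟨h1, h2⟩
    refine ⟨by simpa using h1, c, by simp, by simp, fun j hj => ?_⟩
    simpa using h2 ⟨j, by omega⟩ hj

theorem firstZero_eq_none_iff {m l : ℕ} {h : Fin m → Bits (Fin l)} :
    firstZero h = none ↔ ∀ c, h c ≠ fun _ => false := by
  simp [firstZero]

/-- The attempts that are made when `h` gives the answers: those without a success before. -/
def attempts {ι : Type} {m l : ℕ} (h : ι × Fin m → Bits (Fin l)) : Set (ι × Fin m) :=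
  {p | ∀ c < p.2, h (p.1, c) ≠ fun _ => false}

/-- The result of the search depends only on the answers in the attempts that are made. -/
theorem firstZero_congr {ι : Type} {m l : ℕ} {h h' : ι × Fin m → Bits (Fin l)}
    (hh : ∀ p ∈ attempts h, h p = h' p) (i : ι) :
    firstZero (fun c => h' (i, c)) = firstZero fun c => h (i, c) := by
  rcases hf : firstZero fun c => h (i, c) with _ | c
  · rw [firstZero_eq_none_iff] at hf ⊢
    exact fun c => by rw [← hh (i, c) fun c' _ => hf c']; exact hf c
  · rw [firstZero_eq_some_iff] at hf ⊢
    refine ⟨by rw [← hh (i, c) hf.2]; exact hf.1, fun c' hc' => ?_⟩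
    rw [← hh (i, c') fun c'' hc'' => hf.2 c'' (hc''.trans hc')]
    exact hf.2 c' hc'

/-- Whether an attempt is made depends only on the answers in the attempts before it. -/
theorem attempts_congr {ι : Type} {m l : ℕ} {h h' : ι × Fin m → Bits (Fin l)}
    (hh : ∀ p ∈ attempts h, h p = h' p) : attempts h = attempts h' := by
  have key : ∀ (i : ι) (N : ℕ) (c : Fin m), (c : ℕ) < N →
      ((i, c) ∈ attempts h ↔ (i, c) ∈ attempts h') := by
    intro i N
    induction N with
    | zero => exact fun c hc => absurd hc (by omega)
    | succ N ih =>
      intro c hc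
      refine ⟨fun h1 c' hc' => ?_, fun h1 c' hc' => ?_⟩
      · rw [← hh (i, c') fun c'' hc'' => h1 c'' (hc''.trans hc')]
        exact h1 c' hc'
      · rw [hh (i, c') ((ih c' (by have : (c' : ℕ) < c := hc'; omega)).2
          fun c'' hc'' => h1 c'' (hc''.trans hc'))]
        exact h1 c' hc'
  ext ⟨i, c⟩
  exact key i _ c (Nat.lt_succ_self _)

theorem natBits_injective {m c c' : ℕ} (hc : c < 2 ^ m) (hc' : c' < 2 ^ m)
    (h : natBits m c = natBits m c') : c = c' := by
  refine Nat.eq_of_testBit_eq fun j => ?_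
  by_cases hj : j < m
  · exact congrFun h ⟨j, hj⟩
  · have hm : (2 : ℕ) ^ m ≤ 2 ^ j := Nat.pow_le_pow_right (by norm_num) (by omega)
    rw [Nat.testBit_lt_two_pow (hc.trans_le hm), Nat.testBit_lt_two_pow (hc'.trans_le hm)]

theorem ThreeRound.chal_injective {S : ThreeRound} {n c c' : ℕ} (hc : c < S.numCh n)
    (hc' : c' < S.numCh n) (h : S.chal n c = S.chal n c') : c = c' :=
  natBits_injective (hc.trans (Nat.lt_size_self _)) (hc'.trans (Nat.lt_size_self _)) h

namespace Fischlin

variable {S : ThreeRound} {k l t : ℕ → ℕ} {n : ℕ}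

theorem query_injective {a a' : Fin (k n) → S.Com n} {i i' : Fin (k n)} {c c' : S.Chal n}
    {z z' : S.Resp n} (h : query S k n a i c z = query S k n a' i' c' z') :
    a = a' ∧ i = i' ∧ c = c' ∧ z = z' := by
  refine ⟨funext fun i => funext fun j => congrFun h (Sum.inl (i, j)), ?_,
    funext fun j => congrFun h (Sum.inr (Sum.inr (Sum.inl j))),
    funext fun j => congrFun h (Sum.inr (Sum.inr (Sum.inr j)))⟩
  exact Fin.ext (natBits_injective (i.2.trans (Nat.lt_size_self _))
    (i'.2.trans (Nat.lt_size_self _)) (funext fun j => congrFun h (Sum.inr (Sum.inl j))))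

/-- Hash values for all attempts `(i, c)` of the search. -/
abbrev Answers (k l t : ℕ → ℕ) (n : ℕ) : Type := Fin (k n) × Fin (t n + 2) → Bits (Fin (l n))

/-- With these hash values the search succeeds in every repetition. -/
def Succeeds (h : Answers k l t n) : Prop := ∀ i, (firstZero fun c => h (i, c)).isSome

/-- The challenge found in repetition `i`, with 0 as a default if there is none. -/
def chosen (h : Answers k l t n) (i : Fin (k n)) : Fin (t n + 2) :=
  (firstZero fun c => h (i, c)).getD 0

open Classical in
/-- The proof with given hash values, commitments and responses: the string of zeros, which stands
for abort, if the search fails. -/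
noncomputable def proofOf (h : Answers k l t n) (a : Fin (k n) → S.Com n)
    (z : Fin (k n) → S.Resp n) : Bits (Pf S k n) :=
  if Succeeds h then
    Sum.elim (fun _ => true) (Sum.elim (fun p => a p.1 p.2)
      (Sum.elim (fun p => S.chal n (chosen h p.1) p.2) fun p => z p.1 p.2))
  else fun _ => false

theorem proofOf_of_not {h : Answers k l t n} (hs : ¬ Succeeds h) (a : Fin (k n) → S.Com n)
    (z : Fin (k n) → S.Resp n) : proofOf h a z = fun _ => false := if_neg hs

/-- The oracle input in attempt `(i, c)` of the honest prover. -/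
def point (x : S.Inst n) (w : S.Wit n) (r : Coins S k t n) (p : Fin (k n) × Fin (t n + 2)) :
    Bits (In S k n) :=
  query S k n (comVec x w r) p.1 (S.chal n p.2) (resp x w r p.1 p.2)

theorem point_injective (ht : t n + 2 ≤ S.numCh n) (x : S.Inst n) (w : S.Wit n)
    (r : Coins S k t n) : Function.Injective (point x w r) := by
  rintro ⟨i, c⟩ ⟨i', c'⟩ h
  obtain ⟨-, h1, h2, -⟩ := query_injective h
  exact Prod.ext h1 (Fin.ext (ThreeRound.chal_injective (c.2.trans_le ht) (c'.2.trans_le ht) h2))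

/-- The prover finds the challenges that are determined by the oracle values at its points. -/
theorem prove_eq (H : Oracle S k l n) (x : S.Inst n) (w : S.Wit n) (r : Coins S k t n)
    (h : Answers k l t n)
    (hh : ∀ i, search H x w r i = firstZero fun c => h (i, c)) :
    prove H x w r = proofOf h (comVec x w r) fun i => resp x w r i (chosen h i) := by
  by_cases hs : Succeeds h
  · have hs' : ∀ i, (search H x w r i).isSome := fun i => by rw [hh]; exact hs i
    have hc : ∀ i, (search H x w r i).get (hs' i) = chosen h i := fun i => by
      rw [Option.get_eq_getD (fallback := 0), hh, chosen]
    rw [prove, dif_pos hs', proofOf, if_pos hs]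
    simp only [hc]
  · rw [proofOf_of_not hs, prove, dif_neg]
    exact fun hs' => hs fun i => by rw [← hh]; exact hs' i

/-- With the oracle reprogrammed to the values `h` on the attempts, the prover finds the challenges
determined by `h`. -/
theorem prove_reprogramAt (ht : t n + 2 ≤ S.numCh n) (H : Oracle S k l n) (x : S.Inst n)
    (w : S.Wit n) (r : Coins S k t n) (h : Answers k l t n) :
    prove (reprogramAt (point x w r) attempts h H) x w r =
      proofOf h (comVec x w r) fun i => resp x w r i (chosen h i) :=
  prove_eq _ x w r h fun i => firstZero_congr
    (h' := fun p => reprogramAt (point x w r) attempts h H (point x w r p))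
    (fun _ hp => (reprogramAt_of_mem (point_injective ht x w r) attempts hp H).symm) i

/-- The response in an oracle input. -/
def zPart (ξ : Bits (In S k n)) : S.Resp n := fun j => ξ (Sum.inr (Sum.inr (Sum.inr j)))

/-- The oracle input `ξ` belongs to attempt `p` and its transcript is accepted. By unique responses
the latter holds for at most one response. -/
def Hit (x : S.Inst n) (a : Fin (k n) → S.Com n) (h : Answers k l t n) (ξ : Bits (In S k n))
    (p : Fin (k n) × Fin (t n + 2)) : Prop :=
  Succeeds h ∧ p ∈ attempts h ∧ ξ = query S k n a p.1 (S.chal n p.2) (zPart ξ) ∧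
    S.accepts n x (a p.1) (S.chal n p.2) (zPart ξ) = true

open Classical in
/-- The oracle reprogrammed to the hash values `h` on the accepted oracle inputs of all attempts. It
is computed from the commitments, without the responses. -/
noncomputable def patchOracle (x : S.Inst n) (a : Fin (k n) → S.Com n) (h : Answers k l t n)
    (H : Oracle S k l n) : Oracle S k l n := fun ξ =>
  if ∃ p, Hit x a h ξ p then fun o => decide (∃ p, Hit x a h ξ p ∧ h p o = true) else H ξ

theorem patchOracle_of_not {h : Answers k l t n} (hs : ¬ Succeeds h) (x : S.Inst n)
    (a : Fin (k n) → S.Com n) (H : Oracle S k l n) : patchOracle x a h H = H :=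
  funext fun _ => if_neg fun ⟨_, hp⟩ => hs hp.1

/-- For honest commitments the accepted oracle inputs are, by completeness and unique responses, the
points that the honest prover queries. -/
theorem patchOracle_eq_reprogramAt (hS : S.Complete) (hU : S.UniqueResponses)
    (ht : t n + 2 ≤ S.numCh n) (H : Oracle S k l n) {x : S.Inst n} {w : S.Wit n}
    (hxw : S.rel n x w) (r : Coins S k t n) {h : Answers k l t n} (hs : Succeeds h) :
    patchOracle x (comVec x w r) h H = reprogramAt (point x w r) attempts h H := by
  have hinj := point_injective ht x w r
  have hhit : ∀ ξ p, Hit x (comVec x w r) h ξ p ↔ p ∈ attempts h ∧ point x w r p = ξ := by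
    rintro ξ ⟨i, c⟩
    have hacc : S.accepts n x (comVec x w r i) (S.chal n c) (resp x w r i c) = true :=
      hS n x w hxw (r.1 i) ⟨c, c.2.trans_le ht⟩ (r.2 i c)
    constructor
    · rintro ⟨-, h1, h2, h3⟩
      refine ⟨h1, ?_⟩
      have hz : resp x w r i c = zPart ξ := by
        by_contra hne
        rcases hU n x (comVec x w r i) ⟨c, c.2.trans_le ht⟩ _ _ hne with h4 | h4
        · exact absurd (hacc.symm.trans h4) (by simp)
        · exact absurd (h3.symm.trans h4) (by simp)
      rw [point, hz]
      exact h2.symm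
    · rintro ⟨h1, rfl⟩
      exact ⟨hs, h1, rfl, hacc⟩
  funext ξ
  by_cases hξ : ∃ p ∈ attempts h, point x w r p = ξ
  · obtain ⟨p, hp, rfl⟩ := hξ
    rw [reprogramAt_of_mem hinj attempts hp, patchOracle, if_pos ⟨p, (hhit _ p).2 ⟨hp, rfl⟩⟩]
    funext o
    have : (∃ p', Hit x (comVec x w r) h (point x w r p) p' ∧ h p' o = true) ↔ h p o = true := by
      constructor
      · rintro ⟨p', h1, h2⟩
        rwa [← hinj ((hhit _ _).1 h1).2]
      · exact fun h2 => ⟨p, (hhit _ p).2 ⟨hp, rfl⟩, h2⟩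
    simp [this]
  · rw [reprogramAt_of_forall attempts (fun p hp he => hξ ⟨p, hp, he⟩), patchOracle, if_neg]
    rintro ⟨p, hp⟩
    exact hξ ⟨p, (hhit _ p).1 hp⟩

end Fischlin

namespace Fischlin

variable {S : ThreeRound} {k l t : ℕ → ℕ} {n : ℕ}

/-! ### Reprogramming the oracle for the honest prover -/

/-- The independent commitments of all repetitions take a given value with probability at most
`2^(-k * α)`. -/
theorem expect_comVec_eq_le {α : ℝ} {x : S.Inst n} {w : S.Wit n}
    (hα : α ≤ minEntropy (S.commitDist n x w)) (a : Fin (k n) → S.Com n) :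
    (𝔼 r : Coins S k t n, if comVec x w r = a then (1 : ℝ) else 0) ≤
      (2 : ℝ) ^ (-((k n : ℝ) * α)) := by
  have hmax : ∀ b, S.commitDist n x w b ≤ (2 : ℝ) ^ (-α) := by
    intro b
    have hb : S.commitDist n x w b ≤ ⨆ a, S.commitDist n x w a :=
      le_ciSup (Set.finite_range _).bddAbove b
    rcases le_or_gt (⨆ a, S.commitDist n x w a) 0 with h0 | h0
    · exact (hb.trans h0).trans (by positivity)
    · refine hb.trans ((Real.logb_le_iff_le_rpow (by norm_num) h0).1 ?_)
      rw [minEntropy] at hα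
      linarith
  have h1 : ∀ r : Coins S k t n, (if comVec x w r = a then (1 : ℝ) else 0) =
      ∏ i, if S.commit n x w (r.1 i) = a i then (1 : ℝ) else 0 := by
    intro r
    rw [Fintype.prod_ite_zero]
    simp [comVec, funext_iff]
  have h2 : (𝔼 r : Coins S k t n, if comVec x w r = a then (1 : ℝ) else 0) =
      ∏ i, S.commitDist n x w (a i) := by
    simp only [h1]
    rw [← Finset.univ_product_univ, Finset.expect_product]
    have h3 : ∀ r₁ : Fin (k n) → (S.prover₁ n).Coins,
        (𝔼 _r₂ : Fin (k n) → Fin (t n + 2) → (S.prover₂ n).Coins,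
          ∏ i, if S.commit n x w (r₁ i) = a i then (1 : ℝ) else 0) =
        ∏ i, if S.commit n x w (r₁ i) = a i then (1 : ℝ) else 0 :=
      fun r₁ => Fintype.expect_const _
    simp only [h3, ThreeRound.commitDist]
    simp only [Fintype.expect_eq_sum_div_card]
    rw [Finset.prod_div_distrib, Finset.prod_univ_sum]
    simp [Fintype.piFinset_univ]
  rw [h2]
  refine (Finset.prod_le_prod (fun i _ => Finset.expect_nonneg fun _ _ => ?_)
    fun i _ => hmax _).trans ?_
  · split_ifs <;> norm_num
  · rw [Finset.prod_const, Finset.card_univ, Fintype.card_fin, ← Real.rpow_natCast,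
      ← Real.rpow_mul (by norm_num)]
    apply le_of_eq
    congr 1
    ring

/-- A distinguisher of Fischlin proofs. -/
abbrev ProofDistinguisher (S : ThreeRound) (k l : ℕ → ℕ) (n : ℕ) : Type :=
  Distinguisher (In S k n) (Fin (l n)) (Fin (S.lenX n)) (Fin (S.lenW n)) (Pf S k n)

open Classical in
theorem realProb_fischlin (D : ProofDistinguisher S k l n) :
    (fischlin S k l t).realProb n D = ∑ x : S.Inst n, ∑ w : S.Wit n,
      if S.rel n x w then 𝔼 H : Oracle S k l n, 𝔼 r : Coins S k t n,
        D.prob H H x w (prove H x w r) else 0 := by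
  have h1 : (fischlin S k l t).realProb n D = 𝔼 H : Oracle S k l n, ∑ x : S.Inst n, ∑ w : S.Wit n,
      if S.rel n x w then 𝔼 r : Coins S k t n, D.prob H H x w (prove H x w r) else 0 := rfl
  rw [h1, Finset.expect_sum_comm]
  refine Finset.sum_congr rfl fun x _ => ?_
  rw [Finset.expect_sum_comm]
  refine Finset.sum_congr rfl fun w _ => ?_
  by_cases h : S.rel n x w
  · simp only [h, if_true]
  · simp [h]

open Classical in
/-- The game in which the challenges and the reprogramming are determined by random hash values,
with honest commitments and responses. -/
noncomputable def honestGame (t : ℕ → ℕ) (D : ProofDistinguisher S k l n) : ℝ :=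
  ∑ x : S.Inst n, ∑ w : S.Wit n, if S.rel n x w then
    𝔼 H : Oracle S k l n, 𝔼 r : Coins S k t n, 𝔼 h : Answers k l t n,
      D.prob H (patchOracle x (comVec x w r) h H) x w
        (proofOf h (comVec x w r) fun i => resp x w r i (chosen h i))
  else 0

/-- The block of an oracle input: the commitments. -/
def comPart (ξ : Bits (In S k n)) : Bits (Fin (k n) × Fin (S.lenA n)) := fun p => ξ (Sum.inl p)

/-- The contribution of one outcome `(x, w)` of the first stage. In the real experiment the oracle
is replaced by the reprogrammed one, which has the same distribution. If the search succeeds, the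
two games then have the same oracle in the second stage, and differ by the states after the first
stage. If it fails, the proof is the abort symbol, the honest game keeps the old oracle in both
stages, and the games differ by the final states for a proof that does not depend on the
commitments. -/
theorem abs_realProb_sub_honestGame_fixed (hS : S.Complete) (hU : S.UniqueResponses)
    (ht : t n + 2 ≤ S.numCh n) (D : ProofDistinguisher S k l n) {x : S.Inst n}
    {w : S.Wit n} (hxw : S.rel n x w) {q u : ℝ} (hu : 0 < u)
    (hq : ∀ a, (𝔼 r : Coins S k t n, if comVec x w r = a then (1 : ℝ) else 0) ≤ q) :
    |(𝔼 H : Oracle S k l n, 𝔼 r : Coins S k t n, D.prob H H x w (prove H x w r)) -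
      𝔼 H : Oracle S k l n, 𝔼 r : Coins S k t n, 𝔼 h : Answers k l t n,
        D.prob H (patchOracle x (comVec x w r) h H) x w
          (proofOf h (comVec x w r) fun i => resp x w r i (chosen h i))| ≤
      2 * q / u * (influence (O := Fin (l n)) (comPart (S := S) (k := k) (n := n))
          (fun H => D.midState H x w) +
        influence (O := Fin (l n)) (comPart (S := S) (k := k) (n := n))
          fun H => D.finalState H H x w fun _ => false) +
      2 * u * 𝔼 H : Oracle S k l n, mass (D.midState H x w) := by
  let mid : Oracle S k l n → _ := fun H => D.midState H x w
  let fin : Oracle S k l n → _ := fun H => D.finalState H H x w fun _ => false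
  let β := comPart (S := S) (k := k) (n := n)
  let H' : Coins S k t n → Answers k l t n → Oracle S k l n → Oracle S k l n :=
    fun r h H => reprogramAt (point x w r) attempts h H
  -- One run, with fixed coins and hash values.
  have hrun : ∀ r h H, |D.prob (H' r h H) (H' r h H) x w (prove (H' r h H) x w r) -
      D.prob H (patchOracle x (comVec x w r) h H) x w
        (proofOf h (comVec x w r) fun i => resp x w r i (chosen h i))| ≤
      (mass (mid (H' r h H) - mid H) + mass (fin (H' r h H) - fin H)) / (2 * u) +
        u * (mass (mid (H' r h H)) + mass (mid H)) := by
    intro r h H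
    rw [prove_reprogramAt ht]
    refine (D.abs_prob_sub_prob_le _ _ _ _ x w _ hu).trans ?_
    refine add_le_add_left (div_le_div_of_nonneg_right ?_ (by positivity)) _
    by_cases hs : Succeeds h
    · rw [patchOracle_eq_reprogramAt hS hU ht H hxw r hs, D.mass_finalState_sub]
      exact le_add_of_nonneg_right (mass_nonneg _)
    · rw [patchOracle_of_not hs, proofOf_of_not hs]
      exact le_add_of_nonneg_left (mass_nonneg _)
  have hM : ∀ h h' : Answers k l t n, (∀ p ∈ attempts h, h p = h' p) → attempts h = attempts h' :=
    fun h h' => attempts_congr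
  have hinj := point_injective (k := k) ht x w
  have hcoins : ∀ r : Coins S k t n,
      |(𝔼 H : Oracle S k l n, D.prob H H x w (prove H x w r)) -
        𝔼 H : Oracle S k l n, 𝔼 h : Answers k l t n,
          D.prob H (patchOracle x (comVec x w r) h H) x w
            (proofOf h (comVec x w r) fun i => resp x w r i (chosen h i))| ≤
      2 / u * (blockInfluence β mid (fun p => comVec x w r p.1 p.2) +
          blockInfluence β fin fun p => comVec x w r p.1 p.2) +
        2 * u * 𝔼 H : Oracle S k l n, mass (mid H) := by
    intro r
    rw [← expect_reprogramAt (hinj r) attempts hM fun H => D.prob H H x w (prove H x w r)]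
    rw [← Finset.expect_sub_distrib]
    simp only [← Finset.expect_sub_distrib]
    have h1 := expect_mass_reprogramAt_le β (hinj r) attempts hM mid
      (a := fun p => comVec x w r p.1 p.2) fun _ => rfl
    have h2 := expect_mass_reprogramAt_le β (hinj r) attempts hM fin
      (a := fun p => comVec x w r p.1 p.2) fun _ => rfl
    have h3 := expect_reprogramAt (hinj r) attempts hM fun H : Oracle S k l n => mass (mid H)
    calc _ ≤ 𝔼 H : Oracle S k l n, 𝔼 h : Answers k l t n,
          ((mass (mid (H' r h H) - mid H) + mass (fin (H' r h H) - fin H)) / (2 * u) +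
            u * (mass (mid (H' r h H)) + mass (mid H))) :=
          (Finset.abs_expect_le _ _).trans (Finset.expect_le_expect fun H _ =>
            (Finset.abs_expect_le _ _).trans (Finset.expect_le_expect fun h _ => hrun r h H))
      _ = ((𝔼 H : Oracle S k l n, 𝔼 h : Answers k l t n, mass (mid (H' r h H) - mid H)) +
            𝔼 H : Oracle S k l n, 𝔼 h : Answers k l t n, mass (fin (H' r h H) - fin H)) / (2 * u) +
            u * ((𝔼 H : Oracle S k l n, 𝔼 h : Answers k l t n, mass (mid (H' r h H))) +
              𝔼 H : Oracle S k l n, mass (mid H)) := by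
          simp only [Finset.expect_add_distrib, ← Finset.expect_div, ← Finset.mul_expect,
            Fintype.expect_const]
      _ ≤ (4 * blockInfluence β mid (fun p => comVec x w r p.1 p.2) +
            4 * blockInfluence β fin fun p => comVec x w r p.1 p.2) / (2 * u) +
            u * ((𝔼 H : Oracle S k l n, mass (mid H)) + 𝔼 H : Oracle S k l n, mass (mid H)) := by
          rw [h3]
          gcongr
      _ = _ := by
          field_simp
          ring
  rw [Finset.expect_comm, Finset.expect_comm (s := Finset.univ (α := Oracle S k l n))
    (t := Finset.univ (α := Coins S k t n)), ← Finset.expect_sub_distrib]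
  refine (Finset.abs_expect_le _ _).trans
    ((Finset.expect_le_expect fun r _ => hcoins r).trans ?_)
  have : Nonempty (Coins S k t n) := ⟨fun _ _ => false, fun _ _ _ => false⟩
  simp only [Finset.expect_add_distrib, ← Finset.mul_expect, Fintype.expect_const]
  have hb : ∀ b, (𝔼 r : Coins S k t n, if (fun p : Fin (k n) × Fin (S.lenA n) =>
      comVec x w r p.1 p.2) = b then (1 : ℝ) else 0) ≤ q := by
    intro b
    refine le_of_eq_of_le ?_ (hq fun i j => b (i, j))
    refine Finset.expect_congr rfl fun r _ => if_congr ?_ rfl rfl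
    simp [funext_iff]
  have h1 := expect_blockInfluence_le β mid
    (fun (r : Coins S k t n) p => comVec x w r p.1 p.2) hb
  have h2 := expect_blockInfluence_le β fin
    (fun (r : Coins S k t n) p => comVec x w r p.1 p.2) hb
  refine add_le_add_left ?_ _
  calc _ ≤ 2 / u * (q * influence β mid + q * influence β fin) := by gcongr
    _ = _ := by ring

/-- The honest prover in the random oracle model differs from the game that reprograms the oracle
only by the influence that the block of the commitments has on the distinguisher before these become
known to it. The two error terms are balanced if `u ^ 2` bounds the probability of a commitment. -/
theorem abs_realProb_sub_honestGame_le (hS : S.Complete) (hU : S.UniqueResponses)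
    (ht : t n + 2 ≤ S.numCh n) {u : ℝ} (hu : 0 < u)
    (hq : ∀ x w, S.rel n x w → ∀ a,
      (𝔼 r : Coins S k t n, if comVec x w r = a then (1 : ℝ) else 0) ≤ u ^ 2)
    (D : ProofDistinguisher S k l n) :
    |(fischlin S k l t).realProb n D - honestGame t D| ≤ (16 * D.size + 2) * u := by
  classical
  let β := comPart (S := S) (k := k) (n := n)
  let I₁ : S.Inst n → S.Wit n → ℝ := fun x w =>
    influence (O := Fin (l n)) β fun H => D.midState H x w
  let I₂ : S.Inst n → S.Wit n → ℝ := fun x w =>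
    influence (O := Fin (l n)) β fun H => D.finalState H H x w fun _ => false
  let m : S.Inst n → S.Wit n → ℝ := fun x w => 𝔼 H : Oracle S k l n, mass (D.midState H x w)
  have hpos : ∀ x w, 0 ≤ 2 * u ^ 2 / u * (I₁ x w + I₂ x w) + 2 * u * m x w := by
    intro x w
    have h1 : 0 ≤ I₁ x w := Finset.sum_nonneg fun b _ => blockInfluence_nonneg β _ b
    have h2 : 0 ≤ I₂ x w := Finset.sum_nonneg fun b _ => blockInfluence_nonneg β _ b
    have h3 : 0 ≤ m x w := Finset.expect_nonneg fun _ _ => mass_nonneg _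
    exact add_nonneg (mul_nonneg (by positivity) (add_nonneg h1 h2)) (mul_nonneg (by positivity) h3)
  have hsum : |(fischlin S k l t).realProb n D - honestGame t D| ≤
      ∑ x, ∑ w, (2 * u ^ 2 / u * (I₁ x w + I₂ x w) + 2 * u * m x w) := by
    rw [realProb_fischlin, honestGame, ← Finset.sum_sub_distrib]
    refine (Finset.abs_sum_le_sum_abs _ _).trans (Finset.sum_le_sum fun x _ => ?_)
    rw [← Finset.sum_sub_distrib]
    refine (Finset.abs_sum_le_sum_abs _ _).trans (Finset.sum_le_sum fun w _ => ?_)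
    by_cases h : S.rel n x w
    · rw [if_pos h, if_pos h]
      exact abs_realProb_sub_honestGame_fixed hS hU ht D h hu (hq x w h)
    · rw [if_neg h, if_neg h, sub_zero, abs_zero]
      exact hpos x w
  refine hsum.trans ?_
  have e1 : ∑ x, ∑ w, I₁ x w ≤ 4 * D.first.length := D.sum_influence_midState_le β
  have e2 : ∑ x, ∑ w, I₂ x w ≤ 4 * (D.first.length + D.second.length) :=
    D.sum_influence_finalState_le β _
  have e3 : ∑ x, ∑ w, m x w = 1 := by
    have : ∀ x, ∑ w, m x w = 𝔼 H : Oracle S k l n, ∑ w, mass (D.midState H x w) := fun x =>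
      (Finset.expect_sum_comm _ _ _).symm
    simp only [this]
    rw [← Finset.expect_sum_comm]
    simp only [D.sum_mass_midState]
    simp
  simp only [Finset.sum_add_distrib, ← Finset.mul_sum]
  rw [e3, show 2 * u ^ 2 / u = 2 * u by field_simp]
  have e4 : (D.first.length : ℝ) + D.second.length ≤ D.size := by
    rw [Distinguisher.size]
    push_cast
    have : (0 : ℝ) ≤ D.mem := Nat.cast_nonneg _
    have : (0 : ℝ) ≤ D.anc := Nat.cast_nonneg _
    linarith
  have e5 : (0 : ℝ) ≤ D.second.length := Nat.cast_nonneg _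
  nlinarith

end Fischlin

/-! ### Circuits for the simulator -/

namespace PolyBounded

variable {A B : ℕ → Type} [∀ n, Fintype (A n)] [∀ n, Fintype (B n)]

theorem card_fin {f : ℕ → ℕ} (hf : PolyBounded f) : PolyBounded fun n => Fintype.card (Fin (f n)) :=
  hf.mono fun n => by simp

theorem card_sum (hA : PolyBounded fun n => Fintype.card (A n))
    (hB : PolyBounded fun n => Fintype.card (B n)) :
    PolyBounded fun n => Fintype.card (A n ⊕ B n) := (hA.add hB).mono fun n => by simp

theorem card_prod (hA : PolyBounded fun n => Fintype.card (A n))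
    (hB : PolyBounded fun n => Fintype.card (B n)) :
    PolyBounded fun n => Fintype.card (A n × B n) := (hA.mul hB).mono fun n => by simp

end PolyBounded

namespace PolyTime

variable {J J' I M : ℕ → Type}

/-- Joint computation of all functions of a family without hard-wired data. -/
theorem exists_cost_all [∀ n, Fintype (J n)] (hJ : PolyBounded fun n => Fintype.card (J n))
    {f : ∀ n, J n → Bits (I n) → Bool} (hf : PolyTime f) :
    ∃ s, PolyBounded s ∧ ∀ n, Cost (s n) (f n) := by
  obtain ⟨s, hs, h⟩ := hf
  exact ⟨_, hJ.mul hs, fun n => Cost.pi' fun j => h n j⟩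

theorem of_input {f : ∀ n, J n → Bits (I n) → Bool} (σ : ∀ n, J n → I n)
    (h : ∀ n j x, f n j x = x (σ n j)) : PolyTime f :=
  (input σ).congr h

theorem of_const {f : ∀ n, J n → Bits (I n) → Bool} (c : ∀ n, J n → Bool)
    (h : ∀ n j x, f n j x = c n j) : PolyTime f :=
  (const c).congr h

theorem sum {f : ∀ n, J n ⊕ J' n → Bits (I n) → Bool} (h : PolyTime fun n j => f n (Sum.inl j))
    (h' : PolyTime fun n j => f n (Sum.inr j)) : PolyTime f := by
  obtain ⟨s, hs, h⟩ := h
  obtain ⟨s', hs', h'⟩ := h'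
  refine ⟨_, hs.add hs', fun n j => ?_⟩
  rcases j with j | j
  · exact (h n j).mono (Nat.le_add_right _ _)
  · exact (h' n j).mono (Nat.le_add_left _ _)

/-- A case distinction on the position of the output bit, with hard-wired data in `A n`. -/
theorem prod_sum {A : ℕ → Type} {f : ∀ n, A n × (J n ⊕ J' n) → Bits (I n) → Bool}
    (h : PolyTime (J := fun n => A n × J n) fun n p => f n (p.1, Sum.inl p.2))
    (h' : PolyTime (J := fun n => A n × J' n) fun n p => f n (p.1, Sum.inr p.2)) : PolyTime f := by
  obtain ⟨s, hs, h⟩ := h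
  obtain ⟨s', hs', h'⟩ := h'
  refine ⟨_, hs.add hs', fun n p => ?_⟩
  obtain ⟨a, j | j⟩ := p
  · exact (h n (a, j)).mono (Nat.le_add_right _ _)
  · exact (h' n (a, j)).mono (Nat.le_add_left _ _)

theorem subst [∀ n, Fintype (M n)] (hM : PolyBounded fun n => Fintype.card (M n))
    {g : ∀ n, J n → Bits (M n) → Bool} {f : ∀ n, M n → Bits (I n) → Bool} (hg : PolyTime g)
    (hf : PolyTime f) : PolyTime fun n j x => g n j fun m => f n m x :=
  hg.comp hM (f := fun n _ m x => f n m x) (hf.reindex fun n (p : J n × M n) => p.2)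

/-- Renaming of the input bits. -/
theorem rename [∀ n, Fintype (M n)] (hM : PolyBounded fun n => Fintype.card (M n))
    {g : ∀ n, J n → Bits (M n) → Bool} (hg : PolyTime g) (σ : ∀ n, J n → M n → I n) :
    PolyTime fun n j x => g n j fun m => x (σ n j m) :=
  hg.comp hM (f := fun n j m x => x (σ n j m)) (input fun n (p : J n × M n) => σ n p.1 p.2)

end PolyTime

open Classical in
/-- Predicates that are decided by circuits of polynomial size, with hard-wired data `j` as in
`PolyTime`. -/
def PolyDec {J I : ℕ → Type} (P : ∀ n, J n → Bits (I n) → Prop) : Prop :=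
  PolyTime fun n j x => decide (P n j x)

namespace PolyDec

variable {J J' I K M : ℕ → Type} {P Q : ∀ n, J n → Bits (I n) → Prop}

theorem of_polyTime {f : ∀ n, J n → Bits (I n) → Bool} (hf : PolyTime f)
    (h : ∀ n j x, f n j x = true ↔ P n j x) : PolyDec P :=
  hf.congr fun n j x => by
    classical rw [Bool.eq_iff_iff, h, decide_eq_true_iff]

theorem polyTime {f : ∀ n, J n → Bits (I n) → Bool} (hP : PolyDec P)
    (h : ∀ n j x, f n j x = true ↔ P n j x) : PolyTime f :=
  PolyTime.congr hP fun n j x => by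
    classical rw [Bool.eq_iff_iff, h, decide_eq_true_iff]

theorem congr (hP : PolyDec P) (h : ∀ n j x, Q n j x ↔ P n j x) : PolyDec Q :=
  of_polyTime hP fun n j x => by
    classical rw [h, decide_eq_true_iff]

theorem const (c : ∀ n, J n → Prop) : PolyDec (I := I) fun n j _ => c n j := by
  classical
  exact of_polyTime (PolyTime.const fun n j => decide (c n j)) fun _ _ _ => by simp

theorem and (hP : PolyDec P) (hQ : PolyDec Q) : PolyDec fun n j x => P n j x ∧ Q n j x :=
  of_polyTime (PolyTime.and hP hQ) fun _ _ _ => by simp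

theorem not (hP : PolyDec P) : PolyDec fun n j x => ¬ P n j x :=
  of_polyTime (PolyTime.not hP) fun _ _ _ => by simp

theorem imp (hP : PolyDec P) (hQ : PolyDec Q) : PolyDec fun n j x => P n j x → Q n j x :=
  of_polyTime (PolyTime.or (PolyTime.not hP) hQ) fun _ _ _ => by simp [imp_iff_not_or]

theorem forall_ [∀ n, Fintype (K n)] (hK : PolyBounded fun n => Fintype.card (K n))
    {R : ∀ n, J n → K n → Bits (I n) → Prop}
    (hR : PolyDec (J := fun n => J n × K n) fun n p => R n p.1 p.2) :
    PolyDec fun n j x => ∀ κ, R n j κ x := by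
  classical
  exact PolyTime.all hK (f := fun n j κ x => decide (R n j κ x)) (hR.polyTime (by simp))
    fun n j x => by simp

theorem exists_ [∀ n, Fintype (K n)] (hK : PolyBounded fun n => Fintype.card (K n))
    {R : ∀ n, J n → K n → Bits (I n) → Prop}
    (hR : PolyDec (J := fun n => J n × K n) fun n p => R n p.1 p.2) :
    PolyDec fun n j x => ∃ κ, R n j κ x := by
  classical
  exact PolyTime.any hK (f := fun n j κ x => decide (R n j κ x)) (hR.polyTime (by simp))
    fun n j x => by simp

theorem reindex (hP : PolyDec P) (σ : ∀ n, J' n → J n) : PolyDec fun n j => P n (σ n j) :=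
  PolyTime.reindex hP σ

theorem rename [∀ n, Fintype (M n)] (hM : PolyBounded fun n => Fintype.card (M n))
    {R : ∀ n, J n → Bits (M n) → Prop} (hR : PolyDec R) (σ : ∀ n, J n → M n → I n) :
    PolyDec fun n j x => R n j fun m => x (σ n j m) :=
  PolyTime.rename hM hR σ

end PolyDec

namespace Fischlin

variable (S : ThreeRound) (k l t : ℕ → ℕ)

/-- Positions of the bits of the hash values of all attempts. -/
abbrev AnsPos (k l t : ℕ → ℕ) (n : ℕ) : Type := (Fin (k n) × Fin (t n + 2)) × Fin (l n)

/-- Positions of the commitments. -/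
abbrev ComPos (S : ThreeRound) (k : ℕ → ℕ) (n : ℕ) : Type := Fin (k n) × Fin (S.lenA n)

/-- Positions of the responses. -/
abbrev RespPos (S : ThreeRound) (k : ℕ → ℕ) (n : ℕ) : Type := Fin (k n) × Fin (S.lenZ n)

/-- Positions of the reprogramming instructions `(x, 𝐚, h)`. -/
abbrev InsPos (S : ThreeRound) (k l t : ℕ → ℕ) (n : ℕ) : Type :=
  Fin (S.lenX n) ⊕ ComPos S k n ⊕ AnsPos k l t n

/-- The hash values encoded by a bit string. -/
abbrev answersOf {k l t : ℕ → ℕ} {n : ℕ} (u : Bits (AnsPos k l t n)) : Answers k l t n :=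
  fun p o => u (p, o)

variable {S k l t}

section

variable (hk : PolyBounded k) (hl : PolyBounded l) (ht : PolyBounded fun n => t n + 2)

include hk hl ht

theorem polyBounded_ansPos : PolyBounded fun n => Fintype.card (AnsPos k l t n) :=
  (hk.card_fin.card_prod ht.card_fin).card_prod hl.card_fin

omit hk ht in
theorem polyDec_answer_zero : PolyDec (J := fun n => Fin (k n) × Fin (t n + 2))
    fun n p (u : Bits (AnsPos k l t n)) => answersOf u p = fun _ => false :=
  (PolyDec.forall_ hl.card_fin (R := fun n p o (u : Bits (AnsPos k l t n)) => ¬ u (p, o) = true)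
    (PolyDec.not (PolyDec.of_polyTime (PolyTime.input fun _ p => p)
      fun _ _ _ => Iff.rfl))).congr fun n p u => by simp [funext_iff]

omit hk in
theorem polyDec_attempts : PolyDec (J := fun n => Fin (k n) × Fin (t n + 2))
    fun n p (u : Bits (AnsPos k l t n)) => p ∈ attempts (answersOf u) :=
  PolyDec.forall_ (J := fun n => Fin (k n) × Fin (t n + 2)) ht.card_fin
    (R := fun n p c (u : Bits (AnsPos k l t n)) =>
    c < p.2 → ¬ (answersOf u (p.1, c) = fun _ => false))
    ((PolyDec.const fun n (p : (Fin (k n) × Fin (t n + 2)) × Fin (t n + 2)) => p.2 < p.1.2).imp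
      ((polyDec_answer_zero hl).reindex
        fun n (p : (Fin (k n) × Fin (t n + 2)) × Fin (t n + 2)) => (p.1.1, p.2)).not)

omit hk in
theorem polyDec_firstZero : PolyDec (J := fun n => Fin (k n) × Fin (t n + 2))
    fun n p (u : Bits (AnsPos k l t n)) =>
      firstZero (fun c => answersOf u (p.1, c)) = some p.2 :=
  ((polyDec_answer_zero hl).and (polyDec_attempts hl ht)).congr fun _ _ _ =>
    firstZero_eq_some_iff

theorem polyDec_succeeds : PolyDec (J := fun _ => Unit)
    fun n _ (u : Bits (AnsPos k l t n)) => Succeeds (answersOf u) :=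
  PolyDec.forall_ hk.card_fin (R := fun n _ i (u : Bits (AnsPos k l t n)) =>
    (firstZero fun c => answersOf u (i, c)).isSome = true)
    ((PolyDec.exists_ ht.card_fin (R := fun n i c (u : Bits (AnsPos k l t n)) =>
      firstZero (fun c => answersOf u (i.2, c)) = some c)
      ((polyDec_firstZero hl ht).reindex fun _ (p : (Unit × Fin (k _)) × Fin (t _ + 2)) =>
        (p.1.2, p.2))).congr fun n p u => by
      simp [Option.isSome_iff_exists])

omit hk in
theorem polyTime_chal_chosen :
    PolyTime (J := fun n => Fin (k n) × Fin (S.numCh n).size)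
      fun n p (u : Bits (AnsPos k l t n)) => S.chal n (chosen (answersOf u) p.1) p.2 :=
  (PolyDec.exists_ (J := fun n => Fin (k n) × Fin (S.numCh n).size) ht.card_fin
    (R := fun n p c (u : Bits (AnsPos k l t n)) =>
      firstZero (fun c => answersOf u (p.1, c)) = some c ∧ S.chal n c p.2 = true)
    (((polyDec_firstZero hl ht).reindex
      fun n (p : (Fin (k n) × Fin (S.numCh n).size) × Fin (t n + 2)) => (p.1.1, p.2)).and
      (PolyDec.const fun n (p : (Fin (k n) × Fin (S.numCh n).size) × Fin (t n + 2)) =>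
        S.chal n p.2 p.1.2 = true))).polyTime fun n p u => by
    rcases hf : firstZero fun c => answersOf u (p.1, c) with _ | c
    -- The default value 0 of `chosen` is represented by a string of zeros.
    · simp [chosen, hf, ThreeRound.chal, natBits]
    · simp [chosen, hf]

theorem polyTime_proofOf : PolyTime (J := Pf S k)
    fun n s (u : Bits (AnsPos k l t n ⊕ ComPos S k n ⊕ RespPos S k n)) =>
      proofOf (answersOf fun p => u (Sum.inl p)) (fun i j => u (Sum.inr (Sum.inl (i, j))))
        (fun i j => u (Sum.inr (Sum.inr (i, j)))) s := by
  classical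
  have hA := polyBounded_ansPos hk hl ht
  have hs : ∀ J : ℕ → Type, PolyTime (J := J)
      fun n _ (u : Bits (AnsPos k l t n ⊕ ComPos S k n ⊕ RespPos S k n)) =>
        decide (Succeeds (answersOf fun p => u (Sum.inl p))) := fun J =>
    ((PolyDec.rename hA (polyDec_succeeds hk hl ht) fun _ _ => Sum.inl).reindex
      fun _ _ => ()).polyTime fun _ _ _ => by simp
  have hc := PolyTime.rename hA (polyTime_chal_chosen (S := S) (k := k) hl ht)
    (I := fun n => AnsPos k l t n ⊕ ComPos S k n ⊕ RespPos S k n) fun _ _ => Sum.inl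
  refine PolyTime.sum ?_ (PolyTime.sum ?_ (PolyTime.sum ?_ ?_))
  · refine (hs _).congr fun n j u => ?_
    rw [proofOf]
    split_ifs with h <;> simp [h]
  · refine ((hs _).and (PolyTime.input fun n j => Sum.inr (Sum.inl j))).congr fun n j u => ?_
    rw [proofOf]
    split_ifs with h <;> simp [h]
  · refine ((hs _).and hc).congr fun n j u => ?_
    rw [proofOf]
    split_ifs with h <;> simp [h]
  · refine ((hs _).and (PolyTime.input fun n j => Sum.inr (Sum.inr j))).congr fun n j u => ?_
    rw [proofOf]
    split_ifs with h <;> simp [h]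

end

end Fischlin

namespace Fischlin

variable {S : ThreeRound} {k l t : ℕ → ℕ}

section

variable (hk : PolyBounded k) (hl : PolyBounded l) (ht : PolyBounded fun n => t n + 2)
  (hS : S.Efficient)

include hk hS

theorem polyBounded_in : PolyBounded fun n => Fintype.card (In S k n) := by
  obtain ⟨-, -, hA, -, hZ, hC, -⟩ := hS
  have hks : PolyBounded fun n => (k n).size := hk.mono fun n => by
    rw [Nat.size_le]; exact Nat.lt_two_pow_self
  exact (hk.card_fin.card_prod hA.card_fin).card_sum
    (hks.card_fin.card_sum (hC.card_fin.card_sum hZ.card_fin))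

theorem polyBounded_pf : PolyBounded fun n => Fintype.card (Pf S k n) := by
  obtain ⟨-, -, hA, -, hZ, hC, -⟩ := hS
  exact PolyBounded.card_sum (A := fun _ => Unit) ((PolyBounded.const 1).mono fun n => by simp)
    ((hk.card_fin.card_prod hA.card_fin).card_sum
      ((hk.card_fin.card_prod hC.card_fin).card_sum (hk.card_fin.card_prod hZ.card_fin)))

include hl ht

theorem polyBounded_insPos : PolyBounded fun n => Fintype.card (InsPos S k l t n) :=
  hS.1.card_fin.card_sum ((hk.card_fin.card_prod hS.2.2.1.card_fin).card_sum
    (polyBounded_ansPos hk hl ht))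

theorem polyDec_hit : PolyDec (J := fun n => Fin (k n) × Fin (t n + 2))
    fun n p (u : Bits (InsPos S k l t n ⊕ In S k n)) =>
      Hit (fun i => u (Sum.inl (Sum.inl i))) (fun i j => u (Sum.inl (Sum.inr (Sum.inl (i, j)))))
        (answersOf fun q => u (Sum.inl (Sum.inr (Sum.inr q)))) (fun s => u (Sum.inr s)) p := by
  have hA := polyBounded_ansPos hk hl ht
  have h1 := ((polyDec_succeeds hk hl ht).rename (I := fun n => InsPos S k l t n ⊕ In S k n) hA
    fun _ _ q => Sum.inl (Sum.inr (Sum.inr q))).reindex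
      (J' := fun n => Fin (k n) × Fin (t n + 2)) fun _ _ => ()
  have h2 := (polyDec_attempts (k := k) hl ht).rename
    (I := fun n => InsPos S k l t n ⊕ In S k n) hA fun _ _ q => Sum.inl (Sum.inr (Sum.inr q))
  have h3 : PolyTime (J := fun n => (Fin (k n) × Fin (t n + 2)) × In S k n)
      fun n q (u : Bits (InsPos S k l t n ⊕ In S k n)) =>
        query S k n (fun i j => u (Sum.inl (Sum.inr (Sum.inl (i, j))))) q.1.1 (S.chal n q.1.2)
          (zPart fun s => u (Sum.inr s)) q.2 :=
    .prod_sum (PolyTime.of_input (fun _ q => Sum.inl (Sum.inr (Sum.inl q.2))) fun _ _ _ => rfl)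
      (.prod_sum (PolyTime.of_const (fun n q => natBits (k n).size q.1.1 q.2) fun _ _ _ => rfl)
        (.prod_sum (PolyTime.of_const (fun n q => S.chal n q.1.2 q.2) fun _ _ _ => rfl)
          (PolyTime.of_input (fun _ q => Sum.inr (Sum.inr (Sum.inr (Sum.inr q.2))))
            fun _ _ _ => rfl)))
  have h4 := PolyDec.forall_ (J := fun n => Fin (k n) × Fin (t n + 2)) (polyBounded_in hk hS)
    (R := fun n p s (u : Bits (InsPos S k l t n ⊕ In S k n)) => u (Sum.inr s) =
        query S k n (fun i j => u (Sum.inl (Sum.inr (Sum.inl (i, j))))) p.1 (S.chal n p.2)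
          (zPart fun s => u (Sum.inr s)) s)
    (PolyDec.of_polyTime ((PolyTime.of_input (fun _ q => Sum.inr q.2) fun _ _ _ => rfl).beq h3)
      fun _ _ _ => by simp)
  obtain ⟨hlX, -, hlA, -, hlZ, hlC, -, -, hV⟩ := hS
  have hM : PolyBounded fun n => Fintype.card
      (Fin (S.lenX n) ⊕ Fin (S.lenA n) ⊕ Fin (S.numCh n).size ⊕ Fin (S.lenZ n)) :=
    hlX.card_fin.card_sum (hlA.card_fin.card_sum (hlC.card_fin.card_sum hlZ.card_fin))
  have h5 : PolyTime (J := fun n => Fin (k n) × Fin (t n + 2))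
      fun n p (u : Bits (InsPos S k l t n ⊕ In S k n)) =>
        S.accepts n (fun i => u (Sum.inl (Sum.inl i)))
          (fun j => u (Sum.inl (Sum.inr (Sum.inl (p.1, j))))) (S.chal n p.2)
          (zPart fun s => u (Sum.inr s)) :=
    ((PolyTime.circuit hM S.verifier hV).reindex
      (J' := fun n => Fin (k n) × Fin (t n + 2)) fun _ _ => ()).comp hM
      (f := fun n (p : Fin (k n) × Fin (t n + 2)) m (u : Bits (InsPos S k l t n ⊕ In S k n)) =>
        Sum.elim (fun i => u (Sum.inl (Sum.inl i)))
          (Sum.elim (fun j => u (Sum.inl (Sum.inr (Sum.inl (p.1, j)))))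
            (Sum.elim (S.chal n p.2) (zPart fun s => u (Sum.inr s)))) m)
      (.prod_sum (PolyTime.of_input (fun _ q => Sum.inl (Sum.inl q.2)) fun _ _ _ => rfl)
        (.prod_sum (PolyTime.of_input (fun _ q => Sum.inl (Sum.inr (Sum.inl (q.1.1, q.2))))
            fun _ _ _ => rfl)
          (.prod_sum (PolyTime.of_const (fun n q => S.chal n q.1.2 q.2) fun _ _ _ => rfl)
            (PolyTime.of_input (fun _ q => Sum.inr (Sum.inr (Sum.inr (Sum.inr q.2))))
              fun _ _ _ => rfl))))
  refine (h1.and (h2.and (h4.and (PolyDec.of_polyTime h5 fun _ _ _ => Iff.rfl)))).congr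
    fun n p u => ?_
  rw [Hit, funext_iff]

/-- The output bits of the circuit that reprograms the oracle: a flag that tells whether the value
at a point is changed, and the new value. -/
theorem polyDec_patch : PolyDec (J := fun n => Unit ⊕ Fin (l n))
    fun n s (u : Bits (InsPos S k l t n ⊕ In S k n)) =>
      ∃ p, Hit (fun i => u (Sum.inl (Sum.inl i)))
        (fun i j => u (Sum.inl (Sum.inr (Sum.inl (i, j)))))
        (answersOf fun q => u (Sum.inl (Sum.inr (Sum.inr q)))) (fun s => u (Sum.inr s)) p ∧
          Sum.elim (fun _ => true) (fun o => u (Sum.inl (Sum.inr (Sum.inr (p, o))))) s = true := by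
  have hJ : PolyBounded fun n => Fintype.card (Fin (k n) × Fin (t n + 2)) :=
    hk.card_fin.card_prod ht.card_fin
  have hit := polyDec_hit hk hl ht hS
  have hval : PolyTime (J := fun n => (Fin (k n) × Fin (t n + 2)) × (Unit ⊕ Fin (l n)))
      fun n q (u : Bits (InsPos S k l t n ⊕ In S k n)) =>
        Sum.elim (fun _ => true) (fun o => u (Sum.inl (Sum.inr (Sum.inr (q.1, o))))) q.2 :=
    .prod_sum (PolyTime.of_const (fun _ _ => true) fun _ _ _ => rfl)
      (PolyTime.of_input (fun _ q => Sum.inl (Sum.inr (Sum.inr (q.1, q.2)))) fun _ _ _ => rfl)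
  exact PolyDec.exists_ hJ (R := fun n s p (u : Bits (InsPos S k l t n ⊕ In S k n)) =>
    Hit (fun i => u (Sum.inl (Sum.inl i))) (fun i j => u (Sum.inl (Sum.inr (Sum.inl (i, j)))))
      (answersOf fun q => u (Sum.inl (Sum.inr (Sum.inr q)))) (fun s => u (Sum.inr s)) p ∧
        Sum.elim (fun _ => true) (fun o => u (Sum.inl (Sum.inr (Sum.inr (p, o))))) s = true)
    ((hit.reindex fun _ (q : (Unit ⊕ Fin (l _)) × _) => q.2).and
    (PolyDec.of_polyTime (hval.reindex fun _ (q : (Unit ⊕ Fin (l _)) × _) => (q.2, q.1))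
      fun _ _ _ => Iff.rfl))

end

end Fischlin

namespace Fischlin

variable {S : ThreeRound} {k l t : ℕ → ℕ}

/-- Positions of a commitment and a response. -/
abbrev RunPos (S : ThreeRound) (n : ℕ) : Type := Fin (S.lenA n) ⊕ Fin (S.lenZ n)

/-- A simulated commitment and response for the challenge `c`. -/
def simRun {n : ℕ} (sim : RandCircuit (Fin (S.lenX n) ⊕ Fin (S.numCh n).size) (RunPos S n))
    (x : S.Inst n) (c : ℕ) (ρ : sim.Coins) : Bits (RunPos S n) :=
  sim.run (Sum.elim x (S.chal n c)) ρ

/-- The probability that the distinguisher outputs `(x, w)` and 1, if the hash values in all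
attempts are `h` and the commitments and responses in the proof are `T`. -/
noncomputable def gameProb {n : ℕ} (D : ProofDistinguisher S k l n) (x : S.Inst n) (w : S.Wit n)
    (h : Answers k l t n) (T : Fin (k n) → Bits (RunPos S n)) (H : Oracle S k l n) : ℝ :=
  D.prob H (patchOracle x (fun i j => T i (Sum.inl j)) h H) x w
    (proofOf h (fun i j => T i (Sum.inl j)) fun i j => T i (Sum.inr j))

open Classical in
/-- The game with simulated commitments and responses. -/
noncomputable def simGame {n : ℕ} (t : ℕ → ℕ)
    (sim : RandCircuit (Fin (S.lenX n) ⊕ Fin (S.numCh n).size) (RunPos S n))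
    (D : ProofDistinguisher S k l n) : ℝ :=
  ∑ x : S.Inst n, ∑ w : S.Wit n, if S.rel n x w then
    𝔼 H : Oracle S k l n, 𝔼 h : Answers k l t n, 𝔼 ρ : Fin (k n) → sim.Coins,
      gameProb D x w h (fun i => simRun sim x (chosen h i) (ρ i)) H
  else 0

section

variable (hk : PolyBounded k) (hl : PolyBounded l) (ht : PolyBounded fun n => t n + 2)
  (hS : S.Efficient)
  (sim : ∀ n, RandCircuit (Fin (S.lenX n) ⊕ Fin (S.numCh n).size) (RunPos S n))
  (hsim : PolyBounded fun n => (sim n).size)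

/-- Positions of the coins of the simulator. -/
abbrev SimCoinPos (k l t : ℕ → ℕ) (sim : ∀ n, RandCircuit (Fin (S.lenX n) ⊕ Fin (S.numCh n).size)
    (RunPos S n)) (n : ℕ) : Type := AnsPos k l t n ⊕ Fin (k n) × Fin (sim n).coins

include hk hl ht hS hsim in
theorem polyTime_simRun : PolyTime (J := fun n => Fin (k n) × RunPos S n)
    fun n p (u : Bits (Fin (S.lenX n) ⊕ SimCoinPos k l t sim n)) =>
      simRun (sim n) (fun i => u (Sum.inl i))
        (chosen (answersOf fun q => u (Sum.inr (Sum.inl q))) p.1)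
        (fun c => u (Sum.inr (Sum.inr (p.1, c)))) p.2 := by
  have hA := polyBounded_ansPos hk hl ht
  have hC : PolyBounded fun n => (sim n).coins := hsim.mono fun n => Nat.le_add_left _ _
  have hM : PolyBounded fun n => Fintype.card
      ((Fin (S.lenX n) ⊕ Fin (S.numCh n).size) ⊕ Fin (sim n).coins) :=
    (hS.1.card_fin.card_sum hS.2.2.2.2.2.1.card_fin).card_sum hC.card_fin
  have hchal := ((polyTime_chal_chosen (S := S) (k := k) hl ht).rename hA
    (I := fun n => Fin (S.lenX n) ⊕ SimCoinPos k l t sim n)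
    fun _ _ q => Sum.inr (Sum.inl q)).reindex
    (J' := fun n => (Fin (k n) × RunPos S n) × Fin (S.numCh n).size) fun _ p => (p.1.1, p.2)
  exact ((PolyTime.circuit hM (fun n => (sim n).circ)
    (hsim.mono fun n => Nat.le_add_right _ _)).reindex
      (J' := fun n => Fin (k n) × RunPos S n) fun _ p => p.2).comp hM
    (f := fun n (p : Fin (k n) × RunPos S n) m
        (u : Bits (Fin (S.lenX n) ⊕ SimCoinPos k l t sim n)) =>
      (Sum.elim (Sum.elim (fun i => u (Sum.inl i))
          (S.chal n (chosen (answersOf fun q => u (Sum.inr (Sum.inl q))) p.1)))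
        (fun c => u (Sum.inr (Sum.inr (p.1, c)))) m))
    (.prod_sum (.prod_sum (PolyTime.of_input (fun _ q => Sum.inl q.2) fun _ _ _ => rfl) hchal)
      (PolyTime.of_input (fun _ q => Sum.inr (Sum.inr (q.1.1, q.2))) fun _ _ _ => rfl))

/-- The reprogramming instructions `(x, 𝐚, h)` as a bit string. -/
def encodeIns {n : ℕ} (x : S.Inst n) (a : Fin (k n) → S.Com n) (h : Answers k l t n) :
    Bits (InsPos S k l t n) :=
  Sum.elim x (Sum.elim (fun p => a p.1 p.2) fun q => h q.1 q.2)

include hk hl ht hS in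
/-- The reprogramming is computed from the instructions by circuits of polynomial size. -/
theorem exists_patchCircuit : ∃ C : ∀ n,
    Circuit (Fin (Fintype.card (InsPos S k l t n)) ⊕ In S k n) (Unit ⊕ Fin (l n)),
    PolyBounded (fun n => (C n).size) ∧
    ∀ n (ins : Bits (Fin (Fintype.card (InsPos S k l t n)))) (x : S.Inst n)
      (a : Fin (k n) → S.Com n) (h : Answers k l t n) (H : Oracle S k l n),
      (∀ s, ins (Fintype.equivFin _ s) = encodeIns x a h s) →
      (fun ξ => if (C n).run (Sum.elim ins ξ) (Sum.inl ()) then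
        fun o => (C n).run (Sum.elim ins ξ) (Sum.inr o) else H ξ) = patchOracle x a h H := by
  classical
  have hIns := polyBounded_insPos hk hl ht hS
  have hpatch := (polyDec_patch hk hl ht hS).rename (hIns.card_sum (polyBounded_in hk hS))
    (I := fun n => Fin (Fintype.card (InsPos S k l t n)) ⊕ In S k n)
    fun n _ => Sum.map (Fintype.equivFin _) id
  obtain ⟨s, hs, hcost⟩ := PolyTime.exists_cost_all
    (PolyBounded.card_sum (A := fun _ => Unit) ((PolyBounded.const 1).mono fun n => by simp)
      hl.card_fin) hpatch
  choose C hC hrun using fun n => (hcost n).exists_circuit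
  refine ⟨C, ((PolyBounded.const 3).mul hs).mono hC, fun n ins x a h H hins => ?_⟩
  have hx : (fun i => ins (Fintype.equivFin _ (Sum.inl i))) = x := funext fun i => hins _
  have ha : (fun i j => ins (Fintype.equivFin _ (Sum.inr (Sum.inl (i, j))))) = a :=
    funext fun i => funext fun j => hins _
  have hh : (fun p o => ins (Fintype.equivFin _ (Sum.inr (Sum.inr (p, o))))) = h :=
    funext fun i => funext fun j => hins _
  funext ξ
  have h1 : ∀ s, (C n).run (Sum.elim ins ξ) s =
      decide (∃ p, Hit x a h ξ p ∧ Sum.elim (fun _ => true) (fun o => h p o) s = true) := by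
    intro s
    rw [hrun]
    simp only [← hx, ← ha, ← hh]
    exact decide_eq_decide.2 Iff.rfl
  simp [h1, patchOracle]

include hk hl ht hS hsim in
theorem polyTime_simIns : PolyTime
    fun n s (u : Bits (Fin (S.lenX n) ⊕ SimCoinPos k l t sim n)) =>
      encodeIns (fun i => u (Sum.inl i)) (fun i j => simRun (sim n) (fun i => u (Sum.inl i))
        (chosen (answersOf fun q => u (Sum.inr (Sum.inl q))) i)
        (fun c => u (Sum.inr (Sum.inr (i, c)))) (Sum.inl j))
        (answersOf fun q => u (Sum.inr (Sum.inl q))) s := by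
  have hcom := (polyTime_simRun hk hl ht hS sim hsim).reindex (J' := ComPos S k)
    fun _ p => (p.1, Sum.inl p.2)
  refine .sum (PolyTime.of_input (fun _ i => Sum.inl i) fun _ _ _ => rfl) (.sum ?_ ?_)
  · exact hcom
  · exact PolyTime.of_input (fun _ q => Sum.inr (Sum.inl q)) fun _ _ _ => rfl

include hk hl ht hS hsim in
theorem polyTime_simProof : PolyTime
    fun n s (u : Bits (Fin (S.lenX n) ⊕ SimCoinPos k l t sim n)) =>
      proofOf (answersOf fun q => u (Sum.inr (Sum.inl q)))
        (fun i j => simRun (sim n) (fun i => u (Sum.inl i))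
          (chosen (answersOf fun q => u (Sum.inr (Sum.inl q))) i)
          (fun c => u (Sum.inr (Sum.inr (i, c)))) (Sum.inl j))
        (fun i j => simRun (sim n) (fun i => u (Sum.inl i))
          (chosen (answersOf fun q => u (Sum.inr (Sum.inl q))) i)
          (fun c => u (Sum.inr (Sum.inr (i, c)))) (Sum.inr j)) s := by
  have hA := polyBounded_ansPos hk hl ht
  have hR := polyTime_simRun hk hl ht hS sim hsim
  have hcom := hR.reindex (J' := ComPos S k) fun _ p => (p.1, Sum.inl p.2)
  have hresp := hR.reindex (J' := RespPos S k) fun _ p => (p.1, Sum.inr p.2)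
  have hM := hA.card_sum ((hk.card_fin.card_prod hS.2.2.1.card_fin).card_sum
      (hk.card_fin.card_prod hS.2.2.2.2.1.card_fin))
  have hbase : PolyTime (J := fun n => AnsPos k l t n ⊕ ComPos S k n ⊕ RespPos S k n)
    fun n m (u : Bits (Fin (S.lenX n) ⊕ SimCoinPos k l t sim n)) =>
      Sum.elim (fun q => u (Sum.inr (Sum.inl q))) (Sum.elim
        (fun p => simRun (sim n) (fun i => u (Sum.inl i))
          (chosen (answersOf fun q => u (Sum.inr (Sum.inl q))) p.1)
          (fun c => u (Sum.inr (Sum.inr (p.1, c)))) (Sum.inl p.2))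
        fun p => simRun (sim n) (fun i => u (Sum.inl i))
          (chosen (answersOf fun q => u (Sum.inr (Sum.inl q))) p.1)
          (fun c => u (Sum.inr (Sum.inr (p.1, c)))) (Sum.inr p.2)) m :=
    .sum (PolyTime.of_input (fun _ q => Sum.inr (Sum.inl q)) fun _ _ _ => rfl) (.sum hcom hresp)
  refine ((polyTime_proofOf (S := S) hk hl ht).subst hM hbase).congr fun n s u => ?_
  simp only [Sum.elim_inl, Sum.elim_inr]

include hk hl ht hS hsim in
/-- Instructions and proof of the simulator are computed from its coins, which consist of the hash
values `h` and the coins `ρ` of the special simulator. -/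
theorem exists_sampleCircuit : ∃ C : ∀ n,
    Circuit (Fin (S.lenX n) ⊕ Fin (Fintype.card (SimCoinPos k l t sim n)))
      (Fin (Fintype.card (InsPos S k l t n)) ⊕ Pf S k n),
    PolyBounded (fun n => (C n).size) ∧
    ∀ n (r : Bits (Fin (Fintype.card (SimCoinPos k l t sim n)))) (x : S.Inst n)
      (h : Answers k l t n) (ρ : Fin (k n) → (sim n).Coins),
      (∀ q, r (Fintype.equivFin _ (Sum.inl q)) = h q.1 q.2) →
      (∀ q, r (Fintype.equivFin _ (Sum.inr q)) = ρ q.1 q.2) →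
      (∀ s, (C n).run (Sum.elim x r) (Sum.inl (Fintype.equivFin _ s)) =
        encodeIns x (fun i j => simRun (sim n) x (chosen h i) (ρ i) (Sum.inl j)) h s) ∧
      (fun s => (C n).run (Sum.elim x r) (Sum.inr s)) =
        proofOf h (fun i j => simRun (sim n) x (chosen h i) (ρ i) (Sum.inl j))
          fun i j => simRun (sim n) x (chosen h i) (ρ i) (Sum.inr j) := by
  have hC : PolyBounded fun n => (sim n).coins := hsim.mono fun n => Nat.le_add_left _ _
  have hIns := polyBounded_insPos hk hl ht hS
  have hU : PolyBounded fun n => Fintype.card (Fin (S.lenX n) ⊕ SimCoinPos k l t sim n) :=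
    hS.1.card_fin.card_sum ((polyBounded_ansPos hk hl ht).card_sum
      (hk.card_fin.card_prod hC.card_fin))
  have hins' := (polyTime_simIns hk hl ht hS sim hsim).rename hU
    (I := fun n => Fin (S.lenX n) ⊕ Fin (Fintype.card (SimCoinPos k l t sim n)))
    fun n _ => Sum.map id (Fintype.equivFin _)
  have hpf' := (polyTime_simProof hk hl ht hS sim hsim).rename hU
    (I := fun n => Fin (S.lenX n) ⊕ Fin (Fintype.card (SimCoinPos k l t sim n)))
    fun n _ => Sum.map id (Fintype.equivFin _)
  obtain ⟨s₁, hs₁, hcost₁⟩ := PolyTime.exists_cost_all hIns hins'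
  obtain ⟨s₂, hs₂, hcost₂⟩ := PolyTime.exists_cost_all (polyBounded_pf hk hS) hpf'
  choose C hC hrun using fun n => (((hcost₁ n).reindex (Fintype.equivFin _).symm).sumElim
    (hcost₂ n)).exists_circuit
  refine ⟨C, ((PolyBounded.const 3).mul (hs₁.add hs₂)).mono hC, fun n r x h ρ hh hρ => ?_⟩
  have hh' : (fun p o => r (Fintype.equivFin _ (Sum.inl (p, o)))) = h :=
    funext fun p => funext fun o => hh _
  have hρ' : (fun i c => r (Fintype.equivFin _ (Sum.inr (i, c)))) = ρ :=
    funext fun p => funext fun o => hρ _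
  subst hh' hρ'
  constructor
  · intro s
    rw [hrun, Sum.elim_inl, Equiv.symm_apply_apply]
    rfl
  · funext s
    rw [hrun]
    rfl

include hk hl ht hS hsim in
/-- The simulator samples hash values for all attempts, which determine the challenges, and runs the
special simulator of the protocol on these. -/
theorem exists_simulator : ∃ Sim : ∀ n, (fischlin S k l t).Simulator n,
    PolyBounded (fun n => (Sim n).size) ∧ ∀ n (D : ProofDistinguisher S k l n),
      (fischlin S k l t).simProb n (Sim n) D = simGame t (sim n) D := by
  classical
  have hC : PolyBounded fun n => (sim n).coins := hsim.mono fun n => Nat.le_add_left _ _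
  obtain ⟨C₁, hC₁, hrun₁⟩ := exists_sampleCircuit hk hl ht hS sim hsim
  obtain ⟨C₂, hC₂, hrun₂⟩ := exists_patchCircuit hk hl ht hS
  refine ⟨fun n => ⟨Fintype.card (InsPos S k l t n), ⟨Fintype.card (SimCoinPos k l t sim n), C₁ n⟩,
    C₂ n⟩, ?_, ?_⟩
  · exact ((polyBounded_insPos hk hl ht hS).add (hC₁.add ((polyBounded_ansPos hk hl ht).card_sum
      (hk.card_fin.card_prod hC.card_fin)))).add hC₂
  · intro n D
    let e : Bits (Fin (Fintype.card (SimCoinPos k l t sim n))) ≃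
        Answers k l t n × (Fin (k n) → (sim n).Coins) :=
      ((Fintype.equivFin _).symm.arrowCongr (Equiv.refl Bool)).trans
        ((Equiv.sumArrowEquivProdArrow _ _ _).trans
          ((Equiv.curry _ _ _).prodCongr (Equiv.curry _ _ _)))
    have hrun : ∀ (x : S.Inst n) (w : S.Wit n)
        (r : Bits (Fin (Fintype.card (SimCoinPos k l t sim n)))) (H : Oracle S k l n),
        D.prob H (fun ξ =>
            if (C₂ n).run (Sum.elim (fun i => (C₁ n).run (Sum.elim x r) (Sum.inl i)) ξ)
              (Sum.inl ()) then
            fun o => (C₂ n).run (Sum.elim (fun i => (C₁ n).run (Sum.elim x r) (Sum.inl i)) ξ)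
              (Sum.inr o) else H ξ) x w
          (fun i => (C₁ n).run (Sum.elim x r) (Sum.inr i)) =
        gameProb D x w (e r).1 (fun i => simRun (sim n) x (chosen (e r).1 i) ((e r).2 i)) H := by
      intro x w r H
      obtain ⟨h1, h2⟩ := hrun₁ n r x (e r).1 (e r).2 (fun _ => rfl) fun _ => rfl
      rw [hrun₂ n _ x _ _ H h1, h2]
      rfl
    have hsimProb : (fischlin S k l t).simProb n ⟨Fintype.card (InsPos S k l t n),
        ⟨Fintype.card (SimCoinPos k l t sim n), C₁ n⟩, C₂ n⟩ D =
        𝔼 H : Oracle S k l n, ∑ x : S.Inst n, ∑ w : S.Wit n, if S.rel n x w then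
          𝔼 r : Bits (Fin (Fintype.card (SimCoinPos k l t sim n))),
            gameProb D x w (e r).1 (fun i => simRun (sim n) x (chosen (e r).1 i) ((e r).2 i)) H
        else 0 := by
      simp only [← hrun]
      rfl
    rw [hsimProb, simGame, Finset.expect_sum_comm]
    refine Finset.sum_congr rfl fun x _ => ?_
    rw [Finset.expect_sum_comm]
    refine Finset.sum_congr rfl fun w _ => ?_
    by_cases hxw : S.rel n x w
    · simp only [hxw, if_true]
      refine Finset.expect_congr rfl fun H _ => ?_
      rw [Fintype.expect_equiv e _ (fun q => gameProb D x w q.1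
        (fun i => simRun (sim n) x (chosen q.1 i) (q.2 i)) H) fun _ => rfl,
        ← Finset.univ_product_univ, Finset.expect_product]
    · simp [hxw]

end

end Fischlin

/-! ### Hybrid games -/

/-- Resampling one coordinate of a uniformly random tuple. -/
theorem expect_update {ι C : Type} [Fintype ι] [DecidableEq ι] [Fintype C] [Nonempty C] (j : ι)
    (F : (ι → C) → ℝ) : 𝔼 ω : ι → C, 𝔼 v, F (Function.update ω j v) = 𝔼 ω : ι → C, F ω := by
  have hinv : Function.Involutive fun q : (ι → C) × C => (Function.update q.1 j q.2, q.1 j) := by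
    rintro ⟨ω, v⟩
    simp
  have h1 := Fintype.expect_equiv hinv.toPerm (fun q => F (Function.update q.1 j q.2))
    (fun q => F q.1) fun _ => rfl
  rw [← Finset.univ_product_univ, Finset.expect_product, Finset.expect_product] at h1
  simpa using h1

theorem expect_apply {ι C : Type} [Fintype ι] [DecidableEq ι] [Fintype C] [Nonempty C] (j : ι)
    (f : C → ℝ) : 𝔼 ω : ι → C, f (ω j) = 𝔼 v, f v := by
  rw [← expect_update j]
  simp

theorem expect_pi_prod {ι A B : Type} [Fintype ι] [DecidableEq ι] [Fintype A] [Fintype B]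
    (f : (ι → A) → (ι → B) → ℝ) :
    𝔼 ω : ι → A × B, f (fun i => (ω i).1) (fun i => (ω i).2) = 𝔼 a, 𝔼 b, f a b := by
  rw [Fintype.expect_equiv (Equiv.arrowProdEquivProdArrow ι (fun _ => A) fun _ => B)
    (fun ω => f (fun i => (ω i).1) fun i => (ω i).2) (fun q => f q.1 q.2) fun _ => rfl,
    ← Finset.univ_product_univ, Finset.expect_product]

namespace Fischlin

variable {S : ThreeRound} {k l t : ℕ → ℕ} {n : ℕ}

/-- An honest commitment and response for the challenge `c`. -/
def honestRun (x : S.Inst n) (w : S.Wit n) (c : ℕ) (r₁ : (S.prover₁ n).Coins)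
    (r₂ : (S.prover₂ n).Coins) : Bits (RunPos S n) :=
  Sum.elim (S.commit n x w r₁) (S.respond n (S.state n x w r₁) c r₂)

variable (sim : RandCircuit (Fin (S.lenX n) ⊕ Fin (S.numCh n).size) (RunPos S n))

/-- Coins for one repetition: those of the honest prover, with fresh ones for the response in each
attempt, and those of the special simulator. -/
abbrev HybridCoins (t : ℕ → ℕ) : Type :=
  (S.prover₁ n).Coins × (Fin (t n + 2) → (S.prover₂ n).Coins) × sim.Coins

/-- Commitments and responses of which the first `j` are simulated and the others are honest. -/
def hybridRun (x : S.Inst n) (w : S.Wit n) (h : Answers k l t n) (j : ℕ)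
    (ω : Fin (k n) → HybridCoins sim t) (i : Fin (k n)) : Bits (RunPos S n) :=
  if (i : ℕ) < j then simRun sim x (chosen h i) (ω i).2.2
  else honestRun x w (chosen h i) (ω i).1 ((ω i).2.1 (chosen h i))

/-- Commitments and responses as in `hybridRun`, except for a given commitment and response `v` in
repetition `j`. -/
def mixedRun (h : Answers k l t n) (j : Fin (k n)) (ω : Fin (k n) → HybridCoins sim t)
    (x : S.Inst n) (w : S.Wit n) (v : Bits (RunPos S n)) (i : Fin (k n)) : Bits (RunPos S n) :=
  if i = j then v
  else if i < j then simRun sim x (chosen h i) (ω i).2.2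
  else honestRun x w (chosen h i) (ω i).1 ((ω i).2.1 (chosen h i))

theorem hybridRun_update (x : S.Inst n) (w : S.Wit n) (h : Answers k l t n) (j : Fin (k n))
    (ω : Fin (k n) → HybridCoins sim t) (v : HybridCoins sim t) :
    hybridRun sim x w h j (Function.update ω j v) =
      mixedRun sim h j ω x w (honestRun x w (chosen h j) v.1 (v.2.1 (chosen h j))) := by
  funext i
  by_cases hij : i = j
  · subst hij
    simp [hybridRun, mixedRun]
  · simp only [hybridRun, mixedRun, Function.update_of_ne hij, if_neg hij, Fin.lt_def]

theorem hybridRun_succ_update (x : S.Inst n) (w : S.Wit n) (h : Answers k l t n) (j : Fin (k n))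
    (ω : Fin (k n) → HybridCoins sim t) (v : HybridCoins sim t) :
    hybridRun sim x w h (j + 1) (Function.update ω j v) =
      mixedRun sim h j ω x w (simRun sim x (chosen h j) v.2.2) := by
  funext i
  by_cases hij : i = j
  · subst hij
    simp [hybridRun, mixedRun]
  · have : (i : ℕ) < j + 1 ↔ i < j := by
      rw [Fin.lt_def]
      have := Fin.val_ne_of_ne hij
      omega
    simp only [hybridRun, mixedRun, Function.update_of_ne hij, if_neg hij, this]

theorem expect_hybridRun (x : S.Inst n) (w : S.Wit n) (h : Answers k l t n) (j : Fin (k n))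
    (g : (Fin (k n) → Bits (RunPos S n)) → ℝ) :
    𝔼 ω, g (hybridRun sim x w h j ω) = 𝔼 ω, 𝔼 r₁, 𝔼 r₂,
      g (mixedRun sim h j ω x w (honestRun x w (chosen h j) r₁ r₂)) := by
  rw [← expect_update j]
  refine Finset.expect_congr rfl fun ω _ => ?_
  simp only [hybridRun_update]
  simp only [← Finset.univ_product_univ, Finset.expect_product, Fintype.expect_const]
  exact Finset.expect_congr rfl fun r₁ _ => expect_apply (chosen h j) fun r₂ =>
    g (mixedRun sim h j ω x w (honestRun x w (chosen h j) r₁ r₂))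

theorem expect_hybridRun_succ (x : S.Inst n) (w : S.Wit n) (h : Answers k l t n) (j : Fin (k n))
    (g : (Fin (k n) → Bits (RunPos S n)) → ℝ) :
    𝔼 ω, g (hybridRun sim x w h (j + 1) ω) = 𝔼 ω, 𝔼 ρ,
      g (mixedRun sim h j ω x w (simRun sim x (chosen h j) ρ)) := by
  rw [← expect_update j]
  refine Finset.expect_congr rfl fun ω _ => ?_
  simp only [hybridRun_succ_update]
  simp only [← Finset.univ_product_univ, Finset.expect_product, Fintype.expect_const]

variable (D : ProofDistinguisher S k l n)

open Classical in
/-- The game in which the first `j` commitments and responses are simulated. -/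
noncomputable def hybridGame (t : ℕ → ℕ) (j : ℕ) : ℝ :=
  ∑ x : S.Inst n, ∑ w : S.Wit n, if S.rel n x w then
    𝔼 h : Answers k l t n, 𝔼 ω, 𝔼 H, gameProb D x w h (hybridRun sim x w h j ω) H
  else 0

theorem hybridGame_zero : hybridGame sim D t 0 = honestGame t D := by
  classical
  refine Finset.sum_congr rfl fun x _ => Finset.sum_congr rfl fun w _ => if_congr Iff.rfl ?_ rfl
  have h1 : ∀ h : Answers k l t n, (𝔼 ω, 𝔼 H, gameProb D x w h (hybridRun sim x w h 0 ω) H) =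
      𝔼 H, 𝔼 r : Coins S k t n, D.prob H (patchOracle x (comVec x w r) h H) x w
        (proofOf h (comVec x w r) fun i => resp x w r i (chosen h i)) := by
    intro h
    let F : Coins S k t n → ℝ := fun r => 𝔼 H, D.prob H (patchOracle x (comVec x w r) h H) x w
        (proofOf h (comVec x w r) fun i => resp x w r i (chosen h i))
    have h2 : ∀ ω : Fin (k n) → HybridCoins sim t,
        (𝔼 H, gameProb D x w h (hybridRun sim x w h 0 ω) H) =
          F (fun i => (ω i).1, fun i => (ω i).2.1) := fun ω => rfl
    simp only [h2]
    rw [expect_pi_prod (B := (Fin (t n + 2) → (S.prover₂ n).Coins) × sim.Coins)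
      (fun a b => F (a, fun i => (b i).1))]
    have h3 : ∀ a, (𝔼 b : Fin (k n) → (Fin (t n + 2) → (S.prover₂ n).Coins) × sim.Coins,
        F (a, fun i => (b i).1)) = 𝔼 r₂, F (a, r₂) := fun a => by
      rw [expect_pi_prod (fun r₂ (_ : Fin (k n) → sim.Coins) => F (a, r₂))]
      exact Finset.expect_congr rfl fun _ _ => Fintype.expect_const _
    simp only [h3]
    refine Eq.trans ?_ (Finset.expect_comm ..)
    rw [← Finset.univ_product_univ, Finset.expect_product]
  simp only [h1]
  refine (Finset.expect_comm ..).trans (Finset.expect_congr rfl fun H _ => Finset.expect_comm ..)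

theorem hybridGame_top : hybridGame sim D t (k n) = simGame t sim D := by
  classical
  refine Finset.sum_congr rfl fun x _ => Finset.sum_congr rfl fun w _ => if_congr Iff.rfl ?_ rfl
  have h1 : ∀ h : Answers k l t n, (𝔼 ω, 𝔼 H, gameProb D x w h (hybridRun sim x w h (k n) ω) H) =
      𝔼 H, 𝔼 ρ : Fin (k n) → sim.Coins,
        gameProb D x w h (fun i => simRun sim x (chosen h i) (ρ i)) H := by
    intro h
    have h2 : ∀ ω : Fin (k n) → HybridCoins sim t, hybridRun sim x w h (k n) ω =
        fun i => simRun sim x (chosen h i) (ω i).2.2 := fun ω => funext fun i => if_pos i.2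
    simp only [h2]
    rw [Finset.expect_comm]
    refine Finset.expect_congr rfl fun H _ => ?_
    rw [expect_pi_prod (fun (_ : Fin (k n) → (S.prover₁ n).Coins)
      (b : Fin (k n) → (Fin (t n + 2) → (S.prover₂ n).Coins) × sim.Coins) =>
      gameProb D x w h (fun i => simRun sim x (chosen h i) (b i).2) H), Fintype.expect_const,
      expect_pi_prod (fun (_ : Fin (k n) → Fin (t n + 2) → (S.prover₂ n).Coins)
      (ρ : Fin (k n) → sim.Coins) => gameProb D x w h (fun i => simRun sim x (chosen h i) (ρ i)) H),
      Fintype.expect_const]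
  simp only [h1]
  exact Finset.expect_comm ..

open Classical in
/-- The advantage in repetition `j` with hash values `h`, coins `ω` and oracle `H` fixed. -/
noncomputable def stepAdvantage (h : Answers k l t n) (j : Fin (k n))
    (ω : Fin (k n) → HybridCoins sim t) (H : Oracle S k l n) : ℝ :=
  ∑ x : S.Inst n, ∑ w : S.Wit n, if S.rel n x w then
    (𝔼 r₁, 𝔼 r₂,
        gameProb D x w h (mixedRun sim h j ω x w (honestRun x w (chosen h j) r₁ r₂)) H) -
      𝔼 ρ, gameProb D x w h (mixedRun sim h j ω x w (simRun sim x (chosen h j) ρ)) H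
  else 0

theorem patchOracle_congr {x : S.Inst n} {a : Fin (k n) → S.Com n} {h : Answers k l t n}
    {H K : Oracle S k l n} {ξ : Bits (In S k n)} (hξ : H ξ = K ξ) :
    patchOracle x a h H ξ = patchOracle x a h K ξ := by
  rw [patchOracle, patchOracle, hξ]

/-- The reprogrammed oracle at a point depends on the value of `H` at this point only, so it
suffices that `H` is taken from a family with limited independence. -/
theorem expect_gameProb_eq {K : Type} [Fintype K] {d : ℕ} {E : K → Oracle S k l n}
    (hE : WiseIndep d E) (hd : 2 * D.size ≤ d) (x : S.Inst n) (w : S.Wit n) (h : Answers k l t n)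
    (T : Fin (k n) → Bits (RunPos S n)) :
    𝔼 H, gameProb D x w h T H = 𝔼 κ, gameProb D x w h T (E κ) := by
  have h1 := D.prob_mem_localFun (fun H => patchOracle x (fun i j => T i (Sum.inl j)) h H)
    (fun H K ξ hξ => patchOracle_congr hξ) x w
    (proofOf h (fun i j => T i (Sum.inl j)) fun i j => T i (Sum.inr j))
  have h2 := hE.expect_eq (localFun_mono (le_trans (by rw [Distinguisher.size]; omega) hd) h1)
  exact_mod_cast h2.symm

/-- Two neighbouring hybrid games differ in one repetition, in which the coins are resampled. -/
theorem hybridGame_sub_succ {K : Type} [Fintype K] {d : ℕ} {E : K → Oracle S k l n}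
    (hE : WiseIndep d E) (hd : 2 * D.size ≤ d) (j : Fin (k n)) :
    hybridGame sim D t j - hybridGame sim D t (j + 1) =
      𝔼 h : Answers k l t n, 𝔼 ω, 𝔼 κ, stepAdvantage sim D h j ω (E κ) := by
  classical
  simp only [hybridGame, stepAdvantage]
  simp only [Finset.expect_sum_comm, ← Finset.sum_sub_distrib]
  refine Finset.sum_congr rfl fun x _ => Finset.sum_congr rfl fun w _ => ?_
  by_cases hxw : S.rel n x w
  · simp only [hxw, if_true]
    rw [← Finset.expect_sub_distrib]
    refine Finset.expect_congr rfl fun h _ => ?_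
    simp only [expect_gameProb_eq D hE hd]
    rw [expect_hybridRun sim x w h j fun T => 𝔼 κ, gameProb D x w h T (E κ),
      expect_hybridRun_succ sim x w h j fun T => 𝔼 κ, gameProb D x w h T (E κ),
      ← Finset.expect_sub_distrib]
    refine Finset.expect_congr rfl fun ω _ => ?_
    rw [Finset.expect_sub_distrib]
    congr 1
    · exact (Finset.expect_congr rfl fun r₁ _ => Finset.expect_comm ..).trans
        (Finset.expect_comm ..)
    · exact Finset.expect_comm ..
  · simp [hxw]

/-- The hybrid argument over the `k n` repetitions. -/
theorem abs_honestGame_sub_simGame_le {K : Type} [Fintype K] [Nonempty K] {d : ℕ}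
    {E : K → Oracle S k l n} (hE : WiseIndep d E) (hd : 2 * D.size ≤ d) {B : ℝ}
    (hB : ∀ (h : Answers k l t n) j ω κ, |stepAdvantage sim D h j ω (E κ)| ≤ B) :
    |honestGame t D - simGame t sim D| ≤ k n * B := by
  have key : ∀ m ≤ k n, |hybridGame sim D t 0 - hybridGame sim D t m| ≤ m * B := by
    intro m
    induction m with
    | zero => simp
    | succ m ih =>
      intro hm
      have h1 := hybridGame_sub_succ sim D (t := t) hE hd ⟨m, hm⟩
      have h2 : |hybridGame sim D t m - hybridGame sim D t (m + 1)| ≤ B := by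
        rw [h1]
        refine (Finset.abs_expect_le _ _).trans
          (Finset.expect_le Finset.univ_nonempty fun h _ => ?_)
        refine (Finset.abs_expect_le _ _).trans
          (Finset.expect_le Finset.univ_nonempty fun ω _ => ?_)
        exact (Finset.abs_expect_le _ _).trans
          (Finset.expect_le Finset.univ_nonempty fun κ _ => hB _ _ _ _)
      have h3 := abs_sub_le (hybridGame sim D t 0) (hybridGame sim D t m)
        (hybridGame sim D t (m + 1))
      have h4 := ih (by omega)
      push_cast
      linarith
  rw [← hybridGame_zero sim D, ← hybridGame_top]
  exact key _ le_rfl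

end Fischlin

/-! ### The distinguisher of transcripts -/

namespace PolyTime

variable {J I : ℕ → Type}

open Classical in
/-- Selection by a condition that does not depend on the input. -/
theorem ite_const {c : ∀ n, J n → Prop} {f g F : ∀ n, J n → Bits (I n) → Bool} (hf : PolyTime f)
    (hg : PolyTime g) (hF : ∀ n j x, F n j x = if c n j then f n j x else g n j x) :
    PolyTime F := by
  obtain ⟨s, hs, h⟩ := hf
  obtain ⟨s', hs', h'⟩ := hg
  refine congr (f := fun n j x => if c n j then f n j x else g n j x)
    ⟨_, hs.add hs', fun n j => ?_⟩ hF
  by_cases hc : c n j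
  · simp only [hc, if_true]
    exact (h n j).mono (Nat.le_add_right _ _)
  · simp only [hc, if_false]
    exact (h' n j).mono (Nat.le_add_left _ _)

end PolyTime

namespace Fischlin

variable {S : ThreeRound} {k l t : ℕ → ℕ}

/-- Positions of `(x, w)` and a transcript. -/
abbrev CtxPos (S : ThreeRound) (n : ℕ) : Type := Fin (S.lenX n) ⊕ Fin (S.lenW n) ⊕ S.TrPos n

/-- The commitment and the response of a transcript. -/
abbrev trRun {n : ℕ} (y : Bits (S.TrPos n)) : Bits (RunPos S n) :=
  Sum.elim (fun i => y (Sum.inl i)) fun i => y (Sum.inr (Sum.inr i))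

section

variable (hS : S.Efficient)
  (sim : ∀ n, RandCircuit (Fin (S.lenX n) ⊕ Fin (S.numCh n).size) (RunPos S n))
  (hsim : PolyBounded fun n => (sim n).size)

include hS

theorem polyBounded_trPos : PolyBounded fun n => Fintype.card (S.TrPos n) :=
  hS.2.2.1.card_fin.card_sum (hS.2.2.2.2.2.1.card_fin.card_sum hS.2.2.2.2.1.card_fin)

theorem polyBounded_ctxPos : PolyBounded fun n => Fintype.card (CtxPos S n) :=
  hS.1.card_fin.card_sum (hS.2.1.card_fin.card_sum (polyBounded_trPos hS))

include hsim in
theorem polyTime_simRun_const : PolyTime (J := fun n => (ℕ × (sim n).Coins) × RunPos S n)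
    fun n q (u : Bits (CtxPos S n)) => simRun (sim n) (fun i => u (Sum.inl i)) q.1.1 q.1.2 q.2 := by
  have hC : PolyBounded fun n => (sim n).coins := hsim.mono fun n => Nat.le_add_left _ _
  have hM : PolyBounded fun n => Fintype.card
      ((Fin (S.lenX n) ⊕ Fin (S.numCh n).size) ⊕ Fin (sim n).coins) :=
    (hS.1.card_fin.card_sum hS.2.2.2.2.2.1.card_fin).card_sum hC.card_fin
  exact ((PolyTime.circuit hM (fun n => (sim n).circ)
    (hsim.mono fun n => Nat.le_add_right _ _)).reindex
      (J' := fun n => (ℕ × (sim n).Coins) × RunPos S n) fun _ p => p.2).comp hM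
    (f := fun n (q : (ℕ × (sim n).Coins) × RunPos S n) m (u : Bits (CtxPos S n)) =>
      (Sum.elim (Sum.elim (fun i => u (Sum.inl i)) (S.chal n q.1.1)) q.1.2 m))
    (.prod_sum (.prod_sum (PolyTime.of_input (fun _ q => Sum.inl q.2) fun _ _ _ => rfl)
        (PolyTime.of_const (fun n q => S.chal n q.1.1.1 q.2) fun _ _ _ => rfl))
      (PolyTime.of_const (fun _ q => q.1.1.2 q.2) fun _ _ _ => rfl))

theorem polyTime_prover₁ :
    PolyTime (J := fun n => (S.prover₁ n).Coins × (Fin (S.lenA n) ⊕ Fin (S.lenS n)))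
    fun n q (u : Bits (CtxPos S n)) => (S.prover₁ n).run
      (Sum.elim (fun i => u (Sum.inl i)) fun i => u (Sum.inr (Sum.inl i))) q.1 q.2 := by
  have hP := hS.2.2.2.2.2.2.1
  have hC : PolyBounded fun n => (S.prover₁ n).coins := hP.mono fun n => Nat.le_add_left _ _
  have hM : PolyBounded fun n => Fintype.card
      ((Fin (S.lenX n) ⊕ Fin (S.lenW n)) ⊕ Fin (S.prover₁ n).coins) :=
    (hS.1.card_fin.card_sum hS.2.1.card_fin).card_sum hC.card_fin
  exact ((PolyTime.circuit hM (fun n => (S.prover₁ n).circ)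
    (hP.mono fun n => Nat.le_add_right _ _)).reindex
      (J' := fun n => (S.prover₁ n).Coins × (Fin (S.lenA n) ⊕ Fin (S.lenS n)))
      fun _ p => p.2).comp hM
    (f := fun n (q : (S.prover₁ n).Coins × (Fin (S.lenA n) ⊕ Fin (S.lenS n))) m
        (u : Bits (CtxPos S n)) =>
      (Sum.elim (Sum.elim (fun i => u (Sum.inl i)) fun i => u (Sum.inr (Sum.inl i))) q.1 m))
    (.prod_sum (.prod_sum (PolyTime.of_input (fun _ q => Sum.inl q.2) fun _ _ _ => rfl)
        (PolyTime.of_input (fun _ q => Sum.inr (Sum.inl q.2)) fun _ _ _ => rfl))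
      (PolyTime.of_const (fun _ q => q.1.1 q.2) fun _ _ _ => rfl))

theorem polyTime_honestRun :
    PolyTime (J := fun n => (ℕ × (S.prover₁ n).Coins × (S.prover₂ n).Coins) × RunPos S n)
    fun n q (u : Bits (CtxPos S n)) => honestRun (fun i => u (Sum.inl i))
      (fun i => u (Sum.inr (Sum.inl i))) q.1.1 q.1.2.1 q.1.2.2 q.2 := by
  have hP := hS.2.2.2.2.2.2.2.1
  have hC : PolyBounded fun n => (S.prover₂ n).coins := hP.mono fun n => Nat.le_add_left _ _
  have hM : PolyBounded fun n => Fintype.card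
      ((Fin (S.lenS n) ⊕ Fin (S.numCh n).size) ⊕ Fin (S.prover₂ n).coins) :=
    (hS.2.2.2.1.card_fin.card_sum hS.2.2.2.2.2.1.card_fin).card_sum hC.card_fin
  have h1 := polyTime_prover₁ hS
  refine .prod_sum ?_ ?_
  · exact h1.reindex (J' := fun n => (ℕ × (S.prover₁ n).Coins × (S.prover₂ n).Coins) ×
      Fin (S.lenA n)) fun _ q => (q.1.2.1, Sum.inl q.2)
  · exact ((PolyTime.circuit hM (fun n => (S.prover₂ n).circ)
      (hP.mono fun n => Nat.le_add_right _ _)).reindex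
        (J' := fun n => (ℕ × (S.prover₁ n).Coins × (S.prover₂ n).Coins) × Fin (S.lenZ n))
        fun _ p => p.2).comp hM
      (f := fun n (q : (ℕ × (S.prover₁ n).Coins × (S.prover₂ n).Coins) × Fin (S.lenZ n)) m
          (u : Bits (CtxPos S n)) =>
        (Sum.elim (Sum.elim (S.state n (fun i => u (Sum.inl i)) (fun i => u (Sum.inr (Sum.inl i)))
          q.1.2.1) (S.chal n q.1.1)) q.1.2.2 m))
      (.prod_sum (.prod_sum
          (h1.reindex (J' := fun n => ((ℕ × (S.prover₁ n).Coins × (S.prover₂ n).Coins) ×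
            Fin (S.lenZ n)) × Fin (S.lenS n)) fun _ q => (q.1.1.2.1, Sum.inr q.2))
          (PolyTime.of_const (fun n q => S.chal n q.1.1.1 q.2) fun _ _ _ => rfl))
        (PolyTime.of_const (fun _ q => q.1.1.2.2 q.2) fun _ _ _ => rfl))

/-- What is fixed in one step of the hybrid argument: hash values, the number of the repetition, and
coins. -/
abbrev StepIndex (k l t : ℕ → ℕ)
    (sim : ∀ n, RandCircuit (Fin (S.lenX n) ⊕ Fin (S.numCh n).size) (RunPos S n)) (n : ℕ) : Type :=
  Answers k l t n × Fin (k n) × (Fin (k n) → HybridCoins (sim n) t)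

include hsim in
theorem polyTime_mixedRun : PolyTime (J := fun n => StepIndex k l t sim n × Fin (k n) × RunPos S n)
    fun n q (u : Bits (CtxPos S n)) => mixedRun (sim n) q.1.1 q.1.2.1 q.1.2.2
      (fun i => u (Sum.inl i)) (fun i => u (Sum.inr (Sum.inl i)))
      (trRun fun i => u (Sum.inr (Sum.inr i))) q.2.1 q.2.2 := by
  classical
  have h1 := (polyTime_simRun_const hS sim hsim).reindex
    (J' := fun n => StepIndex k l t sim n × Fin (k n) × RunPos S n)
    fun _ q => (((chosen q.1.1 q.2.1 : ℕ), (q.1.2.2 q.2.1).2.2), q.2.2)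
  have h2 := (polyTime_honestRun hS).reindex
    (J' := fun n => StepIndex k l t sim n × Fin (k n) × RunPos S n)
    fun _ q => (((chosen q.1.1 q.2.1 : ℕ), (q.1.2.2 q.2.1).1,
      (q.1.2.2 q.2.1).2.1 (chosen q.1.1 q.2.1)), q.2.2)
  have h3 : PolyTime (J := RunPos S) fun n s (u : Bits (CtxPos S n)) =>
      trRun (fun i => u (Sum.inr (Sum.inr i))) s :=
    .sum (PolyTime.of_input (fun _ i => Sum.inr (Sum.inr (Sum.inl i))) fun _ _ _ => rfl)
      (PolyTime.of_input (fun _ i => Sum.inr (Sum.inr (Sum.inr (Sum.inr i)))) fun _ _ _ => rfl)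
  refine PolyTime.ite_const (c := fun n q => q.2.1 = q.1.2.1) (h3.reindex fun _ q => q.2.2)
    (PolyTime.ite_const (c := fun n q => q.2.1 < q.1.2.1) (F := fun n q u =>
      (if q.2.1 < q.1.2.1 then simRun (sim n) (fun i => u (Sum.inl i)) (chosen q.1.1 q.2.1)
          (q.1.2.2 q.2.1).2.2
        else honestRun (fun i => u (Sum.inl i)) (fun i => u (Sum.inr (Sum.inl i)))
          (chosen q.1.1 q.2.1) (q.1.2.2 q.2.1).1 ((q.1.2.2 q.2.1).2.1 (chosen q.1.1 q.2.1))) q.2.2)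
      h1 h2 fun n q u => ?_) fun n q u => ?_
  · split_ifs <;> rfl
  · rw [mixedRun]
    split_ifs <;> rfl

end

end Fischlin

namespace Fischlin

variable {S : ThreeRound} {k l t : ℕ → ℕ}

/-- The commitments and responses of one step of the hybrid argument, where those of one repetition
are taken from the given transcript. -/
def ctxRun {sim : ∀ n, RandCircuit (Fin (S.lenX n) ⊕ Fin (S.numCh n).size) (RunPos S n)} {n : ℕ}
    (q : StepIndex k l t sim n) (u : Bits (CtxPos S n)) : Fin (k n) → Bits (RunPos S n) :=
  mixedRun (sim n) q.1 q.2.1 q.2.2 (fun i => u (Sum.inl i)) (fun i => u (Sum.inr (Sum.inl i)))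
    (trRun fun i => u (Sum.inr (Sum.inr i)))

section

variable (hk : PolyBounded k) (hl : PolyBounded l) (ht : PolyBounded fun n => t n + 2)
  (hS : S.Efficient)
  (sim : ∀ n, RandCircuit (Fin (S.lenX n) ⊕ Fin (S.numCh n).size) (RunPos S n))
  (hsim : PolyBounded fun n => (sim n).size)

include hk hl ht hS hsim

theorem polyTime_stepProof : PolyTime (J := fun n => StepIndex k l t sim n × Pf S k n)
    fun n q (u : Bits (CtxPos S n)) => proofOf q.1.1 (fun i j => ctxRun q.1 u i (Sum.inl j))
      (fun i j => ctxRun q.1 u i (Sum.inr j)) q.2 := by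
  have hM := (polyBounded_ansPos hk hl ht).card_sum
    ((hk.card_fin.card_prod hS.2.2.1.card_fin).card_sum
      (hk.card_fin.card_prod hS.2.2.2.2.1.card_fin))
  have hR := polyTime_mixedRun (k := k) (l := l) (t := t) hS sim hsim
  have hbase : PolyTime (J := fun n => (StepIndex k l t sim n × Pf S k n) ×
      (AnsPos k l t n ⊕ ComPos S k n ⊕ RespPos S k n)) fun n q (u : Bits (CtxPos S n)) =>
      Sum.elim (fun p => q.1.1.1 p.1 p.2) (Sum.elim (fun p => ctxRun q.1.1 u p.1 (Sum.inl p.2))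
        fun p => ctxRun q.1.1 u p.1 (Sum.inr p.2)) q.2 :=
    .prod_sum (PolyTime.of_const (fun _ q => q.1.1.1 q.2.1 q.2.2) fun _ _ _ => rfl)
      (.prod_sum
        (hR.reindex (J' := fun n => (StepIndex k l t sim n × Pf S k n) × ComPos S k n)
          fun _ q => (q.1.1, q.2.1, Sum.inl q.2.2))
        (hR.reindex (J' := fun n => (StepIndex k l t sim n × Pf S k n) × RespPos S k n)
          fun _ q => (q.1.1, q.2.1, Sum.inr q.2.2)))
  exact ((polyTime_proofOf (S := S) hk hl ht).reindex
    (J' := fun n => StepIndex k l t sim n × Pf S k n) fun _ q => q.2).comp hM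
    (f := fun n (q : StepIndex k l t sim n × Pf S k n) m (u : Bits (CtxPos S n)) =>
      Sum.elim (fun p => q.1.1 p.1 p.2) (Sum.elim (fun p => ctxRun q.1 u p.1 (Sum.inl p.2))
        fun p => ctxRun q.1 u p.1 (Sum.inr p.2)) m) hbase

theorem polyDec_stepPatch :
    PolyDec (J := fun n => StepIndex k l t sim n × (Unit ⊕ Fin (l n)))
      fun n q (u : Bits (CtxPos S n ⊕ In S k n)) =>
        ∃ p, Hit (fun i => u (Sum.inl (Sum.inl i)))
          (fun i j => ctxRun q.1 (fun m => u (Sum.inl m)) i (Sum.inl j)) q.1.1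
          (fun s => u (Sum.inr s)) p ∧
          Sum.elim (fun _ => true) (fun o => q.1.1 p o) q.2 = true := by
  classical
  have hIns := (polyBounded_insPos hk hl ht hS).card_sum (polyBounded_in hk hS)
  have hR := (polyTime_mixedRun (k := k) (l := l) (t := t) hS sim hsim).rename
    (polyBounded_ctxPos hS) (I := fun n => CtxPos S n ⊕ In S k n) fun _ _ => Sum.inl
  have hbase : PolyTime (J := fun n => (StepIndex k l t sim n × (Unit ⊕ Fin (l n))) ×
      (InsPos S k l t n ⊕ In S k n)) fun n q (u : Bits (CtxPos S n ⊕ In S k n)) =>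
      Sum.elim (encodeIns (fun i => u (Sum.inl (Sum.inl i)))
        (fun i j => ctxRun q.1.1 (fun m => u (Sum.inl m)) i (Sum.inl j)) q.1.1.1)
        (fun s => u (Sum.inr s)) q.2 :=
    .prod_sum (.prod_sum (PolyTime.of_input (fun _ q => Sum.inl (Sum.inl q.2)) fun _ _ _ => rfl)
      (.prod_sum
        (hR.reindex (J' := fun n => (StepIndex k l t sim n × (Unit ⊕ Fin (l n))) × ComPos S k n)
          fun _ q => (q.1.1, q.2.1, Sum.inl q.2.2))
        (PolyTime.of_const (fun _ q => q.1.1.1 q.2.1 q.2.2) fun _ _ _ => rfl)))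
      (PolyTime.of_input (fun _ q => Sum.inr q.2) fun _ _ _ => rfl)
  refine PolyDec.of_polyTime ((PolyTime.reindex (polyDec_patch hk hl ht hS)
    (J' := fun n => StepIndex k l t sim n × (Unit ⊕ Fin (l n))) fun _ q => q.2).comp hIns
    (f := fun n (q : StepIndex k l t sim n × (Unit ⊕ Fin (l n))) m
        (u : Bits (CtxPos S n ⊕ In S k n)) =>
      Sum.elim (encodeIns (fun i => u (Sum.inl (Sum.inl i)))
        (fun i j => ctxRun q.1 (fun m => u (Sum.inl m)) i (Sum.inl j)) q.1.1)
        (fun s => u (Sum.inr s)) m) hbase) fun n q u => ?_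
  exact @decide_eq_true_iff _ (_)

theorem polyTime_stepOracle {K : ℕ → Type} {E : ∀ n, K n → Oracle S k l n}
    (hE : PolyTime (J := fun n => K n × Fin (l n)) fun n q ξ => E n q.1 ξ q.2) :
    PolyTime (J := fun n => (StepIndex k l t sim n × K n) × Fin (l n))
      fun n q (u : Bits (CtxPos S n ⊕ In S k n)) =>
        patchOracle (fun i => u (Sum.inl (Sum.inl i)))
          (fun i j => ctxRun q.1.1 (fun m => u (Sum.inl m)) i (Sum.inl j)) q.1.1.1 (E n q.1.2)
          (fun s => u (Sum.inr s)) q.2 := by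
  classical
  have hP := polyDec_stepPatch hk hl ht hS sim hsim
  have hflag := PolyTime.reindex hP (J' := fun n => (StepIndex k l t sim n × K n) × Fin (l n))
    fun _ q => (q.1.1, Sum.inl ())
  have hval := PolyTime.reindex hP (J' := fun n => (StepIndex k l t sim n × K n) × Fin (l n))
    fun _ q => (q.1.1, Sum.inr q.2)
  have hE' := (hE.rename (polyBounded_in hk hS) (I := fun n => CtxPos S n ⊕ In S k n)
    fun _ _ => Sum.inr).reindex (J' := fun n => (StepIndex k l t sim n × K n) × Fin (l n))
    fun _ q => (q.1.2, q.2)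
  refine (hflag.cond hval hE').congr fun n q u => ?_
  rw [patchOracle]
  by_cases h : ∃ p, Hit (fun i => u (Sum.inl (Sum.inl i)))
      (fun i j => ctxRun q.1.1 (fun m => u (Sum.inl m)) i (Sum.inl j)) q.1.1.1
      (fun s => u (Sum.inr s)) p
  · rw [if_pos h, if_pos (@decide_eq_true _ (_) (h.imp fun _ hp => ⟨hp, rfl⟩))]
    exact decide_eq_decide.2 Iff.rfl
  · rw [if_neg h, if_neg]
    exact fun hc => h ((@of_decide_eq_true _ (_) hc).imp fun _ hp => hp.1)

omit hk hl ht sim hsim in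
theorem polyTime_challengeTest : PolyTime (J := fun _ => ℕ)
    fun n c (u : Bits (S.TrPos n ⊕ Unit)) =>
      decide ((fun i => u (Sum.inl (Sum.inr (Sum.inl i)))) = S.chal n c) && u (Sum.inr ()) := by
  have h1 : PolyDec (J := fun _ => ℕ) fun n c (u : Bits (S.TrPos n ⊕ Unit)) =>
      ∀ i, u (Sum.inl (Sum.inr (Sum.inl i))) = S.chal n c i :=
    PolyDec.forall_ hS.2.2.2.2.2.1.card_fin
      (R := fun n c i (u : Bits (S.TrPos n ⊕ Unit)) =>
        u (Sum.inl (Sum.inr (Sum.inl i))) = S.chal n c i)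
      (PolyDec.of_polyTime ((PolyTime.of_input
        (fun _ q => Sum.inl (Sum.inr (Sum.inl q.2))) fun _ _ _ => rfl).beq
        (PolyTime.of_const (fun n q => S.chal n q.1 q.2) fun _ _ _ => rfl)) fun _ _ _ => by simp)
  exact (h1.polyTime fun n c u => by simp [funext_iff]).and
    (PolyTime.of_input (fun _ _ => Sum.inr ()) fun _ _ _ => rfl)

/-- In one step of the hybrid argument the whole game is played by a distinguisher of transcripts:
it inserts the transcript in repetition `j`, has the rest built in, and computes the oracle
itself. It outputs 0 unless the challenge of the transcript is the one of repetition `j`. -/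
theorem exists_stepDistinguisher {K : ℕ → Type} {E : ∀ n, K n → Oracle S k l n}
    (hE : PolyTime (J := fun n => K n × Fin (l n)) fun n q ξ => E n q.1 ξ q.2)
    (D : ∀ n, ProofDistinguisher S k l n) (hD : PolyBounded fun n => (D n).size) :
    ∃ s, PolyBounded s ∧ ∀ n (q : StepIndex k l t sim n) (κ : K n),
      ∃ D' : S.TrDistinguisher n, D'.size ≤ s n ∧ ∀ x w y, D'.prob id id x w y =
        if (fun i => y (Sum.inr (Sum.inl i))) = S.chal n (chosen q.1 q.2.1) then
          gameProb (D n) x w q.1 (mixedRun (sim n) q.1 q.2.1 q.2.2 x w (trRun y)) (E n κ)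
        else 0 := by
  obtain ⟨s₁, hs₁, h₁⟩ := PolyTime.exists_cost (J := K) hl.card_fin
    (f := fun n κ o ξ => E n κ ξ o) hE
  obtain ⟨s₂, hs₂, h₂⟩ := PolyTime.exists_cost (J := StepIndex k l t sim)
    (O := fun n => Fin (S.lenX n) ⊕ Fin (S.lenW n) ⊕ Pf S k n)
    (hS.1.card_fin.card_sum (hS.2.1.card_fin.card_sum (polyBounded_pf hk hS)))
    (f := fun n q o (u : Bits (CtxPos S n)) =>
      Sum.elim (fun i => u (Sum.inl i)) (Sum.elim (fun i => u (Sum.inr (Sum.inl i)))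
        (proofOf q.1 (fun i j => ctxRun q u i (Sum.inl j))
          (fun i j => ctxRun q u i (Sum.inr j)))) o)
    (.prod_sum (PolyTime.of_input (fun _ q => Sum.inl q.2) fun _ _ _ => rfl)
      (.prod_sum (PolyTime.of_input (fun _ q => Sum.inr (Sum.inl q.2)) fun _ _ _ => rfl)
        (polyTime_stepProof hk hl ht hS sim hsim)))
  obtain ⟨s₃, hs₃, h₃⟩ := PolyTime.exists_cost (J := fun n => StepIndex k l t sim n × K n)
    hl.card_fin (f := fun n q o (u : Bits (CtxPos S n ⊕ In S k n)) =>
        patchOracle (fun i => u (Sum.inl (Sum.inl i)))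
          (fun i j => ctxRun q.1 (fun m => u (Sum.inl m)) i (Sum.inl j)) q.1.1 (E n q.2)
          (fun s => u (Sum.inr s)) o) (polyTime_stepOracle hk hl ht hS sim hsim hE)
  obtain ⟨s₄, hs₄, h₄⟩ := polyTime_challengeTest hS
  let s : ℕ → ℕ := fun n => s₁ n + s₂ n + s₃ n + s₄ n
  have hs : PolyBounded s := ((hs₁.add hs₂).add hs₃).add hs₄
  refine ⟨fun n => ((D n).size + Fintype.card (Pf S k n) + Fintype.card (Fin (S.lenX n)) +
      Fintype.card (Fin (S.lenW n)) + 1) * (4 * s n + Fintype.card (Fin (l n)) + 1) * 5,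
    (((((hD.add (polyBounded_pf hk hS)).add hS.1.card_fin).add hS.2.1.card_fin).add
      (.const 1)).mul ((((PolyBounded.const 4).mul hs).add hl.card_fin).add (.const 1))).mul
      (.const 5), fun n q κ => ?_⟩
  obtain ⟨D', hsize, hprob⟩ := (D n).exists_simulation (s := s n) (Y := S.TrPos n) (E n κ)
    ((h₁ n κ).mono (by dsimp only [s]; omega))
    (fun u => proofOf q.1 (fun i j => ctxRun q u i (Sum.inl j)) fun i j => ctxRun q u i (Sum.inr j))
    ((h₂ n q).mono (by dsimp only [s]; omega))
    (fun u => patchOracle (fun i => u (Sum.inl i)) (fun i j => ctxRun q u i (Sum.inl j)) q.1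
      (E n κ))
    ((h₃ n (q, κ)).mono (by dsimp only [s]; omega))
    (fun y => decide ((fun i => y (Sum.inr (Sum.inl i))) = S.chal n (chosen q.1 q.2.1)))
    ((h₄ n _).mono (by dsimp only [s]; omega))
  refine ⟨D', hsize, fun x w y => ?_⟩
  rw [hprob]
  simp only [decide_eq_true_iff]
  rfl

end

end Fischlin

/-! ### Advantages against single transcripts and against proofs -/

namespace Fischlin

variable {S : ThreeRound} {k l t : ℕ → ℕ} {n : ℕ}

/-- A uniform challenge is the given one with probability `1 / N`. -/
theorem expect_ite_chal {c : ℕ} (hc : c < S.numCh n) (g : ℕ → ℝ) :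
    (S.numCh n : ℝ) * 𝔼 c' : Fin (S.numCh n), (if S.chal n c' = S.chal n c then g c' else 0) =
      g c := by
  have h1 : ∀ c' : Fin (S.numCh n), (if S.chal n c' = S.chal n c then g c' else 0) =
      if c' = ⟨c, hc⟩ then g c else 0 := by
    intro c'
    by_cases h : c' = ⟨c, hc⟩
    · simp [h]
    · rw [if_neg h, if_neg fun h' => h (Fin.ext (ThreeRound.chal_injective c'.2 hc h'))]
  have h2 : (S.numCh n : ℝ) ≠ 0 := by
    have : S.numCh n ≠ 0 := by omega
    exact_mod_cast this
  simp only [h1, Fintype.expect_eq_sum_div_card]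
  simp [mul_div_cancel₀ _ h2]

/-- Since the challenge of the transcript has to be the one found in repetition `j`, the advantage
against single transcripts is smaller by a factor `N`. -/
theorem stepAdvantage_eq (ht : t n + 2 ≤ S.numCh n)
    (sim : RandCircuit (Fin (S.lenX n) ⊕ Fin (S.numCh n).size) (RunPos S n))
    (D : ProofDistinguisher S k l n) (h : Answers k l t n) (j : Fin (k n))
    (ω : Fin (k n) → HybridCoins sim t) (H : Oracle S k l n) (D' : S.TrDistinguisher n)
    (hD' : ∀ x w y, D'.prob id id x w y =
      if (fun i => y (Sum.inr (Sum.inl i))) = S.chal n (chosen h j) then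
        gameProb D x w h (mixedRun sim h j ω x w (trRun y)) H else 0) :
    stepAdvantage sim D h j ω H = S.numCh n * (S.realProb n D' - S.simProb n sim D') := by
  classical
  have hc : (chosen h j : ℕ) < S.numCh n := (chosen h j).2.trans_le ht
  simp only [stepAdvantage, ThreeRound.realProb, ThreeRound.simProb, ← Finset.sum_sub_distrib,
    Finset.mul_sum]
  refine Finset.sum_congr rfl fun x _ => Finset.sum_congr rfl fun w _ => ?_
  by_cases hxw : S.rel n x w
  · simp only [hxw, if_true]
    rw [mul_sub]
    congr 1
    · rw [← expect_ite_chal hc fun c => 𝔼 r₁, 𝔼 r₂,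
        gameProb D x w h (mixedRun sim h j ω x w (honestRun x w c r₁ r₂)) H]
      congr 1
      refine Finset.expect_congr rfl fun c _ => ?_
      by_cases hcc : S.chal n c = S.chal n (chosen h j)
      · rw [if_pos hcc]
        refine Finset.expect_congr rfl fun r₁ _ => Finset.expect_congr rfl fun r₂ _ => ?_
        rw [hD']
        exact (if_pos hcc).symm
      · rw [if_neg hcc]
        refine (Finset.expect_eq_zero fun r₁ _ => Finset.expect_eq_zero fun r₂ _ => ?_).symm
        rw [hD']
        exact if_neg hcc
    · rw [← expect_ite_chal hc fun c => 𝔼 ρ,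
        gameProb D x w h (mixedRun sim h j ω x w (simRun sim x c ρ)) H]
      congr 1
      refine Finset.expect_congr rfl fun c _ => ?_
      by_cases hcc : S.chal n c = S.chal n (chosen h j)
      · rw [if_pos hcc]
        refine Finset.expect_congr rfl fun ρ _ => ?_
        rw [hD']
        refine Eq.trans ?_ (if_pos hcc).symm
        congr 2
        funext i
        rcases i with i | i <;> rfl
      · rw [if_neg hcc]
        refine (Finset.expect_eq_zero fun ρ _ => ?_).symm
        rw [hD']
        exact if_neg hcc
  · simp [hxw]

/-- Replacing the honest commitments and responses by simulated ones changes the game negligibly. -/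
theorem negligible_honestGame_sub_simGame (hk : PolyBounded k) (hl : PolyBounded l)
    (hN : PolyBounded S.numCh) (ht : ∀ n, t n + 2 ≤ S.numCh n) (hS : S.Efficient)
    (sim : ∀ n, RandCircuit (Fin (S.lenX n) ⊕ Fin (S.numCh n).size) (RunPos S n))
    (hsim : PolyBounded fun n => (sim n).size)
    (hZ : ∀ D : ∀ n, S.TrDistinguisher n, PolyBounded (fun n => (D n).size) →
      Negligible fun n => |S.realProb n (D n) - S.simProb n (sim n) (D n)|)
    (D : ∀ n, ProofDistinguisher S k l n) (hD : PolyBounded fun n => (D n).size) :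
    Negligible fun n => honestGame t (D n) - simGame t (sim n) (D n) := by
  have ht' : PolyBounded fun n => t n + 2 := hN.mono ht
  choose K hfin hne E hwise hcost using fun n =>
    exists_wiseIndep (In S k n) (Fin (l n)) (2 * (D n).size)
  have hI := polyBounded_in hk hS
  have hO := hl.card_fin
  have hE : PolyTime (J := fun n => K n × Fin (l n)) fun n q ξ => E n q.1 ξ q.2 := by
    refine ⟨_, (PolyBounded.const 1).add (((PolyBounded.const 2).mul hD).mul
      (hI.add ((hI.add (hO.add (.const 1))).mul
        ((((hI.add (hO.add (.const 1))).mul hI).mul (.const 6)).add (.const 3))))), fun n q => ?_⟩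
    exact (hcost n q.1).reindex fun _ => q.2
  obtain ⟨s, hs, hstep⟩ := exists_stepDistinguisher hk hl ht' hS sim hsim hE D hD
  choose D' hsize hprob using hstep
  -- For each security parameter, the hash values, coins and oracle key with the best advantage are
  -- built in.
  have hbest : ∀ n, ∃ B : S.TrDistinguisher n, B.size ≤ s n + 1 ∧
      ∀ (q : StepIndex k l t sim n) (κ : K n),
        |S.realProb n (D' n q κ) - S.simProb n (sim n) (D' n q κ)| ≤
          |S.realProb n B - S.simProb n (sim n) B| := by
    intro n
    rcases isEmpty_or_nonempty (StepIndex k l t sim n × K n) with h0 | h0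
    -- Without any value to fix, every distinguisher will do.
    · refine ⟨⟨1, 0, [], [], Sum.inl (Sum.inr (Sum.inr 0))⟩, ?_, fun q κ => h0.elim (q, κ)⟩
      simp [Distinguisher.size]
    · obtain ⟨⟨q₀, κ₀⟩, hmax⟩ := Finite.exists_max fun p : StepIndex k l t sim n × K n =>
        |S.realProb n (D' n p.1 p.2) - S.simProb n (sim n) (D' n p.1 p.2)|
      exact ⟨D' n q₀ κ₀, (hsize n q₀ κ₀).trans (Nat.le_succ _), fun q κ => hmax (q, κ)⟩
  choose B hBsize hB using hbest
  refine (hZ B ((hs.add (.const 1)).mono hBsize)).of_abs_le_polyBounded_mul (hk.mul hN)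
    fun n => ?_
  have hstep : ∀ (h : Answers k l t n) j ω κ, |stepAdvantage (sim n) (D n) h j ω (E n κ)| ≤
      S.numCh n * |S.realProb n (B n) - S.simProb n (sim n) (B n)| := by
    intro h j ω κ
    rw [stepAdvantage_eq (ht n) (sim n) (D n) h j ω (E n κ) _ (hprob n (h, j, ω) κ), abs_mul,
      Nat.abs_cast]
    exact mul_le_mul_of_nonneg_left (hB n (h, j, ω) κ) (Nat.cast_nonneg _)
  have := abs_honestGame_sub_simGame_le (sim n) (D n) (hwise n) le_rfl hstep
  rwa [abs_abs, Nat.cast_mul, mul_assoc]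

end Fischlin

theorem mainTheorem4 (S : ThreeRound) (k l t : ℕ → ℕ) (α : ℕ → ℝ)
    (hS : S.IsSigmaProtocol) (hU : S.UniqueResponses) (hZ : S.SHVZK)
    (hk : PolyBounded k) (hl : PolyBounded l) (hN : PolyBounded S.numCh)
    (ht : ∀ n, t n + 2 ≤ S.numCh n)
    (hα : S.HasCommitmentEntropy α)
    (hneg : Negligible fun n => (2 : ℝ) ^ (-((k n : ℝ) * α n))) :
    (fischlin S k l t).IsZeroKnowledge := by
  obtain ⟨sim, hsim, hZ⟩ := hZ
  obtain ⟨Sim, hSim, hprob⟩ :=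
    Fischlin.exists_simulator hk hl (hN.mono ht) hS.efficient sim hsim
  refine ⟨Sim, hSim, fun D hD => ?_⟩
  have h1 : Negligible fun n =>
      (fischlin S k l t).realProb n (D n) - Fischlin.honestGame t (D n) := by
    refine hneg.sqrt.of_abs_le_polyBounded_mul
      (((PolyBounded.const 16).mul hD).add (.const 2)) fun n => ?_
    have h0 : (0 : ℝ) < 2 ^ (-((k n : ℝ) * α n)) := by positivity
    have := Fischlin.abs_realProb_sub_honestGame_le hS.complete hU (ht n) (Real.sqrt_pos.2 h0)
      (fun x w hxw a => by
        rw [Real.sq_sqrt h0.le]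
        exact Fischlin.expect_comVec_eq_le ((hα n).2 x w hxw) a) (D n)
    rw [abs_of_nonneg (Real.sqrt_nonneg _)]
    push_cast
    exact this
  have h2 := Fischlin.negligible_honestGame_sub_simGame hk hl hN ht hS.efficient sim hsim hZ D hD
  refine (h1.add h2).of_abs_le_polyBounded_mul (PolyBounded.const 1) fun n => ?_
  rw [abs_abs, Nat.cast_one, one_mul, sub_add_sub_cancel]
  exact (congrArg (fun p => |(fischlin S k l t).realProb n (D n) - p|) (hprob n (D n))).le
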